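/- Let $k$ be an arbitrary field. All graded vector spaces are $\mathbb{Z}$-graded over $k$, $A=\bigoplus_{n\in\mathbb{Z}}A_n$, and tensor products of homogeneous maps follow the Koszul rule $(f\otimes g)(v\otimes w)=(-1)^{|g||v|}f(v)\otimes g(w)$. An $A_\infty$-algebra $(A,m)$ is a graded vector space $A$ with linear maps $m_n:A^{\otimes n}\to A$ of degree $n-2$ ($n\ge 1$) such that for all $n\ge1$ $$\sum_{\substack{r+s+t=n\\ s\ge 1,\ r,t\ge 0}}(-1)^{rs+t}\,m_{r+1+t}(\mathrm{id}^{\otimes r}\otimes m_s\otimes\mathrm{id}^{\otimes t})=0 .$$ In particular $m_1^2=0$; $H_*(A)$ denotes the (graded) homology of the chain complex $(A,m_1)$, and $[x]\otimes[y]\mapsto[m_2(x\otimes y)]$ is the induced product on it. A morphism of $A_\infty$-algebras $f:(A,m)\to(B,m')$ is a family of linear maps $f_n:A^{\otimes n}\to B$ of degree $n-1$ ($n\ge1$) such that for all $n\ge1$ $$\sum_{\substack{r+s+t=n\\ s\ge 1,\ r,t\ge 0}}(-1)^{rs+t}f_{r+1+t}(\mathrm{id}^{\otimes r}\otimes m_s\otimes\mathrm{id}^{\otimes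 t})=\sum_{\substack{i_1+\dots+i_r=n\\ r\ge 1,\ i_j\ge 1}}(-1)^{l(i_1,\dots,i_r)}m'_r(f_{i_1}\otimes\dots\otimes f_{i_r}),\qquad l(i_1,\dots,i_r)=\sum_{1\le j<l\le r}(i_l-1)\,i_j .$$ Morphisms compose by $(g\circ f)_n=\sum_{i_1+\dots+i_r=n}(-1)^{l(i_1,\dots,i_r)}g_r(f_{i_1}\otimes\dots\otimes f_{i_r})$; the identity morphism has $\mathrm{id}_1=\mathrm{id}$ and $\mathrm{id}_n=0$ for $n\ge2$; an isomorphism is a morphism with a two-sided inverse morphism. A morphism $f$ is a quasi-isomorphism if the chain map $f_1$ induces an isomorphism on homology. A minimal model of $(A,m)$ is an $A_\infty$-structure $m'$ on the graded vector space $H_*(A)$ with $m'_1=0$ and $m'_2$ the induced product, together with a quasi-isomorphism of $A_\infty$-algebras $i:(H_*(A),m')\to(A,m)$ such that $i_1$ induces the identity on homology, i.e. $i_1(x)$ is a cycle with class $x$ for every $x\in H_*(A)$. **Theorem (Kadeishvili).** Let $(A,m)$ be an $A_\infty$-algebra over $k$. Then $(A,m)$ has a minimal model $i:(H_*(A),m')\to(A,m)$.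 Moreover, the $A_\infty$-structure is unique up to isomorphism: if $i':(H_*(A),m')\to(A,m)$ and $i'':(H_*(A),m'')\to(A,m)$ are two minimal models of $(A,m)$, then $(H_*(A),m')$ and $(H_*(A),m'')$ are isomorphic as $A_\infty$-algebras. -/

import Mathlib

noncomputable section

namespace AInfinity

open scoped DirectSum

universe u v

section GradedSpaces

variable {k : Type u} [Field k]
variable {A : Type v} [AddCommGroup A] [Module k A]
variable {B : Type v} [AddCommGroup B] [Module k B]
variable {C : Type v} [AddCommGroup C] [Module k C]

/-- The sign involution of a `ℤ`-graded vector space: it is multiplication by `(-1) ^ n` on the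
component of degree `n`. Moving a map of degree `e` past `a` (Koszul rule) amounts to replacing
`a` by `signInv ^ e` applied to `a`. -/
def signInv (𝒜 : ℤ → Submodule k A) [DirectSum.Decomposition 𝒜] : A →ₗ[k] A :=
  DirectSum.toModule k ℤ A (fun n => (n.negOnePow : ℤ) • (𝒜 n).subtype) ∘ₗ
    (DirectSum.decomposeLinearEquiv 𝒜).toLinearMap

theorem signInv_of_mem (𝒜 : ℤ → Submodule k A) [DirectSum.Decomposition 𝒜] {n : ℤ} {a : A}
    (ha : a ∈ 𝒜 n) : signInv 𝒜 a = (n.negOnePow : ℤ) • a := by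
  have h := DirectSum.decomposeLinearEquiv_apply_coe 𝒜 n ⟨a, ha⟩
  simp only at h
  simp [signInv, h]

theorem signInv_signInv (𝒜 : ℤ → Submodule k A) [DirectSum.Decomposition 𝒜] (a : A) :
    signInv 𝒜 (signInv 𝒜 a) = a := by
  have : signInv 𝒜 ∘ₗ signInv 𝒜 = LinearMap.id := by
    refine DirectSum.decompose_lhom_ext 𝒜 fun i => ?_
    ext ⟨x, hx⟩
    simp only [LinearMap.comp_apply, Submodule.subtype_apply, signInv_of_mem 𝒜 hx, map_zsmul,
      LinearMap.id_apply]
    rcases Int.even_or_odd i with hi | hi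
    · simp [Int.negOnePow_even i hi]
    · simp [Int.negOnePow_odd i hi]
  exact LinearMap.congr_fun this a

/-- A family of linear maps `A^{⊗ n} → B`. Only the members with `n ≥ 1` are meaningful; the
member with `n = 0` is never used. -/
abbrev Family (k : Type u) [Field k] (A : Type v) [AddCommGroup A] [Module k A]
    (B : Type v) [AddCommGroup B] [Module k B] : Type v :=
  (n : ℕ) → MultilinearMap k (fun _ : Fin n => A) B

/-- `f n : A^{⊗ n} → B` is homogeneous of degree `n + e`, for all `n ≥ 1`. -/
def HasDegree (𝒜 : ℤ → Submodule k A) (ℬ : ℤ → Submodule k B) (f : Family k A B) (e : ℤ) :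
    Prop :=
  ∀ n : ℕ, 1 ≤ n → ∀ (d : Fin n → ℤ) (a : Fin n → A), (∀ i, a i ∈ 𝒜 (d i)) →
    f n a ∈ ℬ (∑ i, d i + (n + e))

/-- The value of `id^{⊗ r} ⊗ m_s ⊗ id^{⊗ t}` on `a 0 ⊗ ... ⊗ a (r + s + t - 1)`, as a pure tensor
of length `r + 1 + t`. As `m_s` has degree `s - 2`, the Koszul rule puts `signInv ^ s` on the
first `r` entries. -/
def insertAt (𝒜 : ℤ → Submodule k A) [DirectSum.Decomposition 𝒜] (m : Family k A A)
    (r s t : ℕ) (a : ℕ → A) : Fin (r + 1 + t) → A := fun i =>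
  if (i : ℕ) < r then (signInv 𝒜 ^ s) (a i)
  else if (i : ℕ) = r then m s (fun j : Fin s => a (r + j))
  else a (i + s - 1)

/-- `∑_{r + s + t = n, s ≥ 1} (-1)^{rs + t} f_{r+1+t} (id^{⊗ r} ⊗ m_s ⊗ id^{⊗ t})`, evaluated at
`a 0 ⊗ ... ⊗ a (n - 1)`. -/
def insertSum (𝒜 : ℤ → Submodule k A) [DirectSum.Decomposition 𝒜] (f : Family k A B)
    (m : Family k A A) (n : ℕ) (a : ℕ → A) : B :=
  ∑ s ∈ Finset.Icc 1 n, ∑ p ∈ Finset.HasAntidiagonal.antidiagonal (n - s),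
    (-1 : ℤ) ^ (p.1 * s + p.2) • f (p.1 + 1 + p.2) (insertAt 𝒜 m p.1 s p.2 a)

/-- The exponent `l(i_1, ..., i_r) = ∑_{j < l} (i_l - 1) i_j`. -/
def signExp {n : ℕ} (c : Composition n) : ℕ :=
  ∑ l : Fin c.length, ∑ j ∈ Finset.Iio l, (c.blocksFun l - 1) * c.blocksFun j

/-- `g_r (f_{i_1} ⊗ ... ⊗ f_{i_r})` for the composition `c = (i_1, ..., i_r)` of `n`, where
`f_i` has degree `i - 1`: the Koszul rule puts `signInv ^ (∑_{l > j} (i_l - 1))` on the entries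
of the `j`-th block. -/
def blockTerm (𝒜 : ℤ → Submodule k A) [DirectSum.Decomposition 𝒜] (g : Family k B C)
    (f : Family k A B) {n : ℕ} (c : Composition n) : MultilinearMap k (fun _ : Fin n => A) C :=
  ((g c.length).compMultilinearMap fun j : Fin c.length =>
    (f (c.blocksFun j)).compLinearMap fun _ =>
      signInv 𝒜 ^ (∑ l ∈ Finset.Ioi j, (c.blocksFun l - 1))).domDomCongr c.blocksFinEquiv

/-- `(g ∘ f)_n = ∑_{i_1 + ... + i_r = n} (-1)^{l(i_1, ..., i_r)} g_r (f_{i_1} ⊗ ... ⊗ f_{i_r})`,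
where `f_i` has degree `i - 1`. -/
def compose (𝒜 : ℤ → Submodule k A) [DirectSum.Decomposition 𝒜] (g : Family k B C)
    (f : Family k A B) : Family k A C := fun n =>
  ∑ c : Composition n, (-1 : ℤ) ^ signExp c • blockTerm 𝒜 g f c

/-- The identity family: the identity in arity one, zero in all other arities. -/
def idFamily (k : Type u) [Field k] (A : Type v) [AddCommGroup A] [Module k A] : Family k A A
  | 1 => MultilinearMap.ofSubsingleton k A A (0 : Fin 1) LinearMap.id
  | _ => 0

/-- The linear map given by the member of arity one. -/
def linPart (f : Family k A B) : A →ₗ[k] B :=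
  (MultilinearMap.ofSubsingleton k A B (0 : Fin 1)).symm (f 1)

theorem linPart_apply (f : Family k A B) (x : A) : linPart f x = f 1 (fun _ => x) := rfl

theorem insertSum_one (𝒜 : ℤ → Submodule k A) [DirectSum.Decomposition 𝒜] (f : Family k A B)
    (m : Family k A A) (a : ℕ → A) :
    insertSum 𝒜 f m 1 a = linPart f (linPart m (a 0)) := by
  simp only [insertSum, Finset.Icc_self, Finset.sum_singleton, Nat.sub_self,
    Finset.HasAntidiagonal.antidiagonal_zero, linPart_apply]
  simp only [Nat.zero_mul, Nat.zero_add, pow_zero, one_smul]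
  refine congrArg (f 1) (funext fun i => ?_)
  have hi : (i : ℕ) = 0 := by lia
  simp only [insertAt, hi, lt_self_iff_false, if_false, if_true]
  refine congrArg (m 1) (funext fun j => ?_)
  have : j = 0 := Subsingleton.elim _ _
  subst this
  rfl

theorem insertSum_two (𝒜 : ℤ → Submodule k A) [DirectSum.Decomposition 𝒜] (f : Family k A B)
    (m : Family k A A) (a : ℕ → A) :
    insertSum 𝒜 f m 2 a = linPart f (m 2 ![a 0, a 1])
      - f 2 ![linPart m (a 0), a 1] - f 2 ![signInv 𝒜 (a 0), linPart m (a 1)] := by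
  have e1 : insertAt 𝒜 m 0 1 1 a = ![linPart m (a 0), a 1] := by
    funext i
    fin_cases i
    · simp [insertAt, linPart_apply]
    · simp [insertAt]
  have e2 : insertAt 𝒜 m 1 1 0 a = ![signInv 𝒜 (a 0), linPart m (a 1)] := by
    funext i
    fin_cases i
    · simp [insertAt]
    · simp [insertAt, linPart_apply]
  have e3 : insertAt 𝒜 m 0 2 0 a = fun _ => m 2 ![a 0, a 1] := by
    funext i
    fin_cases i
    simp only [insertAt, lt_self_iff_false, if_false, if_true]
    refine congrArg (m 2) (funext fun j => ?_)
    fin_cases j <;> simp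
  have hI : Finset.Icc 1 2 = ({1, 2} : Finset ℕ) := by decide
  have hA : Finset.HasAntidiagonal.antidiagonal (2 - 1) = ({(0, 1), (1, 0)} : Finset (ℕ × ℕ)) := by decide
  rw [insertSum, hI, Finset.sum_pair (by decide), hA, Finset.sum_pair (by decide)]
  simp only [Nat.sub_self, Finset.HasAntidiagonal.antidiagonal_zero, Finset.sum_singleton, linPart_apply f]
  simp only [Nat.zero_mul, Nat.zero_add, Nat.add_zero, Nat.mul_one, pow_zero, pow_one, one_smul,
    neg_smul, Nat.reduceAdd, e1, e2, e3]
  abel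

theorem compose_one (𝒜 : ℤ → Submodule k A) [DirectSum.Decomposition 𝒜] (g : Family k B C)
    (f : Family k A B) (x : A) :
    compose 𝒜 g f 1 (fun _ => x) = linPart g (linPart f x) := by
  have key : ∀ (g : Family k B C) (f : Family k A B) (N : ℕ) (b : Fin N → ℕ) (e : Fin N → ℕ),
      N = 1 → (∀ j, b j = 1) → (∀ j, e j = 0) →
      (g N) (fun j => f (b j) (fun _ => (signInv 𝒜 ^ (e j)) x)) = linPart g (linPart f x) := by
    intro g f N b e hN hb he
    obtain rfl : b = fun _ => 1 := funext hb
    obtain rfl : e = fun _ => 0 := funext he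
    subst hN
    simp [linPart_apply]
  have hu : (Finset.univ : Finset (Composition 1)) = {Composition.ones 1} := by
    refine Finset.eq_singleton_iff_unique_mem.2 ⟨Finset.mem_univ _, fun c _ => ?_⟩
    rw [Composition.eq_ones_iff_length]
    have h1 := c.length_le
    have h2 : 0 < c.length := c.length_pos_iff.2 Nat.one_pos
    lia
  have hs : signExp (Composition.ones 1) = 0 := by
    simp [signExp]
  rw [compose, hu, Finset.sum_singleton, hs, pow_zero, one_smul]
  refine key g f _ (Composition.ones 1).blocksFun _ (Composition.ones_length 1)
    (fun j => Composition.ones_blocksFun 1 j) (fun j => ?_)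
  simp

end GradedSpaces

section Structures

variable {k : Type u} [Field k]
variable {A : Type v} [AddCommGroup A] [Module k A]
variable {B : Type v} [AddCommGroup B] [Module k B]

/-- An `A_∞`-algebra structure on the graded vector space `A = ⨁ 𝒜 n`: linear maps
`m_n : A^{⊗ n} → A` of degree `n - 2`, for `n ≥ 1`, with the higher associativity conditions. -/
structure Structure (𝒜 : ℤ → Submodule k A) [DirectSum.Decomposition 𝒜] where
  m : Family k A A
  degree : HasDegree 𝒜 𝒜 m (-2)
  assoc : ∀ n : ℕ, 1 ≤ n → ∀ a : ℕ → A, insertSum 𝒜 m m n a = 0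

variable {𝒜 : ℤ → Submodule k A} [DirectSum.Decomposition 𝒜]
variable {ℬ : ℤ → Submodule k B} [DirectSum.Decomposition ℬ]

/-- A morphism of `A_∞`-algebras: linear maps `f_n : A^{⊗ n} → B` of degree `n - 1`, for `n ≥ 1`,
with `∑ (-1)^{rs+t} f_{r+1+t} (id^{⊗ r} ⊗ m_s ⊗ id^{⊗ t})
  = ∑ (-1)^{l(i_1, ..., i_r)} m'_r (f_{i_1} ⊗ ... ⊗ f_{i_r})`. -/
structure Morphism (S : Structure 𝒜) (T : Structure ℬ) where
  f : Family k A B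
  degree : HasDegree 𝒜 ℬ f (-1)
  comm : ∀ n : ℕ, 1 ≤ n → ∀ a : ℕ → A,
    insertSum 𝒜 f S.m n a = compose 𝒜 T.m f n (fun i : Fin n => a i)

/-- Two `A_∞`-algebras are isomorphic: there are mutually inverse `A_∞`-morphisms. -/
def Isomorphic (S : Structure 𝒜) (T : Structure ℬ) : Prop :=
  ∃ (f : Morphism S T) (g : Morphism T S),
    (∀ n : ℕ, 1 ≤ n → compose 𝒜 g.f f.f n = idFamily k A n) ∧
    (∀ n : ℕ, 1 ≤ n → compose ℬ f.f g.f n = idFamily k B n)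

namespace Structure

variable (S : Structure 𝒜)

/-- The differential `m_1`. -/
def diff : A →ₗ[k] A := linPart S.m

theorem diff_diff (x : A) : S.diff (S.diff x) = 0 := by
  have h := S.assoc 1 le_rfl (fun _ => x)
  rwa [insertSum_one] at h

theorem diff_mem {n : ℤ} {x : A} (hx : x ∈ 𝒜 n) : S.diff x ∈ 𝒜 (n - 1) := by
  have h := S.degree 1 le_rfl (fun _ => n) (fun _ => x) (fun _ => hx)
  simp only [Finset.univ_unique, Finset.sum_const, Finset.card_singleton, one_smul,
    Nat.cast_one] at h
  exact h

theorem leibniz (x y : A) : S.diff (S.m 2 ![x, y]) =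
    S.m 2 ![S.diff x, y] + S.m 2 ![signInv 𝒜 x, S.diff y] := by
  have h := S.assoc 2 (by norm_num) (fun i => if i = 0 then x else y)
  rw [insertSum_two] at h
  simp only [if_true, one_ne_zero, if_false] at h
  rw [sub_sub, sub_eq_zero] at h
  exact h

theorem diff_signInv (x : A) : S.diff (signInv 𝒜 x) = - signInv 𝒜 (S.diff x) := by
  have : S.diff ∘ₗ signInv 𝒜 = - (signInv 𝒜 ∘ₗ S.diff) := by
    refine DirectSum.decompose_lhom_ext 𝒜 fun i => ?_
    ext ⟨y, hy⟩
    simp only [LinearMap.comp_apply, LinearMap.neg_apply, Submodule.subtype_apply,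
      signInv_of_mem 𝒜 hy, signInv_of_mem 𝒜 (S.diff_mem hy), map_zsmul]
    simp [Int.negOnePow_sub]
  exact LinearMap.congr_fun this x

/-- The cycles of the chain complex `(A, m_1)`. -/
def cycles : Submodule k A := LinearMap.ker S.diff

/-- The boundaries of the chain complex `(A, m_1)`, inside the cycles. -/
def boundaries : Submodule k S.cycles := (LinearMap.range S.diff).comap S.cycles.subtype

/-- The homology `H_*(A)` of the chain complex `(A, m_1)`. -/
abbrev Homology : Type v := S.cycles ⧸ S.boundaries

/-- The homology class of a cycle. -/
def cls : S.cycles →ₗ[k] S.Homology := S.boundaries.mkQ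

theorem mem_cycles {x : A} : x ∈ S.cycles ↔ S.diff x = 0 := LinearMap.mem_ker

theorem mem_boundaries {x : S.cycles} : x ∈ S.boundaries ↔ ∃ y, S.diff y = x := Iff.rfl

theorem cls_eq_zero {x : S.cycles} : S.cls x = 0 ↔ ∃ y, S.diff y = x := by
  rw [cls, Submodule.mkQ_apply, Submodule.Quotient.mk_eq_zero, mem_boundaries]

theorem cls_surjective : Function.Surjective S.cls := Submodule.mkQ_surjective _

/-- The grading of the homology: `H_n(A)` consists of the classes of cycles of degree `n`. -/
def homologyGrading (n : ℤ) : Submodule k S.Homology :=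
  ((𝒜 n).comap S.cycles.subtype).map S.cls

/-- The projection of `A` onto its component of degree `n`. -/
def proj (𝒜 : ℤ → Submodule k A) [DirectSum.Decomposition 𝒜] (n : ℤ) : A →ₗ[k] A :=
  (𝒜 n).subtype ∘ₗ DirectSum.component k ℤ (fun i => 𝒜 i) n ∘ₗ
    (DirectSum.decomposeLinearEquiv 𝒜).toLinearMap

theorem proj_apply (n : ℤ) (x : A) : proj 𝒜 n x = (DirectSum.decompose 𝒜 x n : A) := rfl

theorem diff_proj (n : ℤ) (x : A) : S.diff (proj 𝒜 n x) = proj 𝒜 (n - 1) (S.diff x) := by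
  have : S.diff ∘ₗ proj 𝒜 n = proj 𝒜 (n - 1) ∘ₗ S.diff := by
    refine DirectSum.decompose_lhom_ext 𝒜 fun i => ?_
    ext ⟨y, hy⟩
    simp only [LinearMap.comp_apply, Submodule.subtype_apply, proj_apply]
    by_cases h : i = n
    · subst h
      rw [DirectSum.decompose_of_mem_same 𝒜 hy,
        DirectSum.decompose_of_mem_same 𝒜 (S.diff_mem hy)]
    · rw [DirectSum.decompose_of_mem_ne 𝒜 hy h,
        DirectSum.decompose_of_mem_ne 𝒜 (S.diff_mem hy) (by lia), map_zero]
  exact LinearMap.congr_fun this x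

theorem proj_mem_cycles (n : ℤ) {x : A} (hx : x ∈ S.cycles) : proj 𝒜 n x ∈ S.cycles := by
  rw [mem_cycles] at hx ⊢
  rw [diff_proj, hx, map_zero]

/-- The projection of the homology onto its component of degree `n`. -/
def homologyProj (n : ℤ) : S.Homology →ₗ[k] S.Homology :=
  S.boundaries.mapQ S.boundaries
    ((proj 𝒜 n).restrict fun _ hx => S.proj_mem_cycles n hx) (by
      rintro x ⟨y, hy⟩
      refine ⟨proj 𝒜 (n + 1) y, ?_⟩
      rw [diff_proj, hy, add_sub_cancel_right]
      rfl)

theorem homologyProj_cls (n : ℤ) (x : S.cycles) :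
    S.homologyProj n (S.cls x) = S.cls ⟨proj 𝒜 n x, S.proj_mem_cycles n x.2⟩ := rfl

theorem homologyProj_of_mem {n : ℤ} {x : S.Homology} (hx : x ∈ S.homologyGrading n) :
    S.homologyProj n x = x := by
  obtain ⟨y, hy, rfl⟩ := hx
  rw [homologyProj_cls]
  exact congrArg _ (Subtype.ext (DirectSum.decompose_of_mem_same 𝒜 hy))

theorem homologyProj_of_mem_ne {n i : ℤ} (h : i ≠ n) {x : S.Homology}
    (hx : x ∈ S.homologyGrading i) : S.homologyProj n x = 0 := by
  obtain ⟨y, hy, rfl⟩ := hx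
  rw [homologyProj_cls]
  have : (⟨proj 𝒜 n y, S.proj_mem_cycles n y.2⟩ : S.cycles) = 0 :=
    Subtype.ext (DirectSum.decompose_of_mem_ne 𝒜 hy h)
  rw [this, map_zero]

/-- `H_*(A) = ⨁ H_n(A)`. -/
theorem homologyGrading_isInternal : DirectSum.IsInternal S.homologyGrading := by
  classical
  constructor
  · rw [injective_iff_map_eq_zero]
    intro z hz
    refine DFinsupp.ext fun n => Subtype.ext ?_
    have key : ∀ w : ⨁ i, S.homologyGrading i,
        S.homologyProj n (DirectSum.coeAddMonoidHom S.homologyGrading w) = w n := by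
      intro w
      induction w using DirectSum.induction_on with
      | zero => simp
      | of i x =>
        rw [DirectSum.coeAddMonoidHom_of]
        by_cases h : i = n
        · subst h
          rw [S.homologyProj_of_mem x.2, DirectSum.of_eq_same]
        · rw [S.homologyProj_of_mem_ne h x.2, DirectSum.of_eq_of_ne _ _ _ (Ne.symm h)]
          rfl
      | add x y hx hy => simp [hx, hy]
    rw [← key z, hz, map_zero]
    rfl
  · intro x
    obtain ⟨y, rfl⟩ := S.cls_surjective x
    refine ⟨∑ i ∈ (DirectSum.decompose 𝒜 (y : A)).support,
      DirectSum.of (fun i => S.homologyGrading i) i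
        ⟨S.cls ⟨proj 𝒜 i y, S.proj_mem_cycles i y.2⟩,
          ⟨_, (DirectSum.decompose 𝒜 (y : A) i).2, rfl⟩⟩, ?_⟩
    rw [map_sum]
    simp only [DirectSum.coeAddMonoidHom_of]
    rw [← map_sum]
    refine congrArg _ (Subtype.ext ?_)
    rw [AddSubmonoidClass.coe_finsetSum]
    exact DirectSum.sum_support_decompose 𝒜 (y : A)

instance homologyDecomposition : DirectSum.Decomposition S.homologyGrading :=
  S.homologyGrading_isInternal.chooseDecomposition

theorem mul_mem_cycles {x y : A} (hx : x ∈ S.cycles) (hy : y ∈ S.cycles) :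
    S.m 2 ![x, y] ∈ S.cycles := by
  rw [mem_cycles] at *
  rw [leibniz, hx, hy, (S.m 2).map_coord_zero 0 rfl, (S.m 2).map_coord_zero 1 rfl, add_zero]

theorem update_left {X : Type v} (x y z : X) : Function.update ![z, y] 0 x = ![x, y] := by
  ext i
  fin_cases i <;> simp

theorem update_right {X : Type v} (x y z : X) : Function.update ![x, z] 1 y = ![x, y] := by
  ext i
  fin_cases i <;> simp

/-- The product of two cycles, as a bilinear map. -/
def cycleMul : S.cycles →ₗ[k] S.cycles →ₗ[k] S.cycles :=
  LinearMap.mk₂ k (fun x y => ⟨S.m 2 ![x, y], S.mul_mem_cycles x.2 y.2⟩)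
    (fun x x' y => Subtype.ext <| by
      simpa only [update_left, Submodule.coe_add, Submodule.coe_smul] using
        (S.m 2).map_update_add ![0, (y : A)] 0 (x : A) (x' : A))
    (fun c x y => Subtype.ext <| by
      simpa only [update_left, Submodule.coe_add, Submodule.coe_smul] using
        (S.m 2).map_update_smul ![0, (y : A)] 0 c (x : A))
    (fun x y y' => Subtype.ext <| by
      simpa only [update_right, Submodule.coe_add, Submodule.coe_smul] using
        (S.m 2).map_update_add ![(x : A), 0] 1 (y : A) (y' : A))
    (fun c x y => Subtype.ext <| by
      simpa only [update_right, Submodule.coe_add, Submodule.coe_smul] using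
        (S.m 2).map_update_smul ![(x : A), 0] 1 c (y : A))

theorem cycleMul_coe (x y : S.cycles) : (S.cycleMul x y : A) = S.m 2 ![(x : A), (y : A)] := rfl

theorem cls_cycleMul_left (x y : S.cycles) (hx : x ∈ S.boundaries) :
    S.cls (S.cycleMul x y) = 0 := by
  obtain ⟨u, hu⟩ := hx
  have hu' : S.diff u = (x : A) := hu
  rw [cls_eq_zero]
  refine ⟨S.m 2 ![u, y], ?_⟩
  rw [leibniz, S.mem_cycles.1 y.2, (S.m 2).map_coord_zero (m := ![signInv 𝒜 u, 0]) 1 rfl,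
    add_zero, hu', cycleMul_coe]

theorem cls_cycleMul_right (x y : S.cycles) (hy : y ∈ S.boundaries) :
    S.cls (S.cycleMul x y) = 0 := by
  obtain ⟨u, hu⟩ := hy
  have hu' : S.diff u = (y : A) := hu
  rw [cls_eq_zero]
  refine ⟨S.m 2 ![signInv 𝒜 x, u], ?_⟩
  rw [leibniz, diff_signInv, S.mem_cycles.1 x.2, map_zero, neg_zero,
    (S.m 2).map_coord_zero (m := ![0, u]) 0 rfl, zero_add, signInv_signInv, hu', cycleMul_coe]

/-- The induced product `[x] ⊗ [y] ↦ [m_2 (x, y)]` on homology. -/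
def inducedProduct : S.Homology →ₗ[k] S.Homology →ₗ[k] S.Homology :=
  S.boundaries.liftQ
    (LinearMap.mk₂ k
      (fun (x : S.cycles) (y : S.Homology) =>
        S.boundaries.liftQ (S.cls ∘ₗ S.cycleMul x)
          (fun z hz => S.cls_cycleMul_right x z hz) y)
      (fun x x' y => by obtain ⟨y, rfl⟩ := S.cls_surjective y; simp [cls])
      (fun c x y => by obtain ⟨y, rfl⟩ := S.cls_surjective y; simp [cls])
      (fun x y y' => map_add _ y y')
      (fun c x y => map_smul _ c y))
    (fun x hx => by
      refine LinearMap.ext fun y => ?_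
      obtain ⟨y, rfl⟩ := S.cls_surjective y
      exact S.cls_cycleMul_left x y hx)

theorem inducedProduct_cls (x y : S.cycles) :
    S.inducedProduct (S.cls x) (S.cls y) = S.cls (S.cycleMul x y) := rfl

end Structure

namespace Morphism

variable {S : Structure 𝒜} {T : Structure ℬ} (φ : Morphism S T)

theorem linPart_diff (x : A) : linPart φ.f (S.diff x) = T.diff (linPart φ.f x) := by
  have h := φ.comm 1 le_rfl (fun _ => x)
  rwa [insertSum_one, compose_one] at h

/-- The map `H_*(A) → H_*(B)` that the chain map `f_1` induces. -/
def homologyMap : S.Homology →ₗ[k] T.Homology :=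
  S.boundaries.mapQ T.boundaries
    ((linPart φ.f).restrict (p := S.cycles) (q := T.cycles) fun x hx => by
      rw [Structure.mem_cycles] at hx ⊢
      rw [← linPart_diff, hx, map_zero])
    (by
      rintro x ⟨y, hy⟩
      refine ⟨linPart φ.f y, ?_⟩
      rw [← linPart_diff, hy]
      rfl)

/-- `φ` is a quasi-isomorphism: `f_1` induces an isomorphism on homology. -/
def IsQuasiIso : Prop := Function.Bijective φ.homologyMap

end Morphism

/-- A minimal model of the `A_∞`-algebra `(A, m)`: an `A_∞`-structure `m'` on `H_*(A)` with
`m'_1 = 0` and `m'_2` the induced product, and a quasi-isomorphism `i` from it to `(A, m)` such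
that `i_1` induces the identity on homology. As `m'_1 = 0`, all elements `x` of `H_*(A)` are cycles
for `m'_1`, and `H_*(A)` is identified with its own homology through `x ↦ cls x`. -/
structure MinimalModel (S : Structure 𝒜) where
  str : Structure S.homologyGrading
  m_one : str.m 1 = 0
  m_two : ∀ x y : S.Homology, str.m 2 ![x, y] = S.inducedProduct x y
  incl : Morphism str S
  quasiIso : incl.IsQuasiIso
  induces_id : ∀ x : str.cycles, incl.homologyMap (str.cls x) = (x : S.Homology)

end Structures

end AInfinity

end

/-!
The bar construction turns an `A_∞`-structure on `A` into a coderivation of square zero of the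
tensor coalgebra of the suspension of `A`, and `A_∞`-morphisms into maps of the resulting
differential graded coalgebras. Coderivations and coalgebra maps are determined by their
components with values in the cogenerators, and equations between them can be solved one word
length at a time.

Over a field, the complex `(A, m₁)` contracts onto its homology. This contraction extends to the
tensor coalgebras, and there the operations `m₂, m₃, …` perturb the differential. The homological
perturbation lemma turns the inclusion and the projection of the contraction into morphisms `I`
and `P` between `A` and its homology with a transferred structure, and `I` is a minimal model. For
any other minimal model `i`, the composite `P ∘ i` has the identity as its linear part, hence is
an isomorphism onto the transferred structure.
-/

noncomputable section

namespace AInfinity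

open scoped DirectSum TensorProduct
open TensorAlgebra

universe u v w

section TensorCoalgebra

variable {R : Type u} [CommSemiring R]
variable {A : Type v} [AddCommMonoid A] [Module R A]
variable {X : Type*} [AddCommMonoid X] [Module R X]

/-- The pure tensor `a₁ ⊗ ⋯ ⊗ aₙ` in the tensor algebra, for the list `[a₁, …, aₙ]`. -/
def word (R : Type u) [CommSemiring R] {A : Type v} [AddCommMonoid A] [Module R A]
    (l : List A) : TensorAlgebra R A := (l.map (ι R)).prod

@[simp] theorem word_nil : word R ([] : List A) = 1 := rfl

theorem word_cons (a : A) (l : List A) : word R (a :: l) = ι R a * word R l := by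
  simp [word]

theorem word_singleton (a : A) : word R [a] = ι R a := by simp [word]

theorem word_append (l l' : List A) : word R (l ++ l') = word R l * word R l' := by
  simp [word]

theorem tprod_eq_word {n : ℕ} (a : Fin n → A) :
    TensorAlgebra.tprod R A n a = word R (List.ofFn a) := by
  rw [TensorAlgebra.tprod_apply, word, List.map_ofFn]
  rfl

theorem span_word : Submodule.span R (Set.range (word R (A := A))) = ⊤ := by
  rw [eq_top_iff, ← Algebra.top_toSubmodule, ← TensorAlgebra.adjoin_range_ι,
    Algebra.adjoin_eq_span]
  refine Submodule.span_mono fun x hx => ?_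
  induction hx using Submonoid.closure_induction with
  | mem x hx =>
    obtain ⟨a, rfl⟩ := hx
    exact ⟨[a], word_singleton a⟩
  | one => exact ⟨[], rfl⟩
  | mul x y _ _ hx hy =>
    obtain ⟨l, rfl⟩ := hx
    obtain ⟨l', rfl⟩ := hy
    exact ⟨l ++ l', word_append l l'⟩

theorem ext_word {f g : TensorAlgebra R A →ₗ[R] X} (h : ∀ l, f (word R l) = g (word R l)) :
    f = g :=
  LinearMap.ext_on_range (v := word R (A := A)) span_word h

/-- The linear map on the tensor algebra given by a multilinear map in each arity. -/
def glue (f : (n : ℕ) → MultilinearMap R (fun _ : Fin n => A) X) : TensorAlgebra R A →ₗ[R] X :=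
  DirectSum.toModule R ℕ X (fun n => PiTensorProduct.lift (f n)) ∘ₗ
    TensorAlgebra.toDirectSum.toLinearMap

theorem glue_ofFn (f : (n : ℕ) → MultilinearMap R (fun _ : Fin n => A) X) {n : ℕ}
    (a : Fin n → A) : glue f (word R (List.ofFn a)) = f n a := by
  rw [← tprod_eq_word, glue, LinearMap.comp_apply, AlgHom.toLinearMap_apply,
    TensorAlgebra.toDirectSum_tensorPower_tprod, ← DirectSum.lof_eq_of R, DirectSum.toModule_lof,
    PiTensorProduct.lift.tprod]

theorem glue_word (f : (n : ℕ) → MultilinearMap R (fun _ : Fin n => A) X) (l : List A) :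
    glue f (word R l) = f l.length l.get := by
  rw [← glue_ofFn, List.ofFn_get]

/-- The deconcatenation coproduct `a₁ ⋯ aₙ ↦ ∑ᵢ a₁ ⋯ aᵢ ⊗ aᵢ₊₁ ⋯ aₙ` of the tensor algebra. -/
def deconcat : TensorAlgebra R A →ₗ[R] TensorAlgebra R A ⊗[R] TensorAlgebra R A :=
  glue fun n => ∑ i : Fin (n + 1),
    ((TensorAlgebra.tprod R A i).domCoprod (TensorAlgebra.tprod R A (n - i))).domDomCongr
      (finSumFinEquiv.trans (finCongr (Nat.add_sub_cancel' (Nat.le_of_lt_succ i.isLt))))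

theorem deconcat_word (l : List A) : deconcat (word R l) =
    ∑ i ∈ Finset.range (l.length + 1), word R (l.take i) ⊗ₜ word R (l.drop i) := by
  rw [deconcat, glue_word, sum_apply, Finset.sum_range]
  refine Finset.sum_congr rfl fun i _ => ?_
  simp only [MultilinearMap.domDomCongr_apply, MultilinearMap.domCoprod_apply, tprod_eq_word]
  congr 2
  · refine List.ext_getElem (by rw [List.length_ofFn, List.length_take]; lia) fun j _ _ => by simp
  · refine List.ext_getElem (by simp) fun j _ _ => by simp

theorem deconcat_ι_mul (a : A) (x : TensorAlgebra R A) :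
    deconcat (ι R a * x) = (ι R a ⊗ₜ 1) * deconcat x + 1 ⊗ₜ (ι R a * x) := by
  have : deconcat ∘ₗ LinearMap.mulLeft R (ι R a) =
      LinearMap.mulLeft R (ι R a ⊗ₜ 1) ∘ₗ deconcat +
        TensorProduct.mk R _ (TensorAlgebra R A) 1 ∘ₗ LinearMap.mulLeft R (ι R a) :=
    ext_word fun l => by
      simp only [LinearMap.comp_apply, LinearMap.add_apply, LinearMap.mulLeft_apply,
        TensorProduct.mk_apply, ← word_cons, deconcat_word, List.length_cons]
      rw [Finset.sum_range_succ', Finset.mul_sum]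
      simp [word_cons]
  exact LinearMap.congr_fun this x

theorem deconcat_coassoc (x : TensorAlgebra R A) :
    TensorProduct.assoc R _ _ _ (deconcat.rTensor _ (deconcat x)) =
      deconcat.lTensor _ (deconcat x) := by
  have : (TensorProduct.assoc R _ _ _).toLinearMap ∘ₗ deconcat.rTensor _ ∘ₗ deconcat (R := R) =
      deconcat.lTensor (TensorAlgebra R A) ∘ₗ deconcat := by
    refine ext_word fun l => ?_
    simp only [LinearMap.comp_apply, LinearEquiv.coe_coe, deconcat_word, map_sum,
      LinearMap.rTensor_tmul, LinearMap.lTensor_tmul, TensorProduct.sum_tmul,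
      TensorProduct.tmul_sum, TensorProduct.assoc_tmul, Finset.sum_sigma']
    refine Finset.sum_bij' (fun p _ => ⟨p.2, p.1 - p.2⟩) (fun q _ => ⟨q.1 + q.2, q.1⟩)
      ?_ ?_ ?_ ?_ ?_
    all_goals
      rintro ⟨i, j⟩ hij
      simp only [Finset.mem_sigma, Finset.mem_range, List.length_take, List.length_drop] at hij ⊢
    · lia
    · lia
    · rw [Nat.add_sub_cancel' (by lia)]
    · rw [Nat.add_sub_cancel_left]
    · rw [List.take_take, List.drop_take, List.drop_drop, Nat.add_sub_cancel' (by lia),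
        min_eq_left (by lia)]
  exact LinearMap.congr_fun this x

theorem algebraMapInv_word_cons (a : A) (l : List A) :
    algebraMapInv (word R (a :: l)) = 0 := by
  simp [word_cons, algebraMapInv]

theorem rTensor_counit_deconcat (x : TensorAlgebra R A) :
    (algebraMapInv (R := R)).toLinearMap.rTensor _ (deconcat x) = 1 ⊗ₜ x := by
  have : (algebraMapInv (R := R)).toLinearMap.rTensor _ ∘ₗ deconcat =
      TensorProduct.mk R R (TensorAlgebra R A) 1 := by
    refine ext_word fun l => ?_
    rw [LinearMap.comp_apply, deconcat_word, map_sum, Finset.sum_eq_single 0]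
    · simp
    · intro i hi h0
      obtain ⟨a, l', hl⟩ : ∃ a l', l.take i = a :: l' :=
        List.exists_cons_of_ne_nil fun h => by simp_all
      rw [hl, LinearMap.rTensor_tmul, AlgHom.toLinearMap_apply, algebraMapInv_word_cons,
        TensorProduct.zero_tmul]
    · simp
  exact LinearMap.congr_fun this x

theorem lTensor_counit_deconcat (x : TensorAlgebra R A) :
    (algebraMapInv (R := R)).toLinearMap.lTensor _ (deconcat x) = x ⊗ₜ 1 := by
  have : (algebraMapInv (R := R)).toLinearMap.lTensor _ ∘ₗ deconcat =
      (TensorProduct.mk R (TensorAlgebra R A) R).flip 1 := by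
    refine ext_word fun l => ?_
    rw [LinearMap.comp_apply, deconcat_word, map_sum, Finset.sum_eq_single l.length]
    · simp
    · intro i hi hne
      have hi' : i < l.length := lt_of_le_of_ne (Finset.mem_range_succ_iff.1 hi) hne
      rw [List.drop_eq_getElem_cons hi', LinearMap.lTensor_tmul, AlgHom.toLinearMap_apply,
        algebraMapInv_word_cons, TensorProduct.tmul_zero]
    · simp
  exact LinearMap.congr_fun this x

/-- The tensor coalgebra: the tensor algebra with the deconcatenation coproduct. -/
instance tensorCoalgebra : Coalgebra R (TensorAlgebra R A) where
  comul := deconcat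
  counit := algebraMapInv.toLinearMap
  coassoc := LinearMap.ext deconcat_coassoc
  rTensor_counit_comp_comul := LinearMap.ext rTensor_counit_deconcat
  lTensor_counit_comp_comul := LinearMap.ext lTensor_counit_deconcat

theorem comul_word (l : List A) : Coalgebra.comul (R := R) (word R l) =
    ∑ i ∈ Finset.range (l.length + 1), word R (l.take i) ⊗ₜ word R (l.drop i) :=
  deconcat_word l

theorem comul_ι_mul (a : A) (x : TensorAlgebra R A) :
    Coalgebra.comul (R := R) (ι R a * x) =
      (ι R a ⊗ₜ 1) * Coalgebra.comul (R := R) x + 1 ⊗ₜ (ι R a * x) :=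
  deconcat_ι_mul a x

theorem comul_one : Coalgebra.comul (R := R) (1 : TensorAlgebra R A) = 1 ⊗ₜ 1 := by
  simpa using comul_word (R := R) ([] : List A)

theorem counit_eq (x : TensorAlgebra R A) :
    Coalgebra.counit (R := R) x = algebraMapInv x := rfl

@[simp] theorem counit_one : Coalgebra.counit (R := R) (1 : TensorAlgebra R A) = 1 := by
  rw [counit_eq, map_one]

@[simp] theorem counit_ι (a : A) : Coalgebra.counit (R := R) (ι R a) = 0 :=
  lift_ι_apply _ a

@[simp] theorem counit_mul (x y : TensorAlgebra R A) : Coalgebra.counit (R := R) (x * y) =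
    Coalgebra.counit (R := R) x * Coalgebra.counit (R := R) y :=
  map_mul algebraMapInv x y

theorem counit_word_cons (a : A) (l : List A) :
    Coalgebra.counit (R := R) (word R (a :: l)) = 0 := algebraMapInv_word_cons a l

@[simp] theorem ιInv_ι (a : A) : ιInv (ι R a) = a := ι_leftInverse a

@[simp] theorem ιInv_one : ιInv (1 : TensorAlgebra R A) = 0 := by
  let : Module Rᵐᵒᵖ A := Module.compHom _ ((RingHom.id R).fromOpposite mul_comm)
  have : IsCentralScalar R A := ⟨fun _ _ => rfl⟩
  exact (congrArg TrivSqZeroExt.snd (map_one toTrivSqZeroExt)).trans TrivSqZeroExt.snd_one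

theorem ιInv_mul (x y : TensorAlgebra R A) : ιInv (x * y) =
    Coalgebra.counit (R := R) x • ιInv y + Coalgebra.counit (R := R) y • ιInv x := by
  let : Module Rᵐᵒᵖ A := Module.compHom _ ((RingHom.id R).fromOpposite mul_comm)
  have : IsCentralScalar R A := ⟨fun _ _ => rfl⟩
  have hfst : (TrivSqZeroExt.fstHom R R A).comp toTrivSqZeroExt =
      (algebraMapInv : TensorAlgebra R A →ₐ[R] R) := by
    ext a
    simp [algebraMapInv]
  have hfst' (z : TensorAlgebra R A) : (toTrivSqZeroExt z).fst = Coalgebra.counit (R := R) z :=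
    AlgHom.congr_fun hfst z
  simp [ιInv, ← hfst']

theorem ιInv_word_of_length_ne {l : List A} (h : l.length ≠ 1) : ιInv (word R l) = 0 := by
  match l, h with
  | [], _ => exact ιInv_one
  | [a], h => simp at h
  | a :: b :: l, _ => rw [word_cons, ιInv_mul, counit_word_cons, counit_ι, zero_smul, zero_smul,
      add_zero]

theorem ιInv_comp_ι : ιInv ∘ₗ ι R = (LinearMap.id : A →ₗ[R] A) := LinearMap.ext ιInv_ι

end TensorCoalgebra

/-- The convolution of two linear maps from the tensor coalgebra to an algebra. It is the product
of `WithConv`, as an operation on plain linear maps. -/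
def conv {R : Type u} [CommSemiring R] {A : Type v} [AddCommMonoid A] [Module R A]
    {S : Type*} [Semiring S] [Algebra R S] (f g : TensorAlgebra R A →ₗ[R] S) :
    TensorAlgebra R A →ₗ[R] S :=
  (WithConv.toConv f * WithConv.toConv g).ofConv

local notation:70 f:70 "⋆" g:71 => conv f g

section Convolution

variable {R : Type u} [CommSemiring R]
variable {A : Type v} [AddCommMonoid A] [Module R A]
variable {S : Type*} [Semiring S] [Algebra R S]
variable {T : Type*} [Semiring T] [Algebra R T]

/-- The unit of the convolution product. -/
def convUnit (R : Type u) [CommSemiring R] (A : Type v) [AddCommMonoid A] [Module R A]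
    (S : Type*) [Semiring S] [Algebra R S] : TensorAlgebra R A →ₗ[R] S :=
  Algebra.linearMap R S ∘ₗ Coalgebra.counit

theorem conv_word (f g : TensorAlgebra R A →ₗ[R] S) (l : List A) :
    (f ⋆ g) (word R l) = ∑ i ∈ Finset.range (l.length + 1),
      f (word R (l.take i)) * g (word R (l.drop i)) := by
  rw [conv, LinearMap.convMul_apply, comul_word]
  simp

theorem conv_assoc (f g h : TensorAlgebra R A →ₗ[R] S) : f ⋆ g ⋆ h = f ⋆ (g ⋆ h) :=
  congrArg WithConv.ofConv
    (mul_assoc (WithConv.toConv f) (WithConv.toConv g) (WithConv.toConv h))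

@[simp] theorem convUnit_conv (f : TensorAlgebra R A →ₗ[R] S) : convUnit R A S ⋆ f = f :=
  congrArg WithConv.ofConv (one_mul (WithConv.toConv f))

@[simp] theorem conv_convUnit (f : TensorAlgebra R A →ₗ[R] S) : f ⋆ convUnit R A S = f :=
  congrArg WithConv.ofConv (mul_one (WithConv.toConv f))

theorem conv_add (f g h : TensorAlgebra R A →ₗ[R] S) : f ⋆ (g + h) = f ⋆ g + f ⋆ h :=
  congrArg WithConv.ofConv
    (mul_add (WithConv.toConv f) (WithConv.toConv g) (WithConv.toConv h))

theorem add_conv (f g h : TensorAlgebra R A →ₗ[R] S) : (f + g) ⋆ h = f ⋆ h + g ⋆ h :=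
  congrArg WithConv.ofConv
    (add_mul (WithConv.toConv f) (WithConv.toConv g) (WithConv.toConv h))

theorem algHom_comp_conv (φ : S →ₐ[R] T) (f g : TensorAlgebra R A →ₗ[R] S) :
    φ.toLinearMap ∘ₗ (f ⋆ g) = (φ.toLinearMap ∘ₗ f) ⋆ (φ.toLinearMap ∘ₗ g) :=
  LinearMap.algHom_comp_convMul_distrib φ (WithConv.toConv f) (WithConv.toConv g)

theorem algHom_comp_convUnit (φ : S →ₐ[R] T) :
    φ.toLinearMap ∘ₗ convUnit R A S = convUnit R A T := by
  ext x
  simp [convUnit]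

@[simp] theorem convUnit_one : convUnit R A S 1 = 1 := by simp [convUnit]

theorem convUnit_word_of_ne {l : List A} (h : l ≠ []) : convUnit R A S (word R l) = 0 := by
  obtain ⟨a, l, rfl⟩ := List.exists_cons_of_ne_nil h
  rw [convUnit, LinearMap.comp_apply, counit_word_cons, map_zero]

/-- As `φ 1 = 0`, the value of `φ ⋆ Z` at a word only depends on `Z` at shorter words. -/
theorem mem_of_eq_add_conv {φ K Z : TensorAlgebra R A →ₗ[R] S} (hφ : φ 1 = 0)
    (hZ : Z = K + φ ⋆ Z) (Q : List A → Submodule R S) (hK : ∀ l, K (word R l) ∈ Q l)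
    (hQ : ∀ l l' y, y ∈ Q l' → φ (word R l) * y ∈ Q (l ++ l')) (l : List A) :
    Z (word R l) ∈ Q l := by
  induction hn : l.length using Nat.strong_induction_on generalizing l with
  | _ n ih =>
    rw [hZ, LinearMap.add_apply, conv_word]
    refine Submodule.add_mem _ (hK l) (Submodule.sum_mem _ fun i hi => ?_)
    rw [Finset.mem_range] at hi
    rcases Nat.eq_zero_or_pos i with rfl | h
    · simp [hφ]
    · have := hQ (l.take i) (l.drop i) _
        (ih (l.drop i).length (by rw [List.length_drop]; lia) _ rfl)
      rwa [List.take_append_drop] at this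

theorem eq_of_eq_add_conv {φ K Z Z' : TensorAlgebra R A →ₗ[R] S} (hφ : φ 1 = 0)
    (hZ : Z = K + φ ⋆ Z) (hZ' : Z' = K + φ ⋆ Z') : Z = Z' := by
  refine ext_word fun l => ?_
  induction hn : l.length using Nat.strong_induction_on generalizing l with
  | _ n ih =>
    rw [hZ, hZ', LinearMap.add_apply, LinearMap.add_apply, conv_word, conv_word]
    refine congrArg _ (Finset.sum_congr rfl fun i hi => ?_)
    rw [Finset.mem_range] at hi
    rcases Nat.eq_zero_or_pos i with rfl | h
    · simp [hφ]
    · rw [ih (l.drop i).length (by rw [List.length_drop]; lia) _ rfl]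

/-- The convolution power `φ ⋆ ⋯ ⋆ φ` with `n` factors. -/
def convPow (φ : TensorAlgebra R A →ₗ[R] S) (n : ℕ) : TensorAlgebra R A →ₗ[R] S :=
  (WithConv.toConv φ ^ n).ofConv

theorem convPow_zero (φ : TensorAlgebra R A →ₗ[R] S) : convPow φ 0 = convUnit R A S :=
  congrArg WithConv.ofConv (pow_zero (WithConv.toConv φ))

theorem convPow_succ (φ : TensorAlgebra R A →ₗ[R] S) (n : ℕ) :
    convPow φ (n + 1) = φ ⋆ convPow φ n :=
  congrArg WithConv.ofConv (pow_succ' (WithConv.toConv φ) n)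

theorem convPow_word_eq_zero {φ : TensorAlgebra R A →ₗ[R] S} (hφ : φ 1 = 0) {n : ℕ} {l : List A}
    (hl : l.length < n) : convPow φ n (word R l) = 0 := by
  induction n generalizing l with
  | zero => exact absurd hl (Nat.not_lt_zero _)
  | succ n ih =>
    rw [convPow_succ, conv_word]
    refine Finset.sum_eq_zero fun i _ => ?_
    rcases Nat.eq_zero_or_pos i with rfl | hi
    · rw [List.take_zero, word_nil, hφ, zero_mul]
    · by_cases hl' : l.length = 0
      · rw [List.length_eq_zero_iff.1 hl', List.take_nil, word_nil, hφ, zero_mul]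
      · rw [ih (by rw [List.length_drop]; lia), mul_zero]

/-- The geometric series `∑ₙ φ ⋆ ⋯ ⋆ φ`. It is the inverse of `1 - φ` for the convolution product
if `φ 1 = 0`: then only the first `n + 1` terms contribute to the words of length `n`. -/
def geomSeries (φ : TensorAlgebra R A →ₗ[R] S) : TensorAlgebra R A →ₗ[R] S :=
  glue fun n => (∑ i ∈ Finset.range (n + 1), convPow φ i).compMultilinearMap
    (TensorAlgebra.tprod R A n)

theorem geomSeries_word {φ : TensorAlgebra R A →ₗ[R] S} (hφ : φ 1 = 0) {N : ℕ} {l : List A}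
    (hl : l.length < N) :
    geomSeries φ (word R l) = ∑ i ∈ Finset.range N, convPow φ i (word R l) := by
  rw [geomSeries, glue_word, LinearMap.compMultilinearMap_apply, tprod_eq_word, List.ofFn_get,
    LinearMap.sum_apply]
  refine Finset.sum_subset (Finset.range_subset_range.2 hl) fun i _ hi => ?_
  exact convPow_word_eq_zero hφ (Nat.lt_of_succ_le (not_lt.1 (mt Finset.mem_range.2 hi)))

theorem geomSeries_eq {φ : TensorAlgebra R A →ₗ[R] S} (hφ : φ 1 = 0) :
    geomSeries φ = convUnit R A S + φ ⋆ geomSeries φ := by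
  refine ext_word fun l => ?_
  have hdrop (i : ℕ) : geomSeries φ (word R (l.drop i)) =
      ∑ j ∈ Finset.range (l.length + 1), convPow φ j (word R (l.drop i)) :=
    geomSeries_word hφ (by rw [List.length_drop]; lia)
  rw [geomSeries_word hφ (N := l.length + 1 + 1) (by lia), Finset.sum_range_succ', add_comm,
    LinearMap.add_apply, conv_word]
  simp only [convPow_zero, convPow_succ, conv_word, hdrop, Finset.mul_sum]
  rw [Finset.sum_comm]

end Convolution


section CoalgebraMaps

variable {R : Type u} [CommSemiring R]
variable {A : Type v} [AddCommMonoid A] [Module R A]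
variable {B : Type w} [AddCommMonoid B] [Module R B]
variable {C : Type*} [AddCommMonoid C] [Module R C]
variable {S : Type*} [Semiring S] [Algebra R S]

/-- A map of tensor coalgebras: it is compatible with the coproducts, the counits and the
coaugmentations. -/
structure IsCoalgHom (Φ : TensorAlgebra R A →ₗ[R] TensorAlgebra R B) : Prop where
  comul_comp : Coalgebra.comul ∘ₗ Φ = TensorProduct.map Φ Φ ∘ₗ Coalgebra.comul
  counit_comp : Coalgebra.counit ∘ₗ Φ = Coalgebra.counit
  map_one : Φ 1 = 1

/-- A coderivation along the coalgebra maps `Φ` and `Ψ`. The Koszul signs of a coderivation of odd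
degree are part of `Φ`. -/
structure IsCoder (Φ Ψ D : TensorAlgebra R A →ₗ[R] TensorAlgebra R B) : Prop where
  comul_comp : Coalgebra.comul ∘ₗ D =
    (TensorProduct.map Φ D + TensorProduct.map D Ψ) ∘ₗ Coalgebra.comul
  counit_comp : Coalgebra.counit ∘ₗ D = 0

/-- The coalgebra map with component `F : T(A) → B`, for `F 1 = 0`. -/
def hat (F : TensorAlgebra R A →ₗ[R] B) : TensorAlgebra R A →ₗ[R] TensorAlgebra R B :=
  geomSeries (ι R ∘ₗ F)

/-- The coderivation along `Φ` and `Ψ` with component `E : T(A) → B`. -/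
def coder (Φ : TensorAlgebra R A →ₗ[R] TensorAlgebra R B) (E : TensorAlgebra R A →ₗ[R] B)
    (Ψ : TensorAlgebra R A →ₗ[R] TensorAlgebra R B) : TensorAlgebra R A →ₗ[R] TensorAlgebra R B :=
  Φ ⋆ ((ι R ∘ₗ E) ⋆ Ψ)

theorem IsCoalgHom.conv_comp {Φ : TensorAlgebra R A →ₗ[R] TensorAlgebra R B} (hΦ : IsCoalgHom Φ)
    (f g : TensorAlgebra R B →ₗ[R] S) : (f ⋆ g) ∘ₗ Φ = (f ∘ₗ Φ) ⋆ (g ∘ₗ Φ) := by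
  change LinearMap.mul' R S ∘ₗ TensorProduct.map f g ∘ₗ Coalgebra.comul ∘ₗ Φ = _
  rw [hΦ.comul_comp, ← LinearMap.comp_assoc _ _ (TensorProduct.map f g),
    ← TensorProduct.map_comp]
  rfl

theorem IsCoder.conv_comp {Φ Ψ D : TensorAlgebra R A →ₗ[R] TensorAlgebra R B} (hD : IsCoder Φ Ψ D)
    (f g : TensorAlgebra R B →ₗ[R] S) :
    (f ⋆ g) ∘ₗ D = (f ∘ₗ Φ) ⋆ (g ∘ₗ D) + (f ∘ₗ D) ⋆ (g ∘ₗ Ψ) := by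
  change LinearMap.mul' R S ∘ₗ TensorProduct.map f g ∘ₗ Coalgebra.comul ∘ₗ D = _
  rw [hD.comul_comp, ← LinearMap.comp_assoc _ _ (TensorProduct.map f g), LinearMap.comp_add,
    ← TensorProduct.map_comp, ← TensorProduct.map_comp, LinearMap.add_comp, LinearMap.comp_add]
  rfl

theorem IsCoalgHom.convUnit_comp {Φ : TensorAlgebra R A →ₗ[R] TensorAlgebra R B}
    (hΦ : IsCoalgHom Φ) : convUnit R B S ∘ₗ Φ = convUnit R A S := by
  rw [convUnit, LinearMap.comp_assoc, hΦ.counit_comp, convUnit]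

theorem IsCoder.convUnit_comp {Φ Ψ D : TensorAlgebra R A →ₗ[R] TensorAlgebra R B}
    (hD : IsCoder Φ Ψ D) : convUnit R B S ∘ₗ D = 0 := by
  rw [convUnit, LinearMap.comp_assoc, hD.counit_comp, LinearMap.comp_zero]

theorem id_eq_convUnit_add_conv : (LinearMap.id : TensorAlgebra R A →ₗ[R] TensorAlgebra R A) =
    convUnit R A _ + (ι R ∘ₗ ιInv) ⋆ LinearMap.id := by
  refine ext_word fun l => ?_
  rw [LinearMap.add_apply, conv_word]
  rcases l with _ | ⟨a, l⟩
  · simp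
  rw [convUnit_word_of_ne (List.cons_ne_nil a l), zero_add, Finset.sum_eq_single 1]
  · simp [word_cons]
  · intro i hi h1
    have hi' : i < (a :: l).length + 1 := Finset.mem_range.1 hi
    rw [LinearMap.comp_apply, ιInv_word_of_length_ne (by rw [List.length_take]; lia), map_zero,
      zero_mul]
  · simp

theorem counit_comp_ι_conv (E : TensorAlgebra R A →ₗ[R] B)
    (Z : TensorAlgebra R A →ₗ[R] TensorAlgebra R B) :
    Coalgebra.counit ∘ₗ ((ι R ∘ₗ E) ⋆ Z) = 0 :=
  ext_word fun l => by
    rw [LinearMap.comp_apply, conv_word, map_sum]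
    simp

theorem comul_comp_ι_conv (E : TensorAlgebra R A →ₗ[R] B)
    (Z : TensorAlgebra R A →ₗ[R] TensorAlgebra R B) :
    Coalgebra.comul ∘ₗ ((ι R ∘ₗ E) ⋆ Z) =
      (Algebra.TensorProduct.includeLeft.toLinearMap ∘ₗ ι R ∘ₗ E) ⋆ (Coalgebra.comul ∘ₗ Z) +
        Algebra.TensorProduct.includeRight.toLinearMap ∘ₗ ((ι R ∘ₗ E) ⋆ Z) :=
  ext_word fun l => by
    rw [LinearMap.add_apply, conv_word]
    simp only [LinearMap.comp_apply, conv_word, map_sum, comul_ι_mul, Finset.sum_add_distrib]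
    simp

theorem comul_comp_convUnit :
    Coalgebra.comul ∘ₗ convUnit R A (TensorAlgebra R B) = convUnit R A _ := by
  ext x
  simp [convUnit, Algebra.algebraMap_eq_smul_one, comul_one, Algebra.TensorProduct.one_def]

theorem map_comp_comul (Φ Ψ : TensorAlgebra R A →ₗ[R] TensorAlgebra R B) :
    TensorProduct.map Φ Ψ ∘ₗ Coalgebra.comul =
      (Algebra.TensorProduct.includeLeft.toLinearMap ∘ₗ Φ) ⋆
        (Algebra.TensorProduct.includeRight.toLinearMap ∘ₗ Ψ) :=
  ext_word fun l => by
    rw [conv_word, LinearMap.comp_apply, comul_word]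
    simp

theorem ιInv_comp_convUnit : ιInv ∘ₗ convUnit R A (TensorAlgebra R B) = 0 := by
  ext x
  simp [convUnit, Algebra.algebraMap_eq_smul_one]

theorem ιInv_comp_conv (Φ Ψ : TensorAlgebra R A →ₗ[R] TensorAlgebra R B) :
    ιInv ∘ₗ (Φ ⋆ Ψ) =
      ((TensorProduct.lid R B).toLinearMap ∘ₗ
          TensorProduct.map (Coalgebra.counit ∘ₗ Φ) (ιInv ∘ₗ Ψ) +
        (TensorProduct.rid R B).toLinearMap ∘ₗ
          TensorProduct.map (ιInv ∘ₗ Φ) (Coalgebra.counit ∘ₗ Ψ)) ∘ₗ Coalgebra.comul :=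
  ext_word fun l => by
    rw [LinearMap.comp_apply, conv_word, LinearMap.comp_apply, comul_word, map_sum, map_sum]
    refine Finset.sum_congr rfl fun i _ => ?_
    simp [ιInv_mul]

theorem ιInv_comp_ι_conv {Ψ : TensorAlgebra R A →ₗ[R] TensorAlgebra R B}
    (hΨ : Coalgebra.counit ∘ₗ Ψ = Coalgebra.counit) (E : TensorAlgebra R A →ₗ[R] B) :
    ιInv ∘ₗ ((ι R ∘ₗ E) ⋆ Ψ) = E := by
  have hE : Coalgebra.counit ∘ₗ ι R ∘ₗ E = 0 := LinearMap.ext fun x => counit_ι (E x)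
  rw [ιInv_comp_conv, hE, hΨ, ← LinearMap.comp_assoc, ιInv_comp_ι, LinearMap.id_comp,
    TensorProduct.map_zero_left, LinearMap.comp_zero, zero_add, LinearMap.comp_assoc,
    ← LinearMap.rTensor_comp_lTensor, LinearMap.comp_assoc,
    Coalgebra.lTensor_counit_comp_comul]
  ext x
  simp

theorem ιInv_comp_conv_of_counit_comp_eq_zero {Φ Z : TensorAlgebra R A →ₗ[R] TensorAlgebra R B}
    (hΦ : Coalgebra.counit ∘ₗ Φ = Coalgebra.counit) (hZ : Coalgebra.counit ∘ₗ Z = 0) :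
    ιInv ∘ₗ (Φ ⋆ Z) = ιInv ∘ₗ Z := by
  rw [ιInv_comp_conv, hΦ, hZ, TensorProduct.map_zero_right, LinearMap.comp_zero, add_zero,
    LinearMap.comp_assoc, ← LinearMap.lTensor_comp_rTensor, LinearMap.comp_assoc,
    Coalgebra.rTensor_counit_comp_comul]
  ext x
  simp

section Hat

variable {F : TensorAlgebra R A →ₗ[R] B}

theorem hat_eq (h : F 1 = 0) : hat F = convUnit R A _ + (ι R ∘ₗ F) ⋆ hat F :=
  geomSeries_eq (by rw [LinearMap.comp_apply, h, map_zero])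

theorem hat_one (h : F 1 = 0) : hat F 1 = 1 := by
  rw [hat_eq h, ← word_nil, LinearMap.add_apply, conv_word]
  simp [h]

theorem counit_comp_hat (h : F 1 = 0) : Coalgebra.counit ∘ₗ hat F = Coalgebra.counit := by
  rw [hat_eq h, LinearMap.comp_add, counit_comp_ι_conv, add_zero]
  ext x
  simp [convUnit, counit_eq]

theorem isCoalgHom_hat (h : F 1 = 0) : IsCoalgHom (hat F) where
  comul_comp := by
    refine eq_of_eq_add_conv
      (φ := Algebra.TensorProduct.includeLeft.toLinearMap ∘ₗ ι R ∘ₗ F)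
      (K := Algebra.TensorProduct.includeRight.toLinearMap ∘ₗ hat F) (by simp [h]) ?_ ?_
    · conv_lhs => rw [hat_eq h, LinearMap.comp_add, comul_comp_ι_conv, comul_comp_convUnit]
      conv_rhs => enter [1]; rw [hat_eq h, LinearMap.comp_add, algHom_comp_convUnit]
      abel
    · conv_lhs => rw [map_comp_comul]
      conv_lhs => enter [1]; rw [hat_eq h, LinearMap.comp_add, algHom_comp_conv]
      rw [algHom_comp_convUnit, add_conv, convUnit_conv, conv_assoc, map_comp_comul]
  counit_comp := counit_comp_hat h
  map_one := hat_one h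

theorem ιInv_comp_hat (h : F 1 = 0) : ιInv ∘ₗ hat F = F := by
  rw [hat_eq h, LinearMap.comp_add, ιInv_comp_convUnit, zero_add,
    ιInv_comp_ι_conv (counit_comp_hat h)]

theorem ιInv_hat (h : F 1 = 0) (x : TensorAlgebra R A) : ιInv (hat F x) = F x :=
  LinearMap.congr_fun (ιInv_comp_hat h) x

theorem hat_ι (h : F 1 = 0) (a : A) : hat F (ι R a) = ι R (F (ι R a)) := by
  rw [← word_singleton, hat_eq h, LinearMap.add_apply, conv_word,
    convUnit_word_of_ne (List.cons_ne_nil _ _)]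
  simp [Finset.sum_range_succ, hat_one h, h]

theorem hat_word_pair (h : F 1 = 0) (a a' : A) :
    hat F (word R [a, a']) = word R [F (ι R a), F (ι R a')] + ι R (F (word R [a, a'])) := by
  rw [hat_eq h, LinearMap.add_apply, conv_word, convUnit_word_of_ne (List.cons_ne_nil _ _)]
  simp [Finset.sum_range_succ, hat_one h, h, hat_ι h, word_cons, word_nil]

end Hat

namespace IsCoalgHom

variable {Φ Ψ : TensorAlgebra R A →ₗ[R] TensorAlgebra R B}

theorem eq_add_conv (hΦ : IsCoalgHom Φ) : Φ = convUnit R A _ + (ι R ∘ₗ ιInv ∘ₗ Φ) ⋆ Φ := by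
  have h := congrArg (· ∘ₗ Φ) (id_eq_convUnit_add_conv (R := R) (A := B))
  simpa only [LinearMap.id_comp, LinearMap.add_comp, hΦ.conv_comp, LinearMap.comp_assoc,
    hΦ.convUnit_comp] using h

theorem ext (hΦ : IsCoalgHom Φ) (hΨ : IsCoalgHom Ψ) (h : ιInv ∘ₗ Φ = ιInv ∘ₗ Ψ) : Φ = Ψ := by
  refine eq_of_eq_add_conv (by simp [hΦ.map_one]) hΦ.eq_add_conv ?_
  rw [h]
  exact hΨ.eq_add_conv

theorem ιInv_comp_one (hΦ : IsCoalgHom Φ) : (ιInv ∘ₗ Φ) 1 = 0 := by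
  rw [LinearMap.comp_apply, hΦ.map_one, ιInv_one]

theorem eq_hat (hΦ : IsCoalgHom Φ) : Φ = hat (ιInv ∘ₗ Φ) :=
  hΦ.ext (isCoalgHom_hat hΦ.ιInv_comp_one) (ιInv_comp_hat hΦ.ιInv_comp_one).symm

theorem comp {Φ' : TensorAlgebra R B →ₗ[R] TensorAlgebra R C} (hΦ' : IsCoalgHom Φ')
    (hΦ : IsCoalgHom Φ) : IsCoalgHom (Φ' ∘ₗ Φ) where
  comul_comp := by
    rw [← LinearMap.comp_assoc, hΦ'.comul_comp, LinearMap.comp_assoc, hΦ.comul_comp,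
      TensorProduct.map_comp, LinearMap.comp_assoc]
  counit_comp := by rw [← LinearMap.comp_assoc, hΦ'.counit_comp, hΦ.counit_comp]
  map_one := by rw [LinearMap.comp_apply, hΦ.map_one, hΦ'.map_one]

theorem id : IsCoalgHom (LinearMap.id : TensorAlgebra R A →ₗ[R] TensorAlgebra R A) where
  comul_comp := by rw [TensorProduct.map_id, LinearMap.id_comp, LinearMap.comp_id]
  counit_comp := LinearMap.comp_id _
  map_one := rfl

end IsCoalgHom

theorem hat_comp_hat {G : TensorAlgebra R B →ₗ[R] C} {F : TensorAlgebra R A →ₗ[R] B}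
    (hG : G 1 = 0) (hF : F 1 = 0) : hat G ∘ₗ hat F = hat (G ∘ₗ hat F) := by
  rw [((isCoalgHom_hat hG).comp (isCoalgHom_hat hF)).eq_hat, ← LinearMap.comp_assoc,
    ιInv_comp_hat hG]

theorem hat_ιInv : hat ιInv = (LinearMap.id : TensorAlgebra R A →ₗ[R] _) :=
  IsCoalgHom.id.eq_hat.symm

end CoalgebraMaps

section Coderivations

variable {R : Type u} [CommSemiring R]
variable {A : Type v} [AddCommMonoid A] [Module R A]
variable {B : Type w} [AddCommMonoid B] [Module R B]
variable {C : Type*} [AddCommMonoid C] [Module R C]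
variable {Φ Ψ : TensorAlgebra R A →ₗ[R] TensorAlgebra R B}

theorem coder_eq (hΦ : IsCoalgHom Φ) (E : TensorAlgebra R A →ₗ[R] B) :
    coder Φ E Ψ = (ι R ∘ₗ E) ⋆ Ψ + (ι R ∘ₗ ιInv ∘ₗ Φ) ⋆ coder Φ E Ψ := by
  conv_lhs => rw [coder, hΦ.eq_add_conv, add_conv, convUnit_conv, conv_assoc]
  rfl

theorem counit_comp_coder (hΦ : IsCoalgHom Φ) (E : TensorAlgebra R A →ₗ[R] B) :
    Coalgebra.counit ∘ₗ coder Φ E Ψ = 0 := by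
  rw [coder_eq hΦ, LinearMap.comp_add, counit_comp_ι_conv, counit_comp_ι_conv, add_zero]

theorem isCoder_coder (hΦ : IsCoalgHom Φ) (hΨ : IsCoalgHom Ψ) (E : TensorAlgebra R A →ₗ[R] B) :
    IsCoder Φ Ψ (coder Φ E Ψ) where
  counit_comp := counit_comp_coder hΦ E
  comul_comp := by
    set D := coder Φ E Ψ with hD
    have hΨ' := hΨ.comul_comp.trans (map_comp_comul Ψ Ψ)
    refine eq_of_eq_add_conv
      (φ := Algebra.TensorProduct.includeLeft.toLinearMap ∘ₗ ι R ∘ₗ ιInv ∘ₗ Φ)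
      (K := (Algebra.TensorProduct.includeLeft.toLinearMap ∘ₗ ι R ∘ₗ E) ⋆ (Coalgebra.comul ∘ₗ Ψ) +
        Algebra.TensorProduct.includeRight.toLinearMap ∘ₗ D) (by simp [hΦ.map_one]) ?_ ?_
    · conv_lhs =>
        rw [hD, coder_eq hΦ, LinearMap.comp_add, comul_comp_ι_conv, comul_comp_ι_conv, ← hD]
      conv_rhs => enter [1, 2]; rw [hD, coder_eq hΦ, LinearMap.comp_add, ← hD]
      abel
    · conv_lhs => rw [LinearMap.add_comp, map_comp_comul, map_comp_comul]
      conv_lhs => enter [1, 1]; rw [hΦ.eq_add_conv, LinearMap.comp_add, algHom_comp_conv]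
      conv_lhs =>
        enter [2, 1]; rw [hD, coder_eq hΦ, LinearMap.comp_add, algHom_comp_conv, algHom_comp_conv]
      rw [algHom_comp_convUnit, add_conv, add_conv, convUnit_conv, conv_assoc, conv_assoc, hΨ',
        conv_assoc, LinearMap.add_comp, conv_add, map_comp_comul, map_comp_comul]
      abel

theorem ιInv_comp_coder (hΦ : IsCoalgHom Φ) (hΨ : IsCoalgHom Ψ) (E : TensorAlgebra R A →ₗ[R] B) :
    ιInv ∘ₗ coder Φ E Ψ = E := by
  rw [coder, ιInv_comp_conv_of_counit_comp_eq_zero hΦ.counit_comp (counit_comp_ι_conv E Ψ),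
    ιInv_comp_ι_conv hΨ.counit_comp]

namespace IsCoder

variable {D D' : TensorAlgebra R A →ₗ[R] TensorAlgebra R B}

theorem eq_add_conv (hD : IsCoder Φ Ψ D) :
    D = (ι R ∘ₗ ιInv ∘ₗ D) ⋆ Ψ + (ι R ∘ₗ ιInv ∘ₗ Φ) ⋆ D := by
  have h := congrArg (· ∘ₗ D) (id_eq_convUnit_add_conv (R := R) (A := B))
  rw [add_comm]
  simpa only [LinearMap.id_comp, LinearMap.add_comp, hD.conv_comp, LinearMap.comp_assoc,
    hD.convUnit_comp, zero_add] using h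

theorem ext (hΦ : IsCoalgHom Φ) (hD : IsCoder Φ Ψ D) (hD' : IsCoder Φ Ψ D')
    (h : ιInv ∘ₗ D = ιInv ∘ₗ D') : D = D' := by
  refine eq_of_eq_add_conv (by simp [hΦ.map_one]) hD.eq_add_conv ?_
  rw [h]
  exact hD'.eq_add_conv

theorem zero : IsCoder Φ Ψ 0 where
  comul_comp := by simp
  counit_comp := LinearMap.comp_zero _

theorem add (hD : IsCoder Φ Ψ D) (hD' : IsCoder Φ Ψ D') : IsCoder Φ Ψ (D + D') where
  comul_comp := by
    rw [LinearMap.comp_add, hD.comul_comp, hD'.comul_comp, TensorProduct.map_add_left,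
      TensorProduct.map_add_right, ← LinearMap.add_comp, add_add_add_comm]
  counit_comp := by rw [LinearMap.comp_add, hD.counit_comp, hD'.counit_comp, add_zero]

theorem comp_left {Θ : TensorAlgebra R B →ₗ[R] TensorAlgebra R C} (hΘ : IsCoalgHom Θ)
    (hD : IsCoder Φ Ψ D) : IsCoder (Θ ∘ₗ Φ) (Θ ∘ₗ Ψ) (Θ ∘ₗ D) where
  comul_comp := by
    rw [← LinearMap.comp_assoc, hΘ.comul_comp, LinearMap.comp_assoc, hD.comul_comp,
      TensorProduct.map_comp, TensorProduct.map_comp, ← LinearMap.comp_add, LinearMap.comp_assoc]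
  counit_comp := by rw [← LinearMap.comp_assoc, hΘ.counit_comp, hD.counit_comp]

theorem comp_right {Θ : TensorAlgebra R C →ₗ[R] TensorAlgebra R A} (hΘ : IsCoalgHom Θ)
    (hD : IsCoder Φ Ψ D) : IsCoder (Φ ∘ₗ Θ) (Ψ ∘ₗ Θ) (D ∘ₗ Θ) where
  comul_comp := by
    rw [← LinearMap.comp_assoc, hD.comul_comp, LinearMap.comp_assoc, hΘ.comul_comp,
      TensorProduct.map_comp, TensorProduct.map_comp, ← LinearMap.add_comp, LinearMap.comp_assoc]
  counit_comp := by rw [← LinearMap.comp_assoc, hD.counit_comp, LinearMap.zero_comp]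

variable {Φ' Ψ' E : TensorAlgebra R B →ₗ[R] TensorAlgebra R C}

theorem comul_comp_comp (hE : IsCoder Φ' Ψ' E) (hD : IsCoder Φ Ψ D) :
    Coalgebra.comul ∘ₗ E ∘ₗ D =
      (TensorProduct.map (Φ' ∘ₗ Φ) (E ∘ₗ D) + TensorProduct.map (E ∘ₗ D) (Ψ' ∘ₗ Ψ) +
        (TensorProduct.map (Φ' ∘ₗ D) (E ∘ₗ Ψ) + TensorProduct.map (E ∘ₗ Φ) (Ψ' ∘ₗ D))) ∘ₗ
          Coalgebra.comul := by
  rw [← LinearMap.comp_assoc, hE.comul_comp, LinearMap.comp_assoc, hD.comul_comp,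
    ← LinearMap.comp_assoc]
  simp only [LinearMap.add_comp, LinearMap.comp_add, ← TensorProduct.map_comp]
  abel

theorem counit_comp_comp (hE : IsCoder Φ' Ψ' E) (D : TensorAlgebra R A →ₗ[R] TensorAlgebra R B) :
    Coalgebra.counit ∘ₗ E ∘ₗ D = 0 := by
  rw [← LinearMap.comp_assoc, hE.counit_comp, LinearMap.zero_comp]

/-- The composite of two coderivations is a second-order operator; the hypothesis is the vanishing
of its symbol. -/
theorem comp (hE : IsCoder Φ' Ψ' E) (hD : IsCoder Φ Ψ D)
    (h : TensorProduct.map (Φ' ∘ₗ D) (E ∘ₗ Ψ) + TensorProduct.map (E ∘ₗ Φ) (Ψ' ∘ₗ D) = 0) :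
    IsCoder (Φ' ∘ₗ Φ) (Ψ' ∘ₗ Ψ) (E ∘ₗ D) where
  comul_comp := by rw [hE.comul_comp_comp hD, h, add_zero]
  counit_comp := hE.counit_comp_comp D

end IsCoder

end Coderivations

section SignedCoderivations

variable {R : Type u} [CommRing R]
variable {A : Type v} [AddCommMonoid A] [Module R A]
variable {B : Type w} [AddCommMonoid B] [Module R B]
variable {Φ Ψ D D' : TensorAlgebra R A →ₗ[R] TensorAlgebra R B}

theorem map_add_map_neg (f g : TensorAlgebra R A →ₗ[R] TensorAlgebra R B) :
    TensorProduct.map f g + TensorProduct.map (-f) g = 0 := by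
  rw [← TensorProduct.map_add_left, add_neg_cancel, TensorProduct.map_zero_left]

theorem IsCoalgHom.isCoder_sub (hΦ : IsCoalgHom Φ) (hΨ : IsCoalgHom Ψ) :
    IsCoder Φ Ψ (Φ - Ψ) := by
  rw [sub_eq_add_neg, ← neg_one_smul R Ψ]
  exact
    { comul_comp := by
        rw [LinearMap.comp_add, LinearMap.comp_smul, hΦ.comul_comp, hΨ.comul_comp,
          ← LinearMap.smul_comp, ← LinearMap.add_comp, TensorProduct.map_add_right,
          TensorProduct.map_add_left, TensorProduct.map_smul_left, TensorProduct.map_smul_right]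
        congr 1
        module
      counit_comp := by
        rw [LinearMap.comp_add, LinearMap.comp_smul, hΦ.counit_comp, hΨ.counit_comp]
        module }

namespace IsCoder

theorem neg (hD : IsCoder Φ Ψ D) : IsCoder Φ Ψ (-D) := by
  rw [← neg_one_smul R D]
  exact
    { comul_comp := by
        rw [LinearMap.comp_smul, hD.comul_comp, TensorProduct.map_smul_left,
          TensorProduct.map_smul_right, ← smul_add, LinearMap.smul_comp]
      counit_comp := by rw [LinearMap.comp_smul, hD.counit_comp, smul_zero] }

theorem comp_self {Φ Ψ D : TensorAlgebra R A →ₗ[R] TensorAlgebra R A} (hD : IsCoder Φ Ψ D)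
    (hΦ : D ∘ₗ Φ = -(Φ ∘ₗ D)) (hΨ : D ∘ₗ Ψ = Ψ ∘ₗ D) :
    IsCoder (Φ ∘ₗ Φ) (Ψ ∘ₗ Ψ) (D ∘ₗ D) :=
  hD.comp hD (by rw [hΦ, hΨ, map_add_map_neg])

theorem anticommutator {Φ₁ Φ₂ Ψ₁ Ψ₂ D₁ D₂ : TensorAlgebra R A →ₗ[R] TensorAlgebra R A}
    (h₁ : IsCoder Φ₁ Ψ₁ D₁) (h₂ : IsCoder Φ₂ Ψ₂ D₂)
    (hΦ : Φ₁ ∘ₗ Φ₂ = Φ₂ ∘ₗ Φ₁) (hΨ : Ψ₁ ∘ₗ Ψ₂ = Ψ₂ ∘ₗ Ψ₁)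
    (hDΦ₁ : D₁ ∘ₗ Φ₂ = -(Φ₂ ∘ₗ D₁)) (hDΦ₂ : D₂ ∘ₗ Φ₁ = -(Φ₁ ∘ₗ D₂))
    (hDΨ₁ : D₁ ∘ₗ Ψ₂ = Ψ₂ ∘ₗ D₁) (hDΨ₂ : D₂ ∘ₗ Ψ₁ = Ψ₁ ∘ₗ D₂) :
    IsCoder (Φ₁ ∘ₗ Φ₂) (Ψ₁ ∘ₗ Ψ₂) (D₁ ∘ₗ D₂ + D₂ ∘ₗ D₁) where
  comul_comp := by
    have cancel₁ := map_add_map_neg (Φ₁ ∘ₗ D₂) (Ψ₂ ∘ₗ D₁)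
    have cancel₂ := map_add_map_neg (Φ₂ ∘ₗ D₁) (Ψ₁ ∘ₗ D₂)
    rw [LinearMap.comp_add, h₁.comul_comp_comp h₂, h₂.comul_comp_comp h₁, hDΦ₁, hDΦ₂, hDΨ₁, hDΨ₂,
      hΦ, hΨ, TensorProduct.map_add_left, TensorProduct.map_add_right, ← LinearMap.add_comp]
    refine congrArg (· ∘ₗ Coalgebra.comul) (.trans ?_ (add_zero _))
    rw [← add_zero (0 : _ →ₗ[R] _)]
    nth_rewrite 1 [← cancel₁]
    rw [← cancel₂]
    abel
  counit_comp := by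
    rw [LinearMap.comp_add, h₁.counit_comp_comp, h₂.counit_comp_comp, add_zero]

end IsCoder

end SignedCoderivations

section Filtration

variable {R : Type u} [CommSemiring R]
variable {A : Type v} [AddCommMonoid A] [Module R A]
variable {B : Type w} [AddCommMonoid B] [Module R B]
variable {C : Type*} [AddCommMonoid C] [Module R C]
variable {X : Type*} [AddCommMonoid X] [Module R X]
variable {S : Type*} [Semiring S] [Algebra R S]

/-- The map of tensor algebras induced by a linear map. -/
def tmap (f : A →ₗ[R] B) : TensorAlgebra R A →ₗ[R] TensorAlgebra R B :=
  (TensorAlgebra.lift R (ι R ∘ₗ f)).toLinearMap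

@[simp] theorem tmap_word (f : A →ₗ[R] B) (l : List A) :
    tmap f (word R l) = word R (l.map f) := by
  simp [tmap, word, map_list_prod, Function.comp_def]

theorem tmap_comp (g : B →ₗ[R] C) (f : A →ₗ[R] B) : tmap g ∘ₗ tmap f = tmap (g ∘ₗ f) :=
  ext_word fun l => by simp

theorem tmap_id : tmap (LinearMap.id : A →ₗ[R] A) = LinearMap.id :=
  ext_word fun l => by simp

theorem isCoalgHom_tmap (f : A →ₗ[R] B) : IsCoalgHom (tmap f) where
  comul_comp := ext_word fun l => by simp [comul_word, List.map_take, List.map_drop]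
  counit_comp := ext_word fun l => by
    rw [LinearMap.comp_apply, tmap_word]
    cases l <;> simp only [List.map_nil, List.map_cons, word_nil, counit_one, counit_word_cons]
  map_one := map_one (TensorAlgebra.lift R (ι R ∘ₗ f))

theorem ιInv_comp_tmap (f : A →ₗ[R] B) : ιInv ∘ₗ tmap f = f ∘ₗ ιInv :=
  ext_word fun l => by
    rw [LinearMap.comp_apply, LinearMap.comp_apply, tmap_word]
    by_cases h : l.length = 1
    · obtain ⟨a, rfl⟩ := List.length_eq_one_iff.1 h
      simp [word_singleton]
    · rw [ιInv_word_of_length_ne h, ιInv_word_of_length_ne (by rwa [List.length_map]), map_zero]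

/-- A linear map that is zero on all words of length less than `n`. -/
def VanishesBelow (n : ℕ) (f : TensorAlgebra R A →ₗ[R] X) : Prop :=
  ∀ l : List A, l.length < n → f (word R l) = 0

namespace VanishesBelow

variable {m n : ℕ} {f g : TensorAlgebra R A →ₗ[R] X}

theorem zero (f : TensorAlgebra R A →ₗ[R] X) : VanishesBelow 0 f :=
  fun _ h => absurd h (Nat.not_lt_zero _)

theorem mono (h : VanishesBelow n f) (hmn : m ≤ n) : VanishesBelow m f :=
  fun l hl => h l (hl.trans_le hmn)

theorem add (hf : VanishesBelow n f) (hg : VanishesBelow n g) : VanishesBelow n (f + g) :=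
  fun l hl => by rw [LinearMap.add_apply, hf l hl, hg l hl, add_zero]

theorem comp {Y : Type*} [AddCommMonoid Y] [Module R Y] (hf : VanishesBelow n f)
    (g : X →ₗ[R] Y) : VanishesBelow n (g ∘ₗ f) :=
  fun l hl => by rw [LinearMap.comp_apply, hf l hl, map_zero]

theorem conv {f g : TensorAlgebra R A →ₗ[R] S} (hf : VanishesBelow m f)
    (hg : VanishesBelow n g) : VanishesBelow (m + n) (f ⋆ g) := fun l hl => by
  rw [conv_word]
  refine Finset.sum_eq_zero fun i hi => ?_
  rw [Finset.mem_range] at hi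
  by_cases h : i < m
  · rw [hf _ (by rw [List.length_take]; lia), zero_mul]
  · rw [hg _ (by rw [List.length_drop]; lia), mul_zero]

theorem eq_zero (h : ∀ n, VanishesBelow n f) : f = 0 :=
  ext_word fun l => h (l.length + 1) l (Nat.lt_succ_self _)

theorem of_map_one (h : f 1 = 0) : VanishesBelow 1 f := fun l hl => by
  rw [List.length_eq_zero_iff.1 (Nat.lt_one_iff.1 hl), word_nil, h]

end VanishesBelow

/-- The span of the words of length at most `n`. -/
def lengthLE (R : Type u) [CommSemiring R] (A : Type v) [AddCommMonoid A] [Module R A] (n : ℤ) :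
    Submodule R (TensorAlgebra R A) :=
  Submodule.span R {x | ∃ l : List A, (l.length : ℤ) ≤ n ∧ word R l = x}

theorem word_mem_lengthLE {l : List A} {n : ℤ} (h : (l.length : ℤ) ≤ n) :
    word R l ∈ lengthLE R A n := Submodule.subset_span ⟨l, h, rfl⟩

theorem lengthLE_of_neg {n : ℤ} (hn : n < 0) : lengthLE R A n = ⊥ :=
  Submodule.span_eq_bot.2 fun _ ⟨_, hl, _⟩ => absurd (hl.trans_lt hn) (Int.natCast_nonneg _).not_gt

theorem mul_mem_lengthLE {m n : ℤ} {x y : TensorAlgebra R A} (hx : x ∈ lengthLE R A m)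
    (hy : y ∈ lengthLE R A n) : x * y ∈ lengthLE R A (m + n) := by
  have hxy := Submodule.mul_mem_mul hx hy
  rw [lengthLE, lengthLE, Submodule.span_mul_span] at hxy
  refine Submodule.span_mono ?_ hxy
  rintro _ ⟨_, ⟨l, hl, rfl⟩, _, ⟨l', hl', rfl⟩, rfl⟩
  exact ⟨l ++ l', by push_cast [List.length_append]; lia, word_append l l'⟩

theorem exists_mem_lengthLE (x : TensorAlgebra R A) : ∃ n : ℕ, x ∈ lengthLE R A n := by
  have hx : x ∈ Submodule.span R (Set.range (word R)) := by rw [span_word]; trivial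
  have mono {m n : ℕ} (h : m ≤ n) : lengthLE R A m ≤ lengthLE R A n :=
    Submodule.span_mono fun _ ⟨l, hl, hx⟩ => ⟨l, hl.trans (Int.ofNat_le.2 h), hx⟩
  induction hx using Submodule.span_induction with
  | mem x hx =>
    obtain ⟨l, rfl⟩ := hx
    exact ⟨l.length, word_mem_lengthLE le_rfl⟩
  | zero => exact ⟨0, Submodule.zero_mem _⟩
  | add x y _ _ hx hy =>
    obtain ⟨m, hm⟩ := hx
    obtain ⟨n, hn⟩ := hy
    exact ⟨max m n, Submodule.add_mem _ (mono (le_max_left m n) hm) (mono (le_max_right m n) hn)⟩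
  | smul c x _ hx =>
    obtain ⟨n, hn⟩ := hx
    exact ⟨n, Submodule.smul_mem _ c hn⟩

/-- A linear map between tensor algebras that lowers the length of words by at least `c`. -/
def Lowers (c : ℤ) (f : TensorAlgebra R A →ₗ[R] TensorAlgebra R B) : Prop :=
  ∀ l : List A, f (word R l) ∈ lengthLE R B (l.length - c)

namespace Lowers

variable {c c' : ℤ} {f g : TensorAlgebra R A →ₗ[R] TensorAlgebra R B}

theorem map_mem (hf : Lowers c f) {n : ℤ} {x : TensorAlgebra R A} (hx : x ∈ lengthLE R A n) :
    f x ∈ lengthLE R B (n - c) := by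
  refine Submodule.span_le (p := (lengthLE R B (n - c)).comap f).2 ?_ hx
  rintro _ ⟨l, hl, rfl⟩
  refine Submodule.span_mono ?_ (hf l)
  exact fun _ ⟨l', hl', hx⟩ => ⟨l', by lia, hx⟩

theorem comp {f : TensorAlgebra R B →ₗ[R] TensorAlgebra R C} (hf : Lowers c f)
    (hg : Lowers c' g) : Lowers (c' + c) (f ∘ₗ g) := fun l => by
  rw [← sub_sub]
  exact hf.map_mem (hg l)

theorem conv (hf : Lowers c f) (hg : Lowers c' g) : Lowers (c + c') (f ⋆ g) := fun l => by
  rw [conv_word]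
  refine Submodule.sum_mem _ fun i hi => ?_
  have hlen : ((l.take i).length - c + ((l.drop i).length - c') : ℤ) = l.length - (c + c') := by
    rw [Finset.mem_range] at hi
    simp only [List.length_take, List.length_drop]
    lia
  exact hlen ▸ mul_mem_lengthLE (hf (l.take i)) (hg (l.drop i))

theorem ι_comp {n : ℕ} {F : TensorAlgebra R A →ₗ[R] B} (hF : VanishesBelow n F) :
    Lowers (n - 1) (ι R ∘ₗ F) := fun l => by
  by_cases h : l.length < n
  · rw [LinearMap.comp_apply, hF l h, map_zero]
    exact Submodule.zero_mem _
  · rw [LinearMap.comp_apply, ← word_singleton]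
    exact word_mem_lengthLE (by rw [List.length_singleton]; lia)

theorem tmap (f : A →ₗ[R] B) : Lowers 0 (tmap f) := fun l => by
  rw [tmap_word]
  exact word_mem_lengthLE (by simp)

theorem id : Lowers 0 (LinearMap.id : TensorAlgebra R A →ₗ[R] _) := by
  rw [← tmap_id]
  exact .tmap _

theorem coder {n : ℕ} {E : TensorAlgebra R A →ₗ[R] B} (hf : Lowers 0 f) (hg : Lowers 0 g)
    (hE : VanishesBelow n E) : Lowers (n - 1) (coder f E g) := by
  have := hf.conv ((Lowers.ι_comp hE).conv hg)
  rwa [add_zero, zero_add] at this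

end Lowers

theorem VanishesBelow.comp_lowers {n : ℕ} {F : TensorAlgebra R B →ₗ[R] X}
    (h : VanishesBelow n F) {c : ℕ} {G : TensorAlgebra R A →ₗ[R] TensorAlgebra R B}
    (hG : Lowers c G) : VanishesBelow (n + c) (F ∘ₗ G) := fun l hl => by
  refine Submodule.span_le (p := LinearMap.ker F).2 ?_ (hG l)
  rintro _ ⟨l', hl', rfl⟩
  exact h l' (by lia)

theorem eq_zero_of_eq_comp_lowers {F : TensorAlgebra R A →ₗ[R] X}
    {f : TensorAlgebra R A →ₗ[R] TensorAlgebra R A} (hf : Lowers 1 f) (hF : F = F ∘ₗ f) : F = 0 :=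
  VanishesBelow.eq_zero fun n => by
    induction n with
    | zero => exact .zero F
    | succ n ih => exact hF ▸ ih.comp_lowers (c := 1) hf

theorem eq_zero_of_eq_lowers_comp {F : X →ₗ[R] TensorAlgebra R A}
    {f : TensorAlgebra R A →ₗ[R] TensorAlgebra R A} (hf : Lowers 1 f) (hF : F = f ∘ₗ F) :
    F = 0 := by
  ext x
  obtain ⟨n, hn⟩ := exists_mem_lengthLE (F x)
  have hmem (m : ℕ) : F x ∈ lengthLE R A (n - m) := by
    induction m with
    | zero => simpa using hn
    | succ m ih =>
      rw [hF, Nat.cast_succ, ← sub_sub]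
      exact hf.map_mem ih
  have hbot := lengthLE_of_neg (R := R) (A := A) (n := n - (n + 1 : ℕ)) (by lia)
  exact (Submodule.mem_bot R).1 (hbot ▸ hmem (n + 1))

end Filtration

section Limits

variable {R : Type u} [CommRing R]
variable {A : Type v} [AddCommMonoid A] [Module R A]
variable {B : Type w} [AddCommGroup B] [Module R B]
variable {X : Type*} [AddCommGroup X] [Module R X]
variable {S : Type*} [Ring S] [Algebra R S]

theorem conv_sub (f g h : TensorAlgebra R A →ₗ[R] S) : f ⋆ (g - h) = f ⋆ g - f ⋆ h :=
  congrArg WithConv.ofConv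
    (mul_sub (WithConv.toConv f) (WithConv.toConv g) (WithConv.toConv h))

theorem sub_conv (f g h : TensorAlgebra R A →ₗ[R] S) : (f - g) ⋆ h = f ⋆ h - g ⋆ h :=
  congrArg WithConv.ofConv
    (sub_mul (WithConv.toConv f) (WithConv.toConv g) (WithConv.toConv h))

theorem VanishesBelow.sub {n : ℕ} {f g : TensorAlgebra R A →ₗ[R] X} (hf : VanishesBelow n f)
    (hg : VanishesBelow n g) : VanishesBelow n (f - g) :=
  fun l hl => by rw [LinearMap.sub_apply, hf l hl, hg l hl, sub_zero]

theorem exists_limit (s : ℕ → TensorAlgebra R A →ₗ[R] X)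
    (hs : ∀ n, VanishesBelow n (s (n + 1) - s n)) :
    ∃ f : TensorAlgebra R A →ₗ[R] X, ∀ n, VanishesBelow n (f - s n) := by
  let f := glue fun n => (s (n + 1)).compMultilinearMap (TensorAlgebra.tprod R A n)
  have hf (l : List A) : f (word R l) = s (l.length + 1) (word R l) := by
    rw [glue_word, LinearMap.compMultilinearMap_apply, tprod_eq_word, List.ofFn_get]
  refine ⟨f, fun n l hl => ?_⟩
  rw [LinearMap.sub_apply, hf, sub_eq_zero]
  induction n, hl using Nat.le_induction with
  | base => rfl
  | succ n hn ih => rw [ih, ← sub_eq_zero.1 (hs n l hn)]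

/-- The contraction principle for the filtration by word length. -/
theorem exists_fixedPoint (Θ : (TensorAlgebra R A →ₗ[R] X) → TensorAlgebra R A →ₗ[R] X)
    (P : (TensorAlgebra R A →ₗ[R] X) → Prop) (h0 : P 0) (hP : ∀ f, P f → P (Θ f))
    (hlim : ∀ f, (∀ n, ∃ g, P g ∧ VanishesBelow n (f - g)) → P f)
    (hΘ : ∀ n f g, P f → P g → VanishesBelow n (f - g) → VanishesBelow (n + 1) (Θ f - Θ g)) :
    ∃ f, P f ∧ Θ f = f := by
  have hiter (n : ℕ) : P (Θ^[n] 0) := by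
    induction n with
    | zero => exact h0
    | succ n ih => rw [Function.iterate_succ_apply']; exact hP _ ih
  obtain ⟨f, hf⟩ := exists_limit (fun n => Θ^[n] 0) fun n => by
    induction n with
    | zero => exact .zero _
    | succ n ih =>
      simp only [Function.iterate_succ_apply'] at ih ⊢
      exact hΘ _ _ _ (hP _ (hiter n)) (hiter n) ih
  have hPf : P f := hlim f fun n => ⟨_, hiter n, hf n⟩
  refine ⟨f, hPf, sub_eq_zero.1 (VanishesBelow.eq_zero fun n => ?_)⟩
  have hΘf := hΘ n f _ hPf (hiter n) (hf n)
  have hsucc := hf (n + 1)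
  rw [Function.iterate_succ_apply'] at hsucc
  simpa using (hΘf.sub hsucc).mono (Nat.le_succ n)

variable {F G : TensorAlgebra R A →ₗ[R] B}

theorem hat_sub_hat_eq (hF : F 1 = 0) (hG : G 1 = 0) :
    hat F - hat G = (ι R ∘ₗ (F - G)) ⋆ hat F + (ι R ∘ₗ G) ⋆ (hat F - hat G) := by
  conv_lhs => rw [hat_eq hF, hat_eq hG]
  rw [LinearMap.comp_sub, sub_conv, conv_sub]
  abel

theorem VanishesBelow.hat_sub_hat (hF : F 1 = 0) (hG : G 1 = 0) {n : ℕ}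
    (h : VanishesBelow n (F - G)) : VanishesBelow n (hat F - hat G) := by
  have hle (m : ℕ) (hm : m ≤ n) : VanishesBelow m (hat F - hat G) := by
    induction m with
    | zero => exact .zero _
    | succ m ih =>
      rw [hat_sub_hat_eq hF hG]
      refine .add (((h.comp (ι R)).conv (.zero (hat F))).mono hm) ?_
      rw [add_comm m]
      exact ((VanishesBelow.of_map_one hG).comp (ι R)).conv (ih (by lia))
  exact hle n le_rfl

theorem VanishesBelow.hat_sub_hat_sub (hF : F 1 = 0) (hG : G 1 = 0) {n : ℕ}
    (h : VanishesBelow n (F - G)) :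
    VanishesBelow (n + 1) (hat F - hat G - ι R ∘ₗ (F - G)) := by
  have hdecomp : hat F - hat G - ι R ∘ₗ (F - G) =
      (ι R ∘ₗ (F - G)) ⋆ (hat F - convUnit R A _) + (ι R ∘ₗ G) ⋆ (hat F - hat G) := by
    conv_lhs => rw [hat_sub_hat_eq hF hG]
    rw [conv_sub _ _ (convUnit R A _), conv_convUnit]
    abel
  have hunit : VanishesBelow 1 (hat F - convUnit R A _) := .of_map_one (by simp [hat_one hF])
  rw [hdecomp]
  refine .add ((h.comp (ι R)).conv hunit) ?_
  rw [add_comm n]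
  exact ((VanishesBelow.of_map_one hG).comp (ι R)).conv (hat_sub_hat hF hG h)

theorem VanishesBelow.comp_hat_sub_comp_hat (hF : F 1 = 0) (hG : G 1 = 0) {n : ℕ}
    (h : VanishesBelow n (F - G)) {L : TensorAlgebra R B →ₗ[R] X} (hL : L ∘ₗ ι R = 0) :
    VanishesBelow (n + 1) (L ∘ₗ hat F - L ∘ₗ hat G) := by
  have := (hat_sub_hat_sub hF hG h).comp L
  rwa [LinearMap.comp_sub, ← LinearMap.comp_assoc, hL, LinearMap.zero_comp, sub_zero,
    LinearMap.comp_sub] at this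

end Limits

section Degrees

variable {R : Type u} [CommSemiring R]
variable {A : Type v} [AddCommMonoid A] [Module R A]
variable {B : Type w} [AddCommMonoid B] [Module R B]
variable {X Y : Type*} [AddCommMonoid X] [Module R X] [AddCommMonoid Y] [Module R Y]

/-- The entries of `l` are homogeneous, of the degrees listed in `ds`. -/
abbrev HasDegrees (𝒜 : ℤ → Submodule R A) (l : List A) (ds : List ℤ) : Prop :=
  List.Forall₂ (fun a d => a ∈ 𝒜 d) l ds

/-- The grading of the suspension: an element of degree `n` gets degree `n + 1`. -/
def suspension (𝒜 : ℤ → Submodule R A) (n : ℤ) : Submodule R A := 𝒜 (n - 1)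

/-- The grading of the tensor algebra on the suspension: a word `a₁ ⋯ aₙ` has degree
`∑ (|aᵢ| + 1)`. -/
def barGrading (𝒜 : ℤ → Submodule R A) (n : ℤ) : Submodule R (TensorAlgebra R A) :=
  Submodule.span R {x | ∃ l ds, HasDegrees 𝒜 l ds ∧ ds.sum + l.length = n ∧ word R l = x}

/-- A linear map on the tensor algebra of the suspension of `A`, homogeneous of degree `e`. -/
def BarHomogeneous (𝒜 : ℤ → Submodule R A) (𝒳 : ℤ → Submodule R X) (e : ℤ)
    (F : TensorAlgebra R A →ₗ[R] X) : Prop :=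
  ∀ l ds, HasDegrees 𝒜 l ds → F (word R l) ∈ 𝒳 (ds.sum + l.length + e)

variable {𝒜 : ℤ → Submodule R A} {ℬ : ℤ → Submodule R B}
variable {𝒳 : ℤ → Submodule R X} {𝒴 : ℤ → Submodule R Y}

theorem HasDegrees.take_drop {l : List A} {ds : List ℤ} (h : HasDegrees 𝒜 l ds) (i : ℕ) :
    HasDegrees 𝒜 (l.take i) (ds.take i) ∧ HasDegrees 𝒜 (l.drop i) (ds.drop i) :=
  ⟨List.forall₂_take i h, List.forall₂_drop i h⟩

theorem word_mem_barGrading {l : List A} {ds : List ℤ} (h : HasDegrees 𝒜 l ds) :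
    word R l ∈ barGrading 𝒜 (ds.sum + l.length) := Submodule.subset_span ⟨l, ds, h, rfl, rfl⟩

theorem mul_mem_barGrading {m n : ℤ} {x y : TensorAlgebra R A} (hx : x ∈ barGrading 𝒜 m)
    (hy : y ∈ barGrading 𝒜 n) : x * y ∈ barGrading 𝒜 (m + n) := by
  have hxy := Submodule.mul_mem_mul hx hy
  rw [barGrading, barGrading, Submodule.span_mul_span] at hxy
  refine Submodule.span_mono ?_ hxy
  rintro _ ⟨_, ⟨l, ds, hl, rfl, rfl⟩, _, ⟨l', ds', hl', rfl, rfl⟩, rfl⟩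
  exact ⟨l ++ l', ds ++ ds', List.rel_append hl hl',
    by push_cast [List.length_append, List.sum_append]; ring, word_append l l'⟩

theorem ι_mem_barGrading {n : ℤ} {a : A} (h : a ∈ suspension 𝒜 n) : ι R a ∈ barGrading 𝒜 n := by
  have ha : HasDegrees 𝒜 [a] [n - 1] := .cons h .nil
  simpa [word_singleton] using word_mem_barGrading ha

theorem BarHomogeneous.map_mem {e : ℤ} {F : TensorAlgebra R A →ₗ[R] X}
    (hF : BarHomogeneous 𝒜 𝒳 e F) {n : ℤ} {x : TensorAlgebra R A} (hx : x ∈ barGrading 𝒜 n) :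
    F x ∈ 𝒳 (n + e) := by
  refine Submodule.span_le (p := (𝒳 (n + e)).comap F).2 ?_ hx
  rintro _ ⟨l, ds, hl, rfl, rfl⟩
  exact hF l ds hl

namespace BarHomogeneous

variable {e e' e'' : ℤ}

theorem zero : BarHomogeneous 𝒜 𝒳 e 0 := fun _ _ _ => Submodule.zero_mem _

theorem add {F G : TensorAlgebra R A →ₗ[R] X} (hF : BarHomogeneous 𝒜 𝒳 e F)
    (hG : BarHomogeneous 𝒜 𝒳 e G) : BarHomogeneous 𝒜 𝒳 e (F + G) :=
  fun l ds h => Submodule.add_mem _ (hF l ds h) (hG l ds h)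

theorem comp {L : TensorAlgebra R B →ₗ[R] X} {F : TensorAlgebra R A →ₗ[R] TensorAlgebra R B}
    (hL : BarHomogeneous ℬ 𝒳 e' L) (hF : BarHomogeneous 𝒜 (barGrading ℬ) e F) (h : e'' = e + e') :
    BarHomogeneous 𝒜 𝒳 e'' (L ∘ₗ F) := fun l ds hl => by
  rw [h, ← add_assoc]
  exact hL.map_mem (hF l ds hl)

theorem comp_left {g : X →ₗ[R] Y} {F : TensorAlgebra R A →ₗ[R] X}
    (hg : ∀ n x, x ∈ 𝒳 n → g x ∈ 𝒴 (n + e')) (hF : BarHomogeneous 𝒜 𝒳 e F) (h : e'' = e + e') :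
    BarHomogeneous 𝒜 𝒴 e'' (g ∘ₗ F) := fun l ds hl => by
  rw [h, ← add_assoc]
  exact hg _ _ (hF l ds hl)

theorem comp_of_mem {g : X →ₗ[R] Y} {F : TensorAlgebra R A →ₗ[R] X}
    (hg : ∀ n x, x ∈ 𝒳 n → g x ∈ 𝒴 n) (hF : BarHomogeneous 𝒜 𝒳 e F) :
    BarHomogeneous 𝒜 𝒴 e (g ∘ₗ F) := fun l ds hl => hg _ _ (hF l ds hl)

theorem ι_comp {F : TensorAlgebra R A →ₗ[R] B} (hF : BarHomogeneous 𝒜 (suspension ℬ) e F) :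
    BarHomogeneous 𝒜 (barGrading ℬ) e (ι R ∘ₗ F) := fun l ds hl => ι_mem_barGrading (hF l ds hl)

theorem ιInv : BarHomogeneous 𝒜 (suspension 𝒜) 0 (ιInv (R := R)) := fun l ds hl => by
  by_cases hlen : l.length = 1
  · obtain ⟨a, rfl⟩ := List.length_eq_one_iff.1 hlen
    obtain ⟨d, ds, hd, hds, rfl⟩ := List.forall₂_cons_left_iff.1 hl
    obtain rfl := List.forall₂_nil_left_iff.1 hds
    simpa [word_singleton, suspension] using hd
  · rw [ιInv_word_of_length_ne hlen]
    exact Submodule.zero_mem _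

theorem conv {F G : TensorAlgebra R A →ₗ[R] TensorAlgebra R B}
    (hF : BarHomogeneous 𝒜 (barGrading ℬ) e F) (hG : BarHomogeneous 𝒜 (barGrading ℬ) e' G)
    (h : e'' = e + e') : BarHomogeneous 𝒜 (barGrading ℬ) e'' (F ⋆ G) := fun l ds hl => by
  rw [conv_word]
  refine Submodule.sum_mem _ fun i hi => ?_
  obtain ⟨htake, hdrop⟩ := hl.take_drop i
  convert mul_mem_barGrading (hF _ _ htake) (hG _ _ hdrop) using 2
  have hsum := List.sum_take_add_sum_drop ds i
  have hlen : ((l.take i).length + (l.drop i).length : ℤ) = l.length := by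
    rw [Finset.mem_range] at hi
    simp only [List.length_take, List.length_drop]
    lia
  rw [h, ← hsum, ← hlen]
  ring

theorem convUnit : BarHomogeneous 𝒜 (barGrading ℬ) 0 (convUnit R A (TensorAlgebra R B)) :=
  fun l ds hl => by
    cases hl with
    | nil => simpa using word_mem_barGrading (R := R) (𝒜 := ℬ) (l := []) (ds := []) .nil
    | cons =>
      rw [convUnit_word_of_ne (List.cons_ne_nil _ _)]
      exact Submodule.zero_mem _

theorem of_eq_add_conv {φ K Z : TensorAlgebra R A →ₗ[R] TensorAlgebra R B} (hφ1 : φ 1 = 0)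
    (hφ : BarHomogeneous 𝒜 (barGrading ℬ) 0 φ) (hK : BarHomogeneous 𝒜 (barGrading ℬ) e K)
    (hZ : Z = K + φ ⋆ Z) : BarHomogeneous 𝒜 (barGrading ℬ) e Z := by
  have hmem := mem_of_eq_add_conv hφ1 hZ (fun l => ⨅ (ds : List ℤ) (_ : HasDegrees 𝒜 l ds),
    barGrading ℬ (ds.sum + l.length + e)) (fun l => by
      simp only [Submodule.mem_iInf]
      exact hK l) (fun l l' y hy => by
      simp only [Submodule.mem_iInf] at hy ⊢
      intro ds hds
      obtain ⟨htake, hdrop⟩ := hds.take_drop l.length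
      rw [List.take_left] at htake
      rw [List.drop_left] at hdrop
      convert mul_mem_barGrading (hφ _ _ htake) (hy _ hdrop) using 2
      rw [← List.sum_take_add_sum_drop ds l.length]
      push_cast [List.length_append]
      ring)
  intro l ds hl
  have hl' := hmem l
  simp only [Submodule.mem_iInf] at hl'
  exact hl' ds hl

theorem hat {F : TensorAlgebra R A →ₗ[R] B} (h : F 1 = 0)
    (hF : BarHomogeneous 𝒜 (suspension ℬ) 0 F) : BarHomogeneous 𝒜 (barGrading ℬ) 0 (hat F) :=
  of_eq_add_conv (φ := ι R ∘ₗ F) (by simp [h]) hF.ι_comp .convUnit (hat_eq h)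

theorem coder {Φ Ψ : TensorAlgebra R A →ₗ[R] TensorAlgebra R B} {E : TensorAlgebra R A →ₗ[R] B}
    (hΦ : BarHomogeneous 𝒜 (barGrading ℬ) 0 Φ) (hE : BarHomogeneous 𝒜 (suspension ℬ) e E)
    (hΨ : BarHomogeneous 𝒜 (barGrading ℬ) 0 Ψ) :
    BarHomogeneous 𝒜 (barGrading ℬ) e (coder Φ E Ψ) :=
  hΦ.conv (hE.ι_comp.conv hΨ (add_zero e).symm) (zero_add e).symm

theorem tmap {f : A →ₗ[R] B} (hf : ∀ n x, x ∈ 𝒜 n → f x ∈ ℬ n) :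
    BarHomogeneous 𝒜 (barGrading ℬ) 0 (tmap f) := fun l ds hl => by
  have hfl : HasDegrees ℬ (l.map f) ds :=
    List.forall₂_map_left_iff.2 (hl.imp fun a d => hf d a)
  simpa using word_mem_barGrading hfl

theorem id : BarHomogeneous 𝒜 (barGrading 𝒜) 0 (LinearMap.id : TensorAlgebra R A →ₗ[R] _) :=
  fun l ds hl => by simpa using word_mem_barGrading hl

end BarHomogeneous

theorem span_homogeneous_word [DirectSum.Decomposition 𝒜] :
    Submodule.span R {x | ∃ l ds, HasDegrees 𝒜 l ds ∧ word R l = x} = ⊤ := by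
  set S := Submodule.span R {x | ∃ l ds, HasDegrees 𝒜 l ds ∧ word R l = x}
  have hmul (a : A) {y : TensorAlgebra R A} (hy : y ∈ S) : ι R a * y ∈ S := by
    induction hy using Submodule.span_induction with
    | zero => simp
    | add x y _ _ hx hy => rw [mul_add]; exact S.add_mem hx hy
    | smul c x _ hx => rw [mul_smul_comm]; exact S.smul_mem c hx
    | mem x hx =>
      obtain ⟨l, ds, hl, rfl⟩ := hx
      induction a using DirectSum.Decomposition.inductionOn 𝒜 with
      | zero => simp
      | @homogeneous i m =>
        exact Submodule.subset_span ⟨(m : A) :: l, i :: ds, .cons m.2 hl, word_cons _ _⟩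
      | add m m' hm hm' => rw [map_add, add_mul]; exact S.add_mem hm hm'
  have hword (l : List A) : word R l ∈ S := by
    induction l with
    | nil => exact Submodule.subset_span ⟨[], [], .nil, rfl⟩
    | cons a l ih => rw [word_cons]; exact hmul a ih
  rw [eq_top_iff, ← span_word, Submodule.span_le]
  rintro _ ⟨l, rfl⟩
  exact hword l

theorem ext_homogeneous_word [DirectSum.Decomposition 𝒜] {f g : TensorAlgebra R A →ₗ[R] X}
    (h : ∀ l ds, HasDegrees 𝒜 l ds → f (word R l) = g (word R l)) : f = g :=
  LinearMap.ext_on span_homogeneous_word fun _ ⟨l, ds, hl, hx⟩ => hx ▸ h l ds hl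

end Degrees

section SuspensionSign

variable {R : Type u} [CommRing R]
variable {A : Type v} [AddCommGroup A] [Module R A]
variable {B : Type w} [AddCommGroup B] [Module R B]
variable {X : Type*} [AddCommGroup X] [Module R X]
variable {𝒜 : ℤ → Submodule R A} {ℬ : ℤ → Submodule R B} {𝒳 : ℤ → Submodule R X}

theorem BarHomogeneous.sub {e : ℤ} {F G : TensorAlgebra R A →ₗ[R] X}
    (hF : BarHomogeneous 𝒜 𝒳 e F) (hG : BarHomogeneous 𝒜 𝒳 e G) :
    BarHomogeneous 𝒜 𝒳 e (F - G) :=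
  fun l ds h => Submodule.sub_mem _ (hF l ds h) (hG l ds h)

theorem exists_homogeneous_fixedPoint
    (Θ : (TensorAlgebra R A →ₗ[R] B) → TensorAlgebra R A →ₗ[R] B)
    (hone : ∀ F, F 1 = 0 → Θ F 1 = 0)
    (hdeg : ∀ F, F 1 = 0 → BarHomogeneous 𝒜 (suspension ℬ) 0 F →
      BarHomogeneous 𝒜 (suspension ℬ) 0 (Θ F))
    (hΘ : ∀ n F G, F 1 = 0 → G 1 = 0 → VanishesBelow n (F - G) →
      VanishesBelow (n + 1) (Θ F - Θ G)) :
    ∃ F, F 1 = 0 ∧ BarHomogeneous 𝒜 (suspension ℬ) 0 F ∧ Θ F = F := by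
  obtain ⟨F, ⟨hF1, hF⟩, hΘF⟩ := exists_fixedPoint Θ
    (fun F => F 1 = 0 ∧ BarHomogeneous 𝒜 (suspension ℬ) 0 F) ⟨rfl, .zero⟩
    (fun F hF => ⟨hone F hF.1, hdeg F hF.1 hF.2⟩)
    (fun F hlim => by
      have hagree (l : List A) : ∃ G, (G 1 = 0 ∧ BarHomogeneous 𝒜 (suspension ℬ) 0 G) ∧
          F (word R l) = G (word R l) := by
        obtain ⟨G, hG, hFG⟩ := hlim (l.length + 1)
        exact ⟨G, hG, sub_eq_zero.1 (hFG l (Nat.lt_succ_self _))⟩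
      refine ⟨?_, fun l ds hl => ?_⟩
      · obtain ⟨G, hG, hFG⟩ := hagree []
        exact hFG.trans hG.1
      · obtain ⟨G, hG, hFG⟩ := hagree l
        exact hFG ▸ hG.2 l ds hl)
    (fun n F G hF hG => hΘ n F G hF.1 hG.1)
  exact ⟨F, hF1, hF, hΘF⟩

variable [DirectSum.Decomposition 𝒜] [DirectSum.Decomposition ℬ]

variable (𝒜) in
/-- The sign involution of the suspension of `A`: it is multiplication by `(-1) ^ (n + 1)` on the
component of degree `n`. -/
def suspSign : A →ₗ[R] A :=
  DirectSum.toModule R ℤ A (fun n => ((n + 1).negOnePow : ℤ) • (𝒜 n).subtype) ∘ₗ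
    (DirectSum.decomposeLinearEquiv 𝒜).toLinearMap

theorem suspSign_of_mem {n : ℤ} {a : A} (ha : a ∈ 𝒜 n) :
    suspSign 𝒜 a = ((n + 1).negOnePow : ℤ) • a := by
  have := DirectSum.decomposeLinearEquiv_apply_coe 𝒜 n ⟨a, ha⟩
  simp only at this
  simp [suspSign, this]

theorem suspSign_mem {n : ℤ} {a : A} (h : a ∈ 𝒜 n) : suspSign 𝒜 a ∈ 𝒜 n :=
  suspSign_of_mem h ▸ zsmul_mem h _

theorem suspSign_comp_of_mem {f : A →ₗ[R] B} (hf : ∀ n x, x ∈ 𝒜 n → f x ∈ ℬ n) :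
    suspSign ℬ ∘ₗ f = f ∘ₗ suspSign 𝒜 := by
  refine DirectSum.decompose_lhom_ext 𝒜 fun n => LinearMap.ext fun ⟨x, hx⟩ => ?_
  simp only [LinearMap.comp_apply, Submodule.subtype_apply, suspSign_of_mem hx,
    suspSign_of_mem (hf n x hx), map_zsmul]

theorem suspSign_comp_suspSign : suspSign 𝒜 ∘ₗ suspSign 𝒜 = LinearMap.id := by
  refine DirectSum.decompose_lhom_ext 𝒜 fun n => LinearMap.ext fun ⟨a, ha⟩ => ?_
  simp only [LinearMap.comp_apply, Submodule.subtype_apply, LinearMap.id_apply]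
  rw [suspSign_of_mem ha, map_zsmul, suspSign_of_mem ha, smul_smul, ← Units.val_mul,
    Int.units_mul_self, Units.val_one, one_smul]

variable (𝒜) in
/-- The sign involution `x ↦ (-1) ^ |x| x` of the tensor algebra on the suspension of `A`. -/
def barSign : TensorAlgebra R A →ₗ[R] TensorAlgebra R A := tmap (suspSign 𝒜)

theorem isCoalgHom_barSign : IsCoalgHom (barSign 𝒜) := isCoalgHom_tmap _

theorem barHomogeneous_barSign : BarHomogeneous 𝒜 (barGrading 𝒜) 0 (barSign 𝒜) :=
  .tmap fun _ _ => suspSign_mem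

theorem barSign_of_mem {n : ℤ} {x : TensorAlgebra R A} (h : x ∈ barGrading 𝒜 n) :
    barSign 𝒜 x = (n.negOnePow : ℤ) • x := by
  refine LinearMap.eqOn_span (g := (n.negOnePow : ℤ) • LinearMap.id) ?_ h
  rintro _ ⟨l, ds, hl, rfl, rfl⟩
  rw [barSign, tmap_word, LinearMap.smul_apply, LinearMap.id_apply]
  clear h
  induction hl with
  | nil => simp
  | @cons a d l ds hd _ ih =>
    have hsign : (((d + 1) : ℤ).negOnePow : ℤ) * ((ds.sum + l.length).negOnePow : ℤ) =
        (((d :: ds).sum + (a :: l).length).negOnePow : ℤ) := by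
      rw [← Units.val_mul, ← Int.negOnePow_add, List.sum_cons, List.length_cons, Nat.cast_succ]
      congr 2
      ring
    rw [List.map_cons, word_cons, ih, suspSign_of_mem hd, word_cons, map_zsmul, smul_mul_assoc,
      mul_smul_comm, smul_smul, hsign]

theorem barSign_comp_barSign : barSign 𝒜 ∘ₗ barSign 𝒜 = LinearMap.id := by
  rw [barSign, tmap_comp, suspSign_comp_suspSign, tmap_id]

namespace BarHomogeneous

variable {e : ℤ} {F : TensorAlgebra R A →ₗ[R] TensorAlgebra R B}

theorem barSign_comp (hF : BarHomogeneous 𝒜 (barGrading ℬ) e F) :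
    barSign ℬ ∘ₗ F = (e.negOnePow : ℤ) • (F ∘ₗ barSign 𝒜) :=
  ext_homogeneous_word (𝒜 := 𝒜) fun l ds hl => by
    rw [LinearMap.comp_apply, barSign_of_mem (hF l ds hl), LinearMap.smul_apply,
      LinearMap.comp_apply, barSign_of_mem (word_mem_barGrading hl), map_zsmul, smul_smul,
      Int.negOnePow_add, mul_comm, Units.val_mul]

theorem barSign_comp_of_zero (hF : BarHomogeneous 𝒜 (barGrading ℬ) 0 F) :
    barSign ℬ ∘ₗ F = F ∘ₗ barSign 𝒜 := by
  simpa using hF.barSign_comp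

theorem barSign_comp_of_odd (hF : BarHomogeneous 𝒜 (barGrading ℬ) e F) (he : Odd e) :
    barSign ℬ ∘ₗ F = -(F ∘ₗ barSign 𝒜) := by
  simpa [Int.negOnePow_odd e he] using hF.barSign_comp

theorem suspSign_comp {F : TensorAlgebra R A →ₗ[R] B}
    (hF : BarHomogeneous 𝒜 (suspension ℬ) e F) :
    suspSign ℬ ∘ₗ F = (e.negOnePow : ℤ) • (F ∘ₗ barSign 𝒜) :=
  ext_homogeneous_word (𝒜 := 𝒜) fun l ds hl => by
    have hmem : F (word R l) ∈ ℬ (ds.sum + l.length + e - 1) := hF l ds hl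
    rw [LinearMap.comp_apply, suspSign_of_mem hmem, LinearMap.smul_apply, sub_add_cancel,
      LinearMap.comp_apply, barSign_of_mem (word_mem_barGrading hl), map_zsmul, smul_smul,
      Int.negOnePow_add, mul_comm, Units.val_mul]

end BarHomogeneous

end SuspensionSign

section BarConstruction

variable {R : Type u} [CommRing R]
variable {A : Type v} [AddCommGroup A] [Module R A]
variable {B : Type w} [AddCommGroup B] [Module R B]
variable {C : Type*} [AddCommGroup C] [Module R C]
variable {𝒜 : ℤ → Submodule R A} [DirectSum.Decomposition 𝒜]
variable {ℬ : ℤ → Submodule R B} [DirectSum.Decomposition ℬ]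
variable {𝒞 : ℤ → Submodule R C}

variable (𝒜) in
/-- The signed coderivation of the tensor coalgebra of the suspension of `A` with component `b`:
on words it is `∑ ± 1 ⊗ b ⊗ 1`, the sign coming from the degree of the first factor. -/
def codiff (b : TensorAlgebra R A →ₗ[R] A) : TensorAlgebra R A →ₗ[R] TensorAlgebra R A :=
  coder (barSign 𝒜) b LinearMap.id

theorem isCoder_codiff (b : TensorAlgebra R A →ₗ[R] A) :
    IsCoder (barSign 𝒜) LinearMap.id (codiff 𝒜 b) :=
  isCoder_coder isCoalgHom_barSign .id b

theorem ιInv_comp_codiff (b : TensorAlgebra R A →ₗ[R] A) : ιInv ∘ₗ codiff 𝒜 b = b :=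
  ιInv_comp_coder isCoalgHom_barSign .id b

theorem codiff_add (b b' : TensorAlgebra R A →ₗ[R] A) :
    codiff 𝒜 (b + b') = codiff 𝒜 b + codiff 𝒜 b' :=
  (isCoder_codiff _).ext isCoalgHom_barSign ((isCoder_codiff b).add (isCoder_codiff b')) (by
    simp only [LinearMap.comp_add, ιInv_comp_codiff])

theorem codiff_ι {b : TensorAlgebra R A →ₗ[R] A} (hb : b 1 = 0) (a : A) :
    codiff 𝒜 b (ι R a) = ι R (b (ι R a)) := by
  rw [← word_singleton, codiff, coder, conv_word]
  simp [Finset.sum_range_succ, conv_word, hb, (isCoalgHom_barSign (𝒜 := 𝒜)).map_one]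

theorem lowers_codiff {n : ℕ} {b : TensorAlgebra R A →ₗ[R] A} (hb : VanishesBelow n b) :
    Lowers (n - 1) (codiff 𝒜 b) :=
  .coder (.tmap _) .id hb

theorem barHomogeneous_codiff {e : ℤ} {b : TensorAlgebra R A →ₗ[R] A}
    (hb : BarHomogeneous 𝒜 (suspension 𝒜) e b) :
    BarHomogeneous 𝒜 (barGrading 𝒜) e (codiff 𝒜 b) :=
  barHomogeneous_barSign.coder hb .id

variable (𝒜) in
/-- An `A∞`-structure in bar form: the component of a square-zero coderivation of degree `-1` of
the tensor coalgebra of the suspension. The equation is stated for the component only, which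
determines the coderivation. -/
structure IsBarStructure (b : TensorAlgebra R A →ₗ[R] A) : Prop where
  map_one : b 1 = 0
  homogeneous : BarHomogeneous 𝒜 (suspension 𝒜) (-1) b
  comp_codiff : b ∘ₗ codiff 𝒜 b = 0

variable (𝒜 ℬ) in
/-- An `A∞`-morphism in bar form: the component of a map of degree `0` of differential graded tensor
coalgebras. -/
structure IsBarMorphism (b : TensorAlgebra R A →ₗ[R] A) (b' : TensorAlgebra R B →ₗ[R] B)
    (F : TensorAlgebra R A →ₗ[R] B) : Prop where
  map_one : F 1 = 0
  homogeneous : BarHomogeneous 𝒜 (suspension ℬ) 0 F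
  comp_codiff : F ∘ₗ codiff 𝒜 b = b' ∘ₗ hat F

theorem barSign_comp_hat {F : TensorAlgebra R A →ₗ[R] B} (h1 : F 1 = 0)
    (hF : BarHomogeneous 𝒜 (suspension ℬ) 0 F) : barSign ℬ ∘ₗ hat F = hat F ∘ₗ barSign 𝒜 :=
  (BarHomogeneous.hat h1 hF).barSign_comp_of_zero

theorem codiff_comp_barSign {b : TensorAlgebra R A →ₗ[R] A}
    (hb : BarHomogeneous 𝒜 (suspension 𝒜) (-1) b) :
    codiff 𝒜 b ∘ₗ barSign 𝒜 = -(barSign 𝒜 ∘ₗ codiff 𝒜 b) := by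
  rw [(barHomogeneous_codiff hb).barSign_comp_of_odd (by decide), neg_neg]

theorem isCoder_codiff_comp_codiff {b : TensorAlgebra R A →ₗ[R] A}
    (hb : BarHomogeneous 𝒜 (suspension 𝒜) (-1) b) :
    IsCoder LinearMap.id LinearMap.id (codiff 𝒜 b ∘ₗ codiff 𝒜 b) := by
  have h := (isCoder_codiff b).comp_self (codiff_comp_barSign hb) rfl
  rwa [barSign_comp_barSign] at h

theorem codiff_comp_codiff {b : TensorAlgebra R A →ₗ[R] A}
    (hb : BarHomogeneous 𝒜 (suspension 𝒜) (-1) b) (h : b ∘ₗ codiff 𝒜 b = 0) :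
    codiff 𝒜 b ∘ₗ codiff 𝒜 b = 0 :=
  (isCoder_codiff_comp_codiff hb).ext .id .zero (by
    rw [← LinearMap.comp_assoc, ιInv_comp_codiff, h, LinearMap.comp_zero])

theorem IsBarMorphism.codiff_comp_hat {b : TensorAlgebra R A →ₗ[R] A}
    {b' : TensorAlgebra R B →ₗ[R] B} {F : TensorAlgebra R A →ₗ[R] B}
    (hF : IsBarMorphism 𝒜 ℬ b b' F) : codiff ℬ b' ∘ₗ hat F = hat F ∘ₗ codiff 𝒜 b := by
  have hhat := isCoalgHom_hat hF.map_one
  have h := (isCoder_codiff (𝒜 := ℬ) b').comp_right hhat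
  rw [barSign_comp_hat hF.map_one hF.homogeneous] at h
  refine h.ext (hhat.comp isCoalgHom_barSign) ((isCoder_codiff b).comp_left hhat) ?_
  rw [← LinearMap.comp_assoc, ← LinearMap.comp_assoc, ιInv_comp_codiff, ιInv_comp_hat hF.map_one,
    hF.comp_codiff]

theorem IsBarMorphism.of_codiff_comp_hat {b : TensorAlgebra R A →ₗ[R] A}
    {b' : TensorAlgebra R B →ₗ[R] B} {F : TensorAlgebra R A →ₗ[R] B} (h1 : F 1 = 0)
    (hF : BarHomogeneous 𝒜 (suspension ℬ) 0 F)
    (h : codiff ℬ b' ∘ₗ hat F = hat F ∘ₗ codiff 𝒜 b) : IsBarMorphism 𝒜 ℬ b b' F where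
  map_one := h1
  homogeneous := hF
  comp_codiff := by
    rw [← ιInv_comp_hat h1, LinearMap.comp_assoc, ← h, ← LinearMap.comp_assoc, ιInv_comp_codiff,
      ιInv_comp_hat h1]

theorem IsBarMorphism.comp {b : TensorAlgebra R A →ₗ[R] A} {b' : TensorAlgebra R B →ₗ[R] B}
    {b'' : TensorAlgebra R C →ₗ[R] C} {F : TensorAlgebra R A →ₗ[R] B}
    {G : TensorAlgebra R B →ₗ[R] C} (hG : IsBarMorphism ℬ 𝒞 b' b'' G)
    (hF : IsBarMorphism 𝒜 ℬ b b' F) : IsBarMorphism 𝒜 𝒞 b b'' (G ∘ₗ hat F) where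
  map_one := by rw [LinearMap.comp_apply, hat_one hF.map_one, hG.map_one]
  homogeneous := hG.homogeneous.comp (.hat hF.map_one hF.homogeneous) rfl
  comp_codiff := by
    rw [← hat_comp_hat hG.map_one hF.map_one, LinearMap.comp_assoc, ← hF.codiff_comp_hat,
      ← LinearMap.comp_assoc, hG.comp_codiff, LinearMap.comp_assoc]

end BarConstruction

section Inverses

variable {R : Type u} [CommRing R] {A : Type v} [AddCommGroup A] [Module R A]
variable {𝒜 : ℤ → Submodule R A}

theorem exists_right_inverse {F : TensorAlgebra R A →ₗ[R] A} (h1 : F 1 = 0)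
    (hF : BarHomogeneous 𝒜 (suspension 𝒜) 0 F) (hι : F ∘ₗ ι R = LinearMap.id) :
    ∃ G : TensorAlgebra R A →ₗ[R] A, G 1 = 0 ∧ BarHomogeneous 𝒜 (suspension 𝒜) 0 G ∧
      G ∘ₗ ι R = LinearMap.id ∧ hat F ∘ₗ hat G = LinearMap.id := by
  have hL : (F - ιInv) ∘ₗ ι R = 0 := by rw [LinearMap.sub_comp, hι, ιInv_comp_ι, sub_self]
  obtain ⟨G, hG1, hG, hfix⟩ := exists_homogeneous_fixedPoint
    (fun G : TensorAlgebra R A →ₗ[R] A => ιInv - (F - ιInv) ∘ₗ hat G)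
    (fun G hG1 => by simp [hat_one hG1, h1])
    (fun G hG1 hG => BarHomogeneous.ιInv.sub ((hF.sub .ιInv).comp (.hat hG1 hG) rfl))
    (fun n G G' hG hG' h => by
      have h' := VanishesBelow.comp_hat_sub_comp_hat hG hG' h hL
      rw [sub_sub_sub_cancel_left, ← neg_sub]
      exact h'.comp (-LinearMap.id))
  refine ⟨G, hG1, hG, ?_, ?_⟩
  · have hhat : hat G ∘ₗ ι R = ι R ∘ₗ G ∘ₗ ι R := LinearMap.ext (hat_ι hG1)
    rw [← hfix, LinearMap.sub_comp, LinearMap.comp_assoc, hhat, ← LinearMap.comp_assoc, hL,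
      LinearMap.zero_comp, sub_zero, ιInv_comp_ι]
  · rw [hat_comp_hat h1 hG1, ← hat_ιInv]
    congr 1
    rwa [LinearMap.sub_comp, ιInv_comp_hat hG1, sub_sub_eq_add_sub, sub_eq_iff_eq_add, add_comm,
      add_right_inj, eq_comm] at hfix

variable [DirectSum.Decomposition 𝒜]

/-- The right inverse of `hat F` has a right inverse in turn, which is then `hat F`. -/
theorem IsBarMorphism.exists_inverse {b b' F : TensorAlgebra R A →ₗ[R] A}
    (hF : IsBarMorphism 𝒜 𝒜 b b' F) (hι : F ∘ₗ ι R = LinearMap.id) :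
    ∃ G : TensorAlgebra R A →ₗ[R] A, IsBarMorphism 𝒜 𝒜 b' b G ∧ G ∘ₗ ι R = LinearMap.id ∧
      hat F ∘ₗ hat G = LinearMap.id ∧ hat G ∘ₗ hat F = LinearMap.id := by
  obtain ⟨G, hG1, hG, hGι, hFG⟩ := exists_right_inverse hF.map_one hF.homogeneous hι
  obtain ⟨G', -, -, -, hGG'⟩ := exists_right_inverse hG1 hG hGι
  have hGF : hat G ∘ₗ hat F = LinearMap.id := by
    rwa [← left_inv_eq_right_inv (M := Module.End R (TensorAlgebra R A)) hFG hGG'] at hGG'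
  refine ⟨G, .of_codiff_comp_hat hG1 hG ?_, hGι, hFG, hGF⟩
  calc codiff 𝒜 b ∘ₗ hat G = (hat G ∘ₗ hat F) ∘ₗ codiff 𝒜 b ∘ₗ hat G := by
        rw [hGF, LinearMap.id_comp]
    _ = hat G ∘ₗ (codiff 𝒜 b' ∘ₗ hat F) ∘ₗ hat G := by rw [hF.codiff_comp_hat]; rfl
    _ = (hat G ∘ₗ codiff 𝒜 b') ∘ₗ hat F ∘ₗ hat G := rfl
    _ = hat G ∘ₗ codiff 𝒜 b' := by rw [hFG, LinearMap.comp_id]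

end Inverses

section PerturbedContraction

variable {R : Type*} [Ring R] {X Y : Type*} [AddCommGroup X] [Module R X] [AddCommGroup Y]
variable [Module R Y] {i I : Y →ₗ[R] X} {p P : X →ₗ[R] Y} {d δ h : X →ₗ[R] X}

/-- Both sides solve the fixed point equation `F = i p δ I + h δ F`. -/
theorem perturbed_comp_incl (hunique : ∀ F : Y →ₗ[R] X, F = (h ∘ₗ δ) ∘ₗ F → F = 0)
    (hdi : d ∘ₗ i = 0) (hhtpy : d ∘ₗ h + h ∘ₗ d = i ∘ₗ p - LinearMap.id)
    (hdδ : d ∘ₗ δ = -(δ ∘ₗ (d + δ))) (hI : I = i + h ∘ₗ δ ∘ₗ I) :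
    (d + δ) ∘ₗ I = I ∘ₗ p ∘ₗ δ ∘ₗ I := by
  have hdh : d ∘ₗ h = i ∘ₗ p - LinearMap.id - h ∘ₗ d := eq_sub_of_add_eq hhtpy
  have hdI : d ∘ₗ I = i ∘ₗ p ∘ₗ δ ∘ₗ I - δ ∘ₗ I + h ∘ₗ δ ∘ₗ (d + δ) ∘ₗ I := calc
    d ∘ₗ I = (d ∘ₗ h) ∘ₗ δ ∘ₗ I := by
      conv_lhs => rw [hI, LinearMap.comp_add, hdi, zero_add]
      rfl
    _ = i ∘ₗ p ∘ₗ δ ∘ₗ I - δ ∘ₗ I - h ∘ₗ (d ∘ₗ δ) ∘ₗ I := by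
      rw [hdh]
      rfl
    _ = _ := by
      rw [hdδ, LinearMap.neg_comp, LinearMap.comp_neg, sub_neg_eq_add]
      rfl
  have hleft : (d + δ) ∘ₗ I = i ∘ₗ p ∘ₗ δ ∘ₗ I + (h ∘ₗ δ) ∘ₗ (d + δ) ∘ₗ I := by
    conv_lhs => rw [LinearMap.add_comp, hdI, add_right_comm, sub_add_cancel]
    rfl
  have hright : I ∘ₗ p ∘ₗ δ ∘ₗ I = i ∘ₗ p ∘ₗ δ ∘ₗ I + (h ∘ₗ δ) ∘ₗ I ∘ₗ p ∘ₗ δ ∘ₗ I := by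
    conv_lhs => rw [hI, LinearMap.add_comp, ← hI]
    rfl
  refine sub_eq_zero.1 (hunique _ ?_)
  rw [LinearMap.comp_sub]
  conv_lhs => rw [hleft, hright, add_sub_add_left_eq_sub]

theorem proj_comp_perturbed (hunique : ∀ F : X →ₗ[R] Y, F = F ∘ₗ δ ∘ₗ h → F = 0)
    (hpd : p ∘ₗ d = 0) (hhtpy : d ∘ₗ h + h ∘ₗ d = i ∘ₗ p - LinearMap.id)
    (hδd : δ ∘ₗ d = -((d + δ) ∘ₗ δ)) (hP : P = p + P ∘ₗ δ ∘ₗ h) :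
    P ∘ₗ (d + δ) = (P ∘ₗ δ ∘ₗ i) ∘ₗ P := by
  have hhd : h ∘ₗ d = i ∘ₗ p - LinearMap.id - d ∘ₗ h := eq_sub_of_add_eq' hhtpy
  have hPd : P ∘ₗ d = (P ∘ₗ δ ∘ₗ i) ∘ₗ p - P ∘ₗ δ + (P ∘ₗ (d + δ)) ∘ₗ δ ∘ₗ h := calc
    P ∘ₗ d = P ∘ₗ δ ∘ₗ h ∘ₗ d := by
      conv_lhs => rw [hP, LinearMap.add_comp, hpd, zero_add]
      rfl
    _ = (P ∘ₗ δ ∘ₗ i) ∘ₗ p - P ∘ₗ δ - P ∘ₗ (δ ∘ₗ d) ∘ₗ h := by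
      rw [hhd, LinearMap.comp_sub, LinearMap.comp_sub, LinearMap.comp_sub, LinearMap.comp_sub]
      rfl
    _ = _ := by
      rw [hδd, LinearMap.neg_comp, LinearMap.comp_neg, sub_neg_eq_add]
      rfl
  have hleft : P ∘ₗ (d + δ) = (P ∘ₗ δ ∘ₗ i) ∘ₗ p + (P ∘ₗ (d + δ)) ∘ₗ δ ∘ₗ h := by
    conv_lhs => rw [LinearMap.comp_add, hPd, add_right_comm, sub_add_cancel]
  have hright : (P ∘ₗ δ ∘ₗ i) ∘ₗ P = (P ∘ₗ δ ∘ₗ i) ∘ₗ p + ((P ∘ₗ δ ∘ₗ i) ∘ₗ P) ∘ₗ δ ∘ₗ h := by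
    conv_lhs => enter [2]; rw [hP]
    rw [LinearMap.comp_add]
    rfl
  refine sub_eq_zero.1 (hunique _ ?_)
  rw [LinearMap.sub_comp]
  conv_lhs => rw [hleft, hright, add_sub_add_left_eq_sub]

theorem perturbed_proj_comp_incl (hI : I = i + h ∘ₗ δ ∘ₗ I) (hP : P = p + P ∘ₗ δ ∘ₗ h) :
    P ∘ₗ δ ∘ₗ i = p ∘ₗ δ ∘ₗ I := calc
  P ∘ₗ δ ∘ₗ i = P ∘ₗ δ ∘ₗ (I - h ∘ₗ δ ∘ₗ I) := by rw [← eq_sub_of_add_eq hI.symm]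
  _ = (P - P ∘ₗ δ ∘ₗ h) ∘ₗ δ ∘ₗ I := by
    rw [LinearMap.comp_sub, LinearMap.comp_sub, LinearMap.sub_comp]
    rfl
  _ = p ∘ₗ δ ∘ₗ I := by rw [← eq_sub_of_add_eq hP.symm]

end PerturbedContraction

section Contractions

variable {R : Type u} [CommRing R]
variable {A : Type v} [AddCommGroup A] [Module R A]
variable {B : Type w} [AddCommGroup B] [Module R B]

/-- A contraction of `(A, d)` onto `B` with zero differential: a strong deformation retraction of
complexes, with the usual side conditions on the homotopy. -/
structure Contraction (𝒜 : ℤ → Submodule R A) (ℬ : ℤ → Submodule R B) (d : A →ₗ[R] A) where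
  incl : B →ₗ[R] A
  proj : A →ₗ[R] B
  htpy : A →ₗ[R] A
  incl_mem : ∀ n x, x ∈ ℬ n → incl x ∈ 𝒜 n
  proj_mem : ∀ n x, x ∈ 𝒜 n → proj x ∈ ℬ n
  htpy_mem : ∀ n x, x ∈ 𝒜 n → htpy x ∈ 𝒜 (n + 1)
  proj_comp_incl : proj ∘ₗ incl = LinearMap.id
  diff_comp_incl : d ∘ₗ incl = 0
  proj_comp_diff : proj ∘ₗ d = 0
  diff_comp_htpy_add : d ∘ₗ htpy + htpy ∘ₗ d = incl ∘ₗ proj - LinearMap.id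
  htpy_comp_htpy : htpy ∘ₗ htpy = 0
  htpy_comp_incl : htpy ∘ₗ incl = 0
  proj_comp_htpy : proj ∘ₗ htpy = 0

namespace Contraction

variable {𝒜 : ℤ → Submodule R A}
variable {ℬ : ℤ → Submodule R B}
variable {d : A →ₗ[R] A} (c : Contraction 𝒜 ℬ d)

variable [DirectSum.Decomposition 𝒜]

theorem codiff_comp_tmap_incl : codiff 𝒜 (d ∘ₗ ιInv) ∘ₗ tmap c.incl = 0 :=
  ((isCoder_codiff _).comp_right (isCoalgHom_tmap c.incl)).ext
    (isCoalgHom_barSign.comp (isCoalgHom_tmap _)) .zero (by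
      rw [← LinearMap.comp_assoc, ιInv_comp_codiff, LinearMap.comp_assoc, ιInv_comp_tmap,
        ← LinearMap.comp_assoc, c.diff_comp_incl, LinearMap.zero_comp, LinearMap.comp_zero])

theorem tmap_proj_comp_codiff : tmap c.proj ∘ₗ codiff 𝒜 (d ∘ₗ ιInv) = 0 :=
  ((isCoder_codiff _).comp_left (isCoalgHom_tmap c.proj)).ext
    ((isCoalgHom_tmap _).comp isCoalgHom_barSign) .zero (by
      rw [← LinearMap.comp_assoc, ιInv_comp_tmap, LinearMap.comp_assoc, ιInv_comp_codiff,
        ← LinearMap.comp_assoc, c.proj_comp_diff, LinearMap.zero_comp, LinearMap.comp_zero])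

/-- The extension `∑ ± 1 ⊗ htpy ⊗ (incl ∘ proj)` of the homotopy to words. -/
def hatHomotopy : TensorAlgebra R A →ₗ[R] TensorAlgebra R A :=
  coder (barSign 𝒜) (c.htpy ∘ₗ ιInv) (tmap (c.incl ∘ₗ c.proj))

theorem isCoder_hatHomotopy :
    IsCoder (barSign 𝒜) (tmap (c.incl ∘ₗ c.proj)) c.hatHomotopy :=
  isCoder_coder isCoalgHom_barSign (isCoalgHom_tmap _) _

theorem ιInv_comp_hatHomotopy : ιInv ∘ₗ c.hatHomotopy = c.htpy ∘ₗ ιInv :=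
  ιInv_comp_coder isCoalgHom_barSign (isCoalgHom_tmap _) _

theorem barHomogeneous_hatHomotopy : BarHomogeneous 𝒜 (barGrading 𝒜) 1 c.hatHomotopy :=
  barHomogeneous_barSign.coder
    (.comp_left (𝒳 := suspension 𝒜) (fun n x hx => by
      rw [suspension, ← sub_add_eq_add_sub]
      exact c.htpy_mem (n - 1) x hx) .ιInv (zero_add 1).symm)
    (.tmap fun n x hx => c.incl_mem n _ (c.proj_mem n x hx))

theorem lowers_hatHomotopy : Lowers 0 c.hatHomotopy :=
  .coder (n := 1) (.tmap _) (.tmap _) (.of_map_one (by simp))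

theorem hatHomotopy_comp_barSign :
    c.hatHomotopy ∘ₗ barSign 𝒜 = -(barSign 𝒜 ∘ₗ c.hatHomotopy) := by
  rw [c.barHomogeneous_hatHomotopy.barSign_comp_of_odd odd_one, neg_neg]

theorem hatHomotopy_comp_tmap_incl : c.hatHomotopy ∘ₗ tmap c.incl = 0 :=
  (c.isCoder_hatHomotopy.comp_right (isCoalgHom_tmap c.incl)).ext
    (isCoalgHom_barSign.comp (isCoalgHom_tmap _)) .zero (by
      rw [← LinearMap.comp_assoc, ιInv_comp_hatHomotopy, LinearMap.comp_assoc, ιInv_comp_tmap,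
        ← LinearMap.comp_assoc, c.htpy_comp_incl, LinearMap.zero_comp, LinearMap.comp_zero])

theorem tmap_proj_comp_hatHomotopy : tmap c.proj ∘ₗ c.hatHomotopy = 0 :=
  (c.isCoder_hatHomotopy.comp_left (isCoalgHom_tmap c.proj)).ext
    ((isCoalgHom_tmap _).comp isCoalgHom_barSign) .zero (by
      rw [← LinearMap.comp_assoc, ιInv_comp_tmap, LinearMap.comp_assoc, ιInv_comp_hatHomotopy,
        ← LinearMap.comp_assoc, c.proj_comp_htpy, LinearMap.zero_comp, LinearMap.comp_zero])

theorem hatHomotopy_comp_hatHomotopy : c.hatHomotopy ∘ₗ c.hatHomotopy = 0 := by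
  have hleft : c.hatHomotopy ∘ₗ tmap (c.incl ∘ₗ c.proj) = 0 := by
    rw [← tmap_comp, ← LinearMap.comp_assoc, hatHomotopy_comp_tmap_incl, LinearMap.zero_comp]
  have hright : tmap (c.incl ∘ₗ c.proj) ∘ₗ c.hatHomotopy = 0 := by
    rw [← tmap_comp, LinearMap.comp_assoc, tmap_proj_comp_hatHomotopy, LinearMap.comp_zero]
  refine (c.isCoder_hatHomotopy.comp_self c.hatHomotopy_comp_barSign (hleft.trans hright.symm)).ext
    (isCoalgHom_barSign.comp isCoalgHom_barSign) .zero ?_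
  rw [← LinearMap.comp_assoc, ιInv_comp_hatHomotopy, LinearMap.comp_assoc, ιInv_comp_hatHomotopy,
    ← LinearMap.comp_assoc, htpy_comp_htpy, LinearMap.zero_comp, LinearMap.comp_zero]

theorem codiff_comp_hatHomotopy_add
    (hd : BarHomogeneous 𝒜 (suspension 𝒜) (-1) (d ∘ₗ ιInv)) :
    codiff 𝒜 (d ∘ₗ ιInv) ∘ₗ c.hatHomotopy + c.hatHomotopy ∘ₗ codiff 𝒜 (d ∘ₗ ιInv) =
      tmap c.incl ∘ₗ tmap c.proj - LinearMap.id := by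
  have hip : codiff 𝒜 (d ∘ₗ ιInv) ∘ₗ tmap (c.incl ∘ₗ c.proj) =
      tmap (c.incl ∘ₗ c.proj) ∘ₗ codiff 𝒜 (d ∘ₗ ιInv) := by
    rw [← tmap_comp, ← LinearMap.comp_assoc, codiff_comp_tmap_incl, LinearMap.comp_assoc,
      tmap_proj_comp_codiff, LinearMap.zero_comp, LinearMap.comp_zero]
  have hcoder := (isCoder_codiff (d ∘ₗ ιInv)).anticommutator c.isCoder_hatHomotopy rfl rfl
    (codiff_comp_barSign hd) c.hatHomotopy_comp_barSign hip rfl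
  rw [barSign_comp_barSign, LinearMap.id_comp] at hcoder
  rw [tmap_comp, ← neg_sub]
  refine hcoder.ext .id (IsCoalgHom.id.isCoder_sub (isCoalgHom_tmap _)).neg ?_
  rw [LinearMap.comp_add, ← LinearMap.comp_assoc, ← LinearMap.comp_assoc, ιInv_comp_codiff,
    ιInv_comp_hatHomotopy, LinearMap.comp_assoc, LinearMap.comp_assoc, ιInv_comp_hatHomotopy,
    ιInv_comp_codiff, ← LinearMap.comp_assoc, ← LinearMap.comp_assoc, ← LinearMap.add_comp,
    c.diff_comp_htpy_add, neg_sub, LinearMap.comp_sub, ιInv_comp_tmap, LinearMap.sub_comp,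
    LinearMap.id_comp, LinearMap.comp_id]

variable [DirectSum.Decomposition ℬ]

theorem barSign_comp_tmap_proj : barSign ℬ ∘ₗ tmap c.proj = tmap c.proj ∘ₗ barSign 𝒜 :=
  (BarHomogeneous.tmap c.proj_mem).barSign_comp_of_zero

end Contraction

end Contractions

section HigherPart

variable {R : Type u} [CommRing R] {A : Type v} [AddCommGroup A] [Module R A]

/-- The component `b` with its restriction to words of length one removed. -/
def higherPart (b : TensorAlgebra R A →ₗ[R] A) : TensorAlgebra R A →ₗ[R] A :=
  b - (b ∘ₗ ι R) ∘ₗ ιInv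

variable {b : TensorAlgebra R A →ₗ[R] A}

theorem linear_add_higherPart : (b ∘ₗ ι R) ∘ₗ ιInv + higherPart b = b :=
  add_sub_cancel _ _

theorem higherPart_one (hb : b 1 = 0) : higherPart b 1 = 0 := by simp [higherPart, hb]

theorem higherPart_comp_ι : higherPart b ∘ₗ ι R = 0 := by
  rw [higherPart, LinearMap.sub_comp, LinearMap.comp_assoc, ιInv_comp_ι, LinearMap.comp_id,
    sub_self]

theorem higherPart_ι (a : A) : higherPart b (ι R a) = 0 :=
  LinearMap.congr_fun higherPart_comp_ι a

theorem higherPart_word_of_ne {l : List A} (hl : l.length ≠ 1) :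
    higherPart b (word R l) = b (word R l) := by
  rw [higherPart, LinearMap.sub_apply, LinearMap.comp_apply, ιInv_word_of_length_ne hl, map_zero,
    sub_zero]

theorem vanishesBelow_higherPart (hb : b 1 = 0) : VanishesBelow 2 (higherPart b) := fun l hl => by
  match l, hl with
  | [], _ => exact higherPart_one hb
  | [a], _ => rw [word_singleton, higherPart_ι]

variable {𝒜 : ℤ → Submodule R A}

theorem barHomogeneous_linear {e : ℤ} (hb : BarHomogeneous 𝒜 (suspension 𝒜) e b) :
    BarHomogeneous 𝒜 (suspension 𝒜) e ((b ∘ₗ ι R) ∘ₗ ιInv) :=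
  hb.comp BarHomogeneous.ιInv.ι_comp (zero_add e).symm

theorem barHomogeneous_higherPart {e : ℤ} (hb : BarHomogeneous 𝒜 (suspension 𝒜) e b) :
    BarHomogeneous 𝒜 (suspension 𝒜) e (higherPart b) :=
  hb.sub (barHomogeneous_linear hb)

variable [DirectSum.Decomposition 𝒜]

theorem codiff_linear_add_codiff_higherPart :
    codiff 𝒜 ((b ∘ₗ ι R) ∘ₗ ιInv) + codiff 𝒜 (higherPart b) = codiff 𝒜 b := by
  rw [← codiff_add, linear_add_higherPart]

namespace IsBarStructure

variable (hb : IsBarStructure 𝒜 b)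
include hb

theorem codiff_comp_codiff : codiff 𝒜 b ∘ₗ codiff 𝒜 b = 0 :=
  AInfinity.codiff_comp_codiff hb.homogeneous hb.comp_codiff

theorem diff_comp_diff : (b ∘ₗ ι R) ∘ₗ b ∘ₗ ι R = 0 :=
  LinearMap.ext fun a => by
    have h := LinearMap.congr_fun hb.comp_codiff (ι R a)
    rwa [LinearMap.comp_apply, codiff_ι hb.map_one] at h

theorem codiff_linear_comp_codiff_linear :
    codiff 𝒜 ((b ∘ₗ ι R) ∘ₗ ιInv) ∘ₗ codiff 𝒜 ((b ∘ₗ ι R) ∘ₗ ιInv) = 0 :=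
  AInfinity.codiff_comp_codiff (barHomogeneous_linear hb.homogeneous) (by
    rw [LinearMap.comp_assoc, ιInv_comp_codiff, ← LinearMap.comp_assoc, hb.diff_comp_diff,
      LinearMap.zero_comp])

theorem codiff_linear_comp_codiff_higherPart :
    codiff 𝒜 ((b ∘ₗ ι R) ∘ₗ ιInv) ∘ₗ codiff 𝒜 (higherPart b) =
      -(codiff 𝒜 (higherPart b) ∘ₗ codiff 𝒜 b) := by
  have h : codiff 𝒜 ((b ∘ₗ ι R) ∘ₗ ιInv) ∘ₗ codiff 𝒜 b =
      codiff 𝒜 ((b ∘ₗ ι R) ∘ₗ ιInv) ∘ₗ codiff 𝒜 (higherPart b) := by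
    rw [← codiff_linear_add_codiff_higherPart (b := b), LinearMap.comp_add,
      hb.codiff_linear_comp_codiff_linear, zero_add]
  rw [← h]
  refine eq_neg_of_add_eq_zero_left ?_
  rw [← LinearMap.add_comp, codiff_linear_add_codiff_higherPart, hb.codiff_comp_codiff]

theorem codiff_higherPart_comp_codiff_linear :
    codiff 𝒜 (higherPart b) ∘ₗ codiff 𝒜 ((b ∘ₗ ι R) ∘ₗ ιInv) =
      -(codiff 𝒜 b ∘ₗ codiff 𝒜 (higherPart b)) := by
  have h : codiff 𝒜 b ∘ₗ codiff 𝒜 ((b ∘ₗ ι R) ∘ₗ ιInv) =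
      codiff 𝒜 (higherPart b) ∘ₗ codiff 𝒜 ((b ∘ₗ ι R) ∘ₗ ιInv) := by
    rw [← codiff_linear_add_codiff_higherPart (b := b), LinearMap.add_comp,
      hb.codiff_linear_comp_codiff_linear, zero_add]
  rw [← h]
  refine eq_neg_of_add_eq_zero_left ?_
  rw [← LinearMap.comp_add, codiff_linear_add_codiff_higherPart, hb.codiff_comp_codiff]

end IsBarStructure

end HigherPart

section PerturbationLemma

variable {R : Type u} [CommRing R]
variable {A : Type v} [AddCommGroup A] [Module R A]
variable {B : Type w} [AddCommGroup B] [Module R B]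
variable {𝒜 : ℤ → Submodule R A}
variable {ℬ : ℤ → Submodule R B}
variable {d : A →ₗ[R] A} {c : Contraction 𝒜 ℬ d} {u : TensorAlgebra R A →ₗ[R] A}

namespace Contraction

variable (c u) in
/-- `F` is the component of the inclusion of the contraction `c` perturbed by the coderivation with
component `u`. -/
structure IsPerturbedIncl (F : TensorAlgebra R B →ₗ[R] A) : Prop where
  map_one : F 1 = 0
  homogeneous : BarHomogeneous ℬ (suspension 𝒜) 0 F
  eq_add : F = c.incl ∘ₗ ιInv + c.htpy ∘ₗ u ∘ₗ hat F

variable (c) in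
theorem exists_isPerturbedIncl (hone : u 1 = 0) (hι : u ∘ₗ ι R = 0)
    (hu : BarHomogeneous 𝒜 (suspension 𝒜) (-1) u) : ∃ F, c.IsPerturbedIncl u F := by
  obtain ⟨F, hF1, hF, hfix⟩ := exists_homogeneous_fixedPoint
    (fun F : TensorAlgebra R B →ₗ[R] A => c.incl ∘ₗ ιInv + c.htpy ∘ₗ u ∘ₗ hat F)
    (fun F hF1 => by simp [hat_one hF1, hone])
    (fun F hF1 hF => .add (.comp_of_mem (fun n => c.incl_mem (n - 1)) .ιInv)
      (.comp_left (𝒳 := suspension 𝒜) (e' := 1) (fun n x hx => by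
        rw [suspension, ← sub_add_eq_add_sub]
        exact c.htpy_mem (n - 1) x hx) (hu.comp (.hat hF1 hF) (zero_add _).symm) (by simp)))
    (fun n F G hF1 hG1 h => by
      rw [add_sub_add_left_eq_sub, ← LinearMap.comp_sub]
      exact (h.comp_hat_sub_comp_hat hF1 hG1 hι).comp c.htpy)
  exact ⟨F, hF1, hF, hfix.symm⟩

namespace IsPerturbedIncl

variable {F : TensorAlgebra R B →ₗ[R] A} (hF : c.IsPerturbedIncl u F)
include hF

theorem comp_ι (hι : u ∘ₗ ι R = 0) : F ∘ₗ ι R = c.incl := by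
  have h : hat F ∘ₗ ι R = ι R ∘ₗ F ∘ₗ ι R := LinearMap.ext (hat_ι hF.map_one)
  conv_lhs => rw [hF.eq_add, LinearMap.add_comp, LinearMap.comp_assoc, ιInv_comp_ι]
  rw [LinearMap.comp_assoc, LinearMap.comp_assoc, h, ← LinearMap.comp_assoc _ _ u, hι,
    LinearMap.zero_comp, LinearMap.comp_zero, add_zero, LinearMap.comp_id]

theorem tmap_proj_comp_hat : tmap c.proj ∘ₗ hat F = LinearMap.id := by
  refine ((isCoalgHom_tmap _).comp (isCoalgHom_hat hF.map_one)).ext .id ?_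
  rw [← LinearMap.comp_assoc, ιInv_comp_tmap, LinearMap.comp_assoc, ιInv_comp_hat hF.map_one,
    hF.eq_add, LinearMap.comp_add, ← LinearMap.comp_assoc, ← LinearMap.comp_assoc,
    c.proj_comp_incl, c.proj_comp_htpy, LinearMap.zero_comp, add_zero, LinearMap.id_comp,
    LinearMap.comp_id]

variable [DirectSum.Decomposition 𝒜]

theorem hatHomotopy_comp_hat : c.hatHomotopy ∘ₗ hat F = 0 := by
  have hhat := isCoalgHom_hat hF.map_one
  refine (c.isCoder_hatHomotopy.comp_right hhat).ext (isCoalgHom_barSign.comp hhat) .zero ?_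
  rw [← LinearMap.comp_assoc, ιInv_comp_hatHomotopy, LinearMap.comp_assoc,
    ιInv_comp_hat hF.map_one, hF.eq_add, LinearMap.comp_add, ← LinearMap.comp_assoc,
    ← LinearMap.comp_assoc, c.htpy_comp_incl, c.htpy_comp_htpy, LinearMap.zero_comp,
    LinearMap.zero_comp, add_zero, LinearMap.comp_zero]

theorem hat_eq_add :
    hat F = tmap c.incl + c.hatHomotopy ∘ₗ codiff 𝒜 u ∘ₗ hat F := by
  have hhat := isCoalgHom_hat hF.map_one
  have hdiff := hhat.isCoder_sub (isCoalgHom_tmap c.incl)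
  have hhtpy := c.isCoder_hatHomotopy.comp ((isCoder_codiff (𝒜 := 𝒜) u).comp_right hhat) (by
    rw [LinearMap.id_comp, hF.hatHomotopy_comp_hat, TensorProduct.map_zero_right, zero_add,
      ← LinearMap.comp_assoc, c.hatHomotopy_comp_barSign, LinearMap.neg_comp,
      LinearMap.comp_assoc, hF.hatHomotopy_comp_hat, LinearMap.comp_zero, neg_zero,
      TensorProduct.map_zero_left])
  rw [← LinearMap.comp_assoc, barSign_comp_barSign, LinearMap.id_comp,
    ← tmap_comp, LinearMap.comp_assoc, hF.tmap_proj_comp_hat, LinearMap.comp_id] at hhtpy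
  refine sub_eq_iff_eq_add'.1 (hdiff.ext hhat hhtpy ?_)
  conv_rhs =>
    rw [← LinearMap.comp_assoc, ιInv_comp_hatHomotopy, LinearMap.comp_assoc,
      ← LinearMap.comp_assoc _ _ ιInv, ιInv_comp_codiff]
  rw [LinearMap.comp_sub, ιInv_comp_hat hF.map_one, ιInv_comp_tmap, sub_eq_iff_eq_add']
  exact hF.eq_add

theorem tmap_proj_comp_codiff_comp_hat [DirectSum.Decomposition ℬ] :
    tmap c.proj ∘ₗ codiff 𝒜 u ∘ₗ hat F = codiff ℬ (c.proj ∘ₗ u ∘ₗ hat F) := by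
  have hcoder := ((isCoder_codiff (𝒜 := 𝒜) u).comp_right (isCoalgHom_hat hF.map_one)).comp_left
    (isCoalgHom_tmap c.proj)
  rw [← LinearMap.comp_assoc, ← c.barSign_comp_tmap_proj, LinearMap.comp_assoc, LinearMap.id_comp,
    hF.tmap_proj_comp_hat, LinearMap.comp_id] at hcoder
  refine hcoder.ext isCoalgHom_barSign (isCoder_codiff _) ?_
  rw [ιInv_comp_codiff, ← LinearMap.comp_assoc, ιInv_comp_tmap, LinearMap.comp_assoc,
    ← LinearMap.comp_assoc _ _ ιInv, ιInv_comp_codiff]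

end IsPerturbedIncl

variable [DirectSum.Decomposition 𝒜]

variable (c u) in
/-- `F` is the component of the projection of the contraction `c` perturbed by the coderivation with
component `u`. -/
structure IsPerturbedProj (F : TensorAlgebra R A →ₗ[R] B) : Prop where
  map_one : F 1 = 0
  homogeneous : BarHomogeneous 𝒜 (suspension ℬ) 0 F
  eq_add : F = c.proj ∘ₗ ιInv + F ∘ₗ codiff 𝒜 u ∘ₗ c.hatHomotopy

variable (c) in
theorem lowers_codiff_comp_hatHomotopy (hu : VanishesBelow 2 u) :
    Lowers 1 (codiff 𝒜 u ∘ₗ c.hatHomotopy) := by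
  simpa using (lowers_codiff (𝒜 := 𝒜) hu).comp c.lowers_hatHomotopy

variable (c) in
theorem lowers_hatHomotopy_comp_codiff (hu : VanishesBelow 2 u) :
    Lowers 1 (c.hatHomotopy ∘ₗ codiff 𝒜 u) := by
  simpa using c.lowers_hatHomotopy.comp (lowers_codiff (𝒜 := 𝒜) hu)

variable (c) in
theorem exists_isPerturbedProj (hu2 : VanishesBelow 2 u)
    (hu : BarHomogeneous 𝒜 (suspension 𝒜) (-1) u) : ∃ F, c.IsPerturbedProj u F := by
  have hlowers := c.lowers_codiff_comp_hatHomotopy hu2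
  obtain ⟨F, hF1, hF, hfix⟩ := exists_homogeneous_fixedPoint
    (fun F : TensorAlgebra R A →ₗ[R] B => c.proj ∘ₗ ιInv + F ∘ₗ codiff 𝒜 u ∘ₗ c.hatHomotopy)
    (fun F hF1 => by
      have h := (VanishesBelow.of_map_one hF1).comp_lowers hlowers [] (by simp)
      rw [word_nil] at h
      simp [h])
    (fun F _ hF => .add (.comp_of_mem (fun n => c.proj_mem (n - 1)) .ιInv)
      (hF.comp ((barHomogeneous_codiff hu).comp c.barHomogeneous_hatHomotopy rfl) (by simp)))
    (fun n F G _ _ h => by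
      rw [add_sub_add_left_eq_sub, ← LinearMap.sub_comp]
      exact h.comp_lowers hlowers)
  exact ⟨F, hF1, hF, hfix.symm⟩

namespace IsPerturbedProj

variable {F : TensorAlgebra R A →ₗ[R] B} (hF : c.IsPerturbedProj u F)
include hF

theorem comp_ι (hu : VanishesBelow 2 u) : F ∘ₗ ι R = c.proj := by
  have h := (VanishesBelow.of_map_one hF.map_one).comp_lowers
    (c.lowers_codiff_comp_hatHomotopy hu)
  ext a
  rw [LinearMap.comp_apply, ← word_singleton, hF.eq_add, LinearMap.add_apply,
    h [a] Nat.one_lt_two, add_zero, LinearMap.comp_apply, word_singleton, ιInv_ι]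

theorem hat_comp_tmap_incl : hat F ∘ₗ tmap c.incl = LinearMap.id := by
  refine ((isCoalgHom_hat hF.map_one).comp (isCoalgHom_tmap _)).ext .id ?_
  rw [← LinearMap.comp_assoc, ιInv_comp_hat hF.map_one, hF.eq_add, LinearMap.add_comp,
    LinearMap.comp_assoc, LinearMap.comp_assoc, LinearMap.comp_assoc, c.hatHomotopy_comp_tmap_incl,
    ιInv_comp_tmap, ← LinearMap.comp_assoc, c.proj_comp_incl, LinearMap.comp_zero,
    LinearMap.comp_zero, add_zero, LinearMap.id_comp, LinearMap.comp_id]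

theorem hat_comp_hatHomotopy [DirectSum.Decomposition ℬ] : hat F ∘ₗ c.hatHomotopy = 0 := by
  have hhat := isCoalgHom_hat hF.map_one
  refine (c.isCoder_hatHomotopy.comp_left hhat).ext (hhat.comp isCoalgHom_barSign) .zero ?_
  rw [← LinearMap.comp_assoc, ιInv_comp_hat hF.map_one, hF.eq_add, LinearMap.add_comp,
    LinearMap.comp_assoc, LinearMap.comp_assoc, LinearMap.comp_assoc,
    c.hatHomotopy_comp_hatHomotopy, ιInv_comp_hatHomotopy, ← LinearMap.comp_assoc,
    c.proj_comp_htpy, LinearMap.zero_comp, LinearMap.comp_zero, LinearMap.comp_zero, add_zero,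
    LinearMap.comp_zero]

theorem hat_eq_add [DirectSum.Decomposition ℬ] :
    hat F = tmap c.proj + hat F ∘ₗ codiff 𝒜 u ∘ₗ c.hatHomotopy := by
  have hhat := isCoalgHom_hat hF.map_one
  have hdiff := hhat.isCoder_sub (isCoalgHom_tmap c.proj)
  have hhtpy := ((isCoder_codiff (𝒜 := 𝒜) u).comp_left hhat).comp c.isCoder_hatHomotopy (by
    rw [LinearMap.comp_id, hF.hat_comp_hatHomotopy, TensorProduct.map_zero_right, add_zero,
      ← barSign_comp_hat hF.map_one hF.homogeneous, LinearMap.comp_assoc, hF.hat_comp_hatHomotopy,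
      LinearMap.comp_zero, TensorProduct.map_zero_left])
  rw [LinearMap.comp_assoc, barSign_comp_barSign, LinearMap.comp_id,
    ← tmap_comp, ← LinearMap.comp_assoc, hF.hat_comp_tmap_incl, LinearMap.id_comp] at hhtpy
  refine sub_eq_iff_eq_add'.1 (hdiff.ext hhat hhtpy ?_)
  rw [LinearMap.comp_sub, ← LinearMap.comp_assoc, ← LinearMap.comp_assoc,
    ιInv_comp_hat hF.map_one, ιInv_comp_tmap, sub_eq_iff_eq_add']
  exact hF.eq_add

end IsPerturbedProj

end Contraction

end PerturbationLemma

section Transfer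

variable {R : Type u} [CommRing R]
variable {A : Type v} [AddCommGroup A] [Module R A]
variable {B : Type w} [AddCommGroup B] [Module R B]
variable {𝒜 : ℤ → Submodule R A} [DirectSum.Decomposition 𝒜]
variable {ℬ : ℤ → Submodule R B} [DirectSum.Decomposition ℬ]
variable {b : TensorAlgebra R A →ₗ[R] A} {c : Contraction 𝒜 ℬ (b ∘ₗ ι R)}
variable {I : TensorAlgebra R B →ₗ[R] A} {P : TensorAlgebra R A →ₗ[R] B}

namespace Contraction

theorem codiff_comp_hat_incl (hb : IsBarStructure 𝒜 b) (hI : c.IsPerturbedIncl (higherPart b) I) :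
    codiff 𝒜 b ∘ₗ hat I = hat I ∘ₗ codiff ℬ (c.proj ∘ₗ higherPart b ∘ₗ hat I) := by
  rw [← hI.tmap_proj_comp_codiff_comp_hat]
  nth_rw 1 [← codiff_linear_add_codiff_higherPart]
  refine perturbed_comp_incl (fun F hF => eq_zero_of_eq_lowers_comp
      (c.lowers_hatHomotopy_comp_codiff (vanishesBelow_higherPart hb.map_one)) hF)
    c.codiff_comp_tmap_incl
    (c.codiff_comp_hatHomotopy_add (barHomogeneous_linear hb.homogeneous)) ?_ hI.hat_eq_add
  rw [codiff_linear_add_codiff_higherPart]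
  exact hb.codiff_linear_comp_codiff_higherPart

theorem hat_proj_comp_codiff (hb : IsBarStructure 𝒜 b)
    (hI : c.IsPerturbedIncl (higherPart b) I) (hP : c.IsPerturbedProj (higherPart b) P) :
    hat P ∘ₗ codiff 𝒜 b = codiff ℬ (c.proj ∘ₗ higherPart b ∘ₗ hat I) ∘ₗ hat P := by
  rw [← hI.tmap_proj_comp_codiff_comp_hat,
    ← perturbed_proj_comp_incl hI.hat_eq_add hP.hat_eq_add]
  nth_rw 1 [← codiff_linear_add_codiff_higherPart]
  refine proj_comp_perturbed (fun F hF => eq_zero_of_eq_comp_lowers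
      (c.lowers_codiff_comp_hatHomotopy (vanishesBelow_higherPart hb.map_one)) hF)
    c.tmap_proj_comp_codiff
    (c.codiff_comp_hatHomotopy_add (barHomogeneous_linear hb.homogeneous)) ?_ hP.hat_eq_add
  rw [codiff_linear_add_codiff_higherPart]
  exact hb.codiff_higherPart_comp_codiff_linear

theorem isBarStructure_transfer (hb : IsBarStructure 𝒜 b)
    (hI : c.IsPerturbedIncl (higherPart b) I) :
    IsBarStructure ℬ (c.proj ∘ₗ higherPart b ∘ₗ hat I) where
  map_one := by simp [hat_one hI.map_one, higherPart_one hb.map_one]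
  homogeneous := .comp_of_mem (fun n => c.proj_mem (n - 1))
    ((barHomogeneous_higherPart hb.homogeneous).comp (.hat hI.map_one hI.homogeneous) rfl)
  comp_codiff := by
    set b' := c.proj ∘ₗ higherPart b ∘ₗ hat I
    have hD := c.codiff_comp_hat_incl hb hI
    have hsq : codiff ℬ b' ∘ₗ codiff ℬ b' = 0 := calc
      codiff ℬ b' ∘ₗ codiff ℬ b' = tmap c.proj ∘ₗ (hat I ∘ₗ codiff ℬ b') ∘ₗ codiff ℬ b' := by
        rw [LinearMap.comp_assoc, ← LinearMap.comp_assoc, hI.tmap_proj_comp_hat, LinearMap.id_comp]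
      _ = tmap c.proj ∘ₗ codiff 𝒜 b ∘ₗ codiff 𝒜 b ∘ₗ hat I := by
        rw [← hD, LinearMap.comp_assoc, ← hD]
      _ = 0 := by
        rw [← LinearMap.comp_assoc _ _ (codiff 𝒜 b), hb.codiff_comp_codiff, LinearMap.zero_comp,
          LinearMap.comp_zero]
    calc b' ∘ₗ codiff ℬ b' = ιInv ∘ₗ codiff ℬ b' ∘ₗ codiff ℬ b' := by
          rw [← LinearMap.comp_assoc, ιInv_comp_codiff]
      _ = 0 := by rw [hsq, LinearMap.comp_zero]

variable (c) in
theorem exists_transfer (hb : IsBarStructure 𝒜 b) :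
    ∃ (b' : TensorAlgebra R B →ₗ[R] B) (I : TensorAlgebra R B →ₗ[R] A)
      (P : TensorAlgebra R A →ₗ[R] B),
      IsBarStructure ℬ b' ∧ IsBarMorphism ℬ 𝒜 b' b I ∧ IsBarMorphism 𝒜 ℬ b b' P ∧
      I ∘ₗ ι R = c.incl ∧ P ∘ₗ ι R = c.proj ∧ b' ∘ₗ ι R = 0 ∧
      ∀ x y, b' (word R [x, y]) = c.proj (b (word R [c.incl x, c.incl y])) := by
  have hlow := vanishesBelow_higherPart hb.map_one
  have hhom := barHomogeneous_higherPart hb.homogeneous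
  obtain ⟨I, hI⟩ := c.exists_isPerturbedIncl (higherPart_one hb.map_one) higherPart_comp_ι hhom
  obtain ⟨P, hP⟩ := c.exists_isPerturbedProj hlow hhom
  have hIι : I ∘ₗ ι R = c.incl := hI.comp_ι higherPart_comp_ι
  refine ⟨c.proj ∘ₗ higherPart b ∘ₗ hat I, I, P, c.isBarStructure_transfer hb hI,
    .of_codiff_comp_hat hI.map_one hI.homogeneous (c.codiff_comp_hat_incl hb hI),
    .of_codiff_comp_hat hP.map_one hP.homogeneous (c.hat_proj_comp_codiff hb hI hP).symm,
    hIι, hP.comp_ι hlow, LinearMap.ext fun x => ?_, fun x y => ?_⟩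
  · simp only [LinearMap.comp_apply, hat_ι hI.map_one, higherPart_ι, map_zero,
      LinearMap.zero_apply]
  · have hx (x : B) : I (ι R x) = c.incl x := LinearMap.congr_fun hIι x
    rw [LinearMap.comp_apply, LinearMap.comp_apply, hat_word_pair hI.map_one, map_add,
      higherPart_ι, add_zero, hx, hx, higherPart_word_of_ne (by simp)]

end Contraction

end Transfer

section Homology

/-- The general solution of `d q d = d` is improved in two steps: `q d q` is a reflexive generalized
inverse, and the factor `1 - q d` makes it square to zero. -/
theorem generalized_inverse_of_sq_zero {E : Type*} [Ring E] {d q : E} (hdd : d * d = 0)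
    (hdqd : d * q * d = d) :
    d * (q * d * q * (1 - q * d)) * d = d ∧
      q * d * q * (1 - q * d) * d * (q * d * q * (1 - q * d)) = q * d * q * (1 - q * d) ∧
      q * d * q * (1 - q * d) * (q * d * q * (1 - q * d)) = 0 := by
  have hright : (1 - q * d) * d = d := by rw [sub_mul, one_mul, mul_assoc, hdd, mul_zero, sub_zero]
  have hleft : (1 - q * d) * q * d = 0 := by
    rw [sub_mul, one_mul, sub_mul, mul_assoc q d, mul_assoc q, hdqd, sub_self]
  have hmid : d * (q * d * q) = d * q := by rw [← mul_assoc, ← mul_assoc, hdqd]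
  refine ⟨?_, ?_, ?_⟩
  · rw [mul_assoc, mul_assoc _ _ d, hright, ← mul_assoc, hmid, hdqd]
  · rw [mul_assoc _ _ d, hright, ← mul_assoc, mul_assoc (q * d * q) d, hmid,
      show q * d * q * (d * q) = q * (d * q * d) * q by noncomm_ring, hdqd]
  · rw [mul_assoc, ← mul_assoc (1 - q * d), ← mul_assoc (1 - q * d), ← mul_assoc (1 - q * d),
      hleft, zero_mul, zero_mul, mul_zero]

theorem one_sub_sub_of_generalized_inverse {E : Type*} [Ring E] {d q : E} (hdd : d * d = 0)
    (hdqd : d * q * d = d) (hqdq : q * d * q = q) (hqq : q * q = 0) :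
    d * (1 - d * q - q * d) = 0 ∧ (1 - d * q - q * d) * d = 0 ∧
      q * (1 - d * q - q * d) = 0 ∧ (1 - d * q - q * d) * q = 0 ∧
      (1 - d * q - q * d) * (1 - d * q - q * d) = 1 - d * q - q * d := by
  have hed : (1 - d * q - q * d) * d = 0 := by simp [sub_mul, mul_assoc q, hdd, hdqd]
  have heq : (1 - d * q - q * d) * q = 0 := by simp [sub_mul, mul_assoc d, hqq, hqdq]
  refine ⟨?_, hed, ?_, heq, ?_⟩
  · simp [mul_sub, ← mul_assoc, hdd, hdqd]
  · simp [mul_sub, ← mul_assoc, hqq, hqdq]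
  · rw [mul_sub _ _ (q * d), mul_sub, ← mul_assoc, ← mul_assoc, hed, heq, zero_mul, zero_mul,
      mul_one, sub_zero, sub_zero]

variable {k : Type u} [Field k]
variable {A : Type v} [AddCommGroup A] [Module k A]
variable {B : Type v} [AddCommGroup B] [Module k B]
variable {𝒜 : ℤ → Submodule k A} [DirectSum.Decomposition 𝒜]
variable {ℬ : ℤ → Submodule k B} [DirectSum.Decomposition ℬ]

variable (𝒜 ℬ) in
/-- The homogeneous part of degree `e` of a linear map, which makes choices made without regard to
the grading homogeneous. -/
def homogeneousPart (e : ℤ) (f : A →ₗ[k] B) : A →ₗ[k] B :=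
  DirectSum.toModule k ℤ B (fun n => Structure.proj ℬ (n + e) ∘ₗ f ∘ₗ (𝒜 n).subtype) ∘ₗ
    (DirectSum.decomposeLinearEquiv 𝒜).toLinearMap

theorem homogeneousPart_of_mem (e : ℤ) (f : A →ₗ[k] B) {n : ℤ} {a : A} (ha : a ∈ 𝒜 n) :
    homogeneousPart 𝒜 ℬ e f a = Structure.proj ℬ (n + e) (f a) := by
  have h : DirectSum.decomposeLinearEquiv 𝒜 a = DirectSum.lof k ℤ (fun i => 𝒜 i) n ⟨a, ha⟩ :=
    DirectSum.decomposeLinearEquiv_apply_coe 𝒜 n ⟨a, ha⟩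
  simp [homogeneousPart, h]

theorem homogeneousPart_mem (e : ℤ) (f : A →ₗ[k] B) (n : ℤ) (a : A) (ha : a ∈ 𝒜 n) :
    homogeneousPart 𝒜 ℬ e f a ∈ ℬ (n + e) := by
  rw [homogeneousPart_of_mem e f ha]
  exact (DirectSum.decompose ℬ (f a) (n + e)).2

namespace Structure

variable (S : Structure 𝒜)

theorem diff_comp_diff : S.diff ∘ₗ S.diff = 0 := LinearMap.ext S.diff_diff

theorem exists_homogeneous_generalized_inverse :
    ∃ q : A →ₗ[k] A, (∀ n x, x ∈ 𝒜 n → q x ∈ 𝒜 (n + 1)) ∧ S.diff ∘ₗ q ∘ₗ S.diff = S.diff := by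
  obtain ⟨g, hg⟩ := S.diff.rangeRestrict.exists_rightInverse_of_surjective
    S.diff.range_rangeRestrict
  obtain ⟨q, hq⟩ := g.exists_extend
  have hqd (x : A) : S.diff (q (S.diff x)) = S.diff x := by
    have hqx : q (S.diff x) = g ⟨S.diff x, x, rfl⟩ := LinearMap.congr_fun hq ⟨S.diff x, x, rfl⟩
    rw [hqx]
    exact congrArg Subtype.val (LinearMap.congr_fun hg ⟨S.diff x, x, rfl⟩)
  refine ⟨homogeneousPart 𝒜 𝒜 1 q, homogeneousPart_mem 1 q,
    DirectSum.decompose_lhom_ext 𝒜 fun n => LinearMap.ext fun ⟨y, hy⟩ => ?_⟩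
  simp only [LinearMap.comp_apply, Submodule.subtype_apply]
  rw [homogeneousPart_of_mem 1 q (S.diff_mem hy), S.diff_proj, hqd, add_sub_cancel_right]
  exact DirectSum.decompose_of_mem_same 𝒜 (S.diff_mem hy)

theorem exists_homogeneous_sq_zero_generalized_inverse :
    ∃ q : A →ₗ[k] A, (∀ n x, x ∈ 𝒜 n → q x ∈ 𝒜 (n + 1)) ∧ S.diff ∘ₗ q ∘ₗ S.diff = S.diff ∧
      q ∘ₗ S.diff ∘ₗ q = q ∧ q ∘ₗ q = 0 := by
  obtain ⟨q, hq, hdqd⟩ := S.exists_homogeneous_generalized_inverse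
  have hqd (n : ℤ) (x : A) (hx : x ∈ 𝒜 n) : q (S.diff x) ∈ 𝒜 n := by
    simpa using hq _ _ (S.diff_mem hx)
  obtain ⟨h₁, h₂, h₃⟩ := generalized_inverse_of_sq_zero (E := Module.End k A) (d := S.diff)
    S.diff_comp_diff hdqd
  exact ⟨q ∘ₗ S.diff ∘ₗ q ∘ₗ (LinearMap.id - q ∘ₗ S.diff), fun n x hx =>
    hqd _ _ (hq n _ (Submodule.sub_mem _ hx (hqd n x hx))), h₁, h₂, h₃⟩

variable {S}

/-- The map from `A` to the homology sending `x` to the class of the cycle `f x`. -/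
def clsComp (f : A →ₗ[k] A) (hf : S.diff ∘ₗ f = 0) : A →ₗ[k] S.Homology :=
  S.cls ∘ₗ f.codRestrict S.cycles fun x => S.mem_cycles.2 (LinearMap.congr_fun hf x)

/-- The map from the homology to `A` sending the class of a cycle `z` to `f z`. -/
def liftHomology (f : A →ₗ[k] A) (hf : f ∘ₗ S.diff = 0) : S.Homology →ₗ[k] A :=
  S.boundaries.liftQ (f ∘ₗ S.cycles.subtype) fun x ⟨y, hy⟩ => by
    rw [LinearMap.mem_ker, LinearMap.comp_apply, ← hy]
    exact LinearMap.congr_fun hf y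

theorem clsComp_comp_eq_zero {f g : A →ₗ[k] A} (hf : S.diff ∘ₗ f = 0) (hfg : f ∘ₗ g = 0) :
    clsComp f hf ∘ₗ g = 0 :=
  LinearMap.ext fun x =>
    (congrArg S.cls (Subtype.ext (LinearMap.congr_fun hfg x))).trans (map_zero _)

theorem clsComp_of_eq_add_diff {f : A →ₗ[k] A} (hf : S.diff ∘ₗ f = 0) {z : S.cycles} {y : A}
    (h : f z = z + S.diff y) : clsComp f hf z = S.cls z := by
  refine sub_eq_zero.1 ((map_sub S.cls _ _).symm.trans (S.cls_eq_zero.2 ⟨y, ?_⟩))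
  exact (sub_eq_of_eq_add' h).symm

theorem comp_liftHomology_eq_zero {f g : A →ₗ[k] A} (hf : f ∘ₗ S.diff = 0) (hgf : g ∘ₗ f = 0) :
    g ∘ₗ liftHomology f hf = 0 := by
  refine LinearMap.ext fun x => ?_
  obtain ⟨z, rfl⟩ := S.cls_surjective x
  exact LinearMap.congr_fun hgf z

variable (S)

/-- For a homogeneous `q` with `d q d = d`, `q d q = q` and `q² = 0`, the idempotent
`e = 1 - d q - q d` is the composite of the projection onto the homology with the inclusion, and
`-q` is the homotopy. -/
theorem exists_contraction :
    ∃ c : Contraction 𝒜 S.homologyGrading S.diff, ∀ z : S.cycles, c.proj z = S.cls z := by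
  obtain ⟨q, hq, hdqd, hqdq, hqq⟩ := S.exists_homogeneous_sq_zero_generalized_inverse
  let e : A →ₗ[k] A := LinearMap.id - S.diff ∘ₗ q - q ∘ₗ S.diff
  obtain ⟨hde, hed, hqe, heq, hee⟩ : S.diff ∘ₗ e = 0 ∧ e ∘ₗ S.diff = 0 ∧ q ∘ₗ e = 0 ∧ e ∘ₗ q = 0 ∧
      e ∘ₗ e = e :=
    one_sub_sub_of_generalized_inverse (E := Module.End k A) S.diff_comp_diff hdqd hqdq hqq
  have he (n : ℤ) (x : A) (hx : x ∈ 𝒜 n) : e x ∈ 𝒜 n :=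
    Submodule.sub_mem _ (Submodule.sub_mem _ hx (by simpa using S.diff_mem (hq n x hx)))
      (by simpa using hq _ _ (S.diff_mem hx))
  have hcls (z : S.cycles) : clsComp e hde z = S.cls z := by
    refine clsComp_of_eq_add_diff hde (y := -q z) ?_
    simp [e, S.mem_cycles.1 z.2, sub_eq_add_neg]
  refine ⟨{
    incl := liftHomology e hed
    proj := clsComp e hde
    htpy := -q
    incl_mem := ?_
    proj_mem := fun n x hx => ⟨_, he n x hx, rfl⟩
    htpy_mem := fun n x hx => Submodule.neg_mem _ (hq n x hx)
    proj_comp_incl := LinearMap.ext fun x => ?_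
    diff_comp_incl := comp_liftHomology_eq_zero hed hde
    proj_comp_diff := clsComp_comp_eq_zero hde hed
    diff_comp_htpy_add := ?_
    htpy_comp_htpy := by rw [LinearMap.neg_comp, LinearMap.comp_neg, hqq, neg_zero, neg_zero]
    htpy_comp_incl := by rw [LinearMap.neg_comp, comp_liftHomology_eq_zero hed hqe, neg_zero]
    proj_comp_htpy := by rw [LinearMap.comp_neg, clsComp_comp_eq_zero hde heq, neg_zero] }, hcls⟩
  · rintro n _ ⟨z, hz, rfl⟩
    exact he n z hz
  · obtain ⟨z, rfl⟩ := S.cls_surjective x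
    exact (hcls _).trans (hcls z)
  · calc S.diff ∘ₗ (-q) + (-q) ∘ₗ S.diff = e - LinearMap.id := by
          rw [LinearMap.comp_neg, LinearMap.neg_comp]
          simp only [e]
          abel
      _ = e ∘ₗ e - LinearMap.id := by rw [hee]

end Structure

end Homology

section Compositions

/-- The composition `(i + 1, i₁, …, iᵣ)` obtained by adding a block of length `i + 1` in front of
`(i₁, …, iᵣ)`. -/
def consBlock {n : ℕ} (i : Fin (n + 1)) (c : Composition (n - i)) : Composition (n + 1) where
  blocks := (i + 1) :: c.blocks
  blocks_pos {j} hj := by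
    rcases List.mem_cons.1 hj with rfl | hj
    · exact Nat.succ_pos _
    · exact c.blocks_pos hj
  blocks_sum := by
    rw [List.sum_cons, c.blocks_sum]
    lia

theorem consBlock_injective {n : ℕ} :
    Function.Injective fun x : Σ i : Fin (n + 1), Composition (n - i) => consBlock x.1 x.2 := by
  rintro ⟨i, c⟩ ⟨j, d⟩ h
  obtain ⟨hij, hcd⟩ := List.cons.inj (congrArg Composition.blocks h)
  obtain rfl := Fin.ext (Nat.succ_injective hij)
  obtain rfl := Composition.ext hcd
  rfl

theorem consBlock_surjective {n : ℕ} :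
    Function.Surjective fun x : Σ i : Fin (n + 1), Composition (n - i) => consBlock x.1 x.2 := by
  intro c
  obtain ⟨m, l, hl⟩ := List.exists_cons_of_ne_nil fun h => n.succ_ne_zero (c.blocks_eq_nil.1 h)
  have hm : 0 < m := c.blocks_pos (by simp [hl])
  have hsum : m + l.sum = n + 1 := by rw [← List.sum_cons, ← hl, c.blocks_sum]
  refine ⟨⟨⟨m - 1, by lia⟩, ⟨l, fun hj => c.blocks_pos (by simp [hl, hj]), ?_⟩⟩,
    Composition.ext ?_⟩
  · change l.sum = n - (m - 1)
    lia
  · simp [consBlock, hl, Nat.sub_add_cancel hm]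

theorem sum_composition_succ {M : Type*} [AddCommMonoid M] (n : ℕ) (φ : Composition (n + 1) → M) :
    ∑ c, φ c = ∑ i : Fin (n + 1), ∑ c : Composition (n - i), φ (consBlock i c) := by
  rw [← Fintype.sum_sigma']
  exact (Fintype.sum_bijective _ ⟨consBlock_injective, consBlock_surjective⟩ _ _
    fun _ => rfl).symm

theorem splitWrtComposition_consBlock {X : Type*} {n : ℕ} (l : List X) (i : Fin (n + 1))
    (c : Composition (n - i)) : l.splitWrtComposition (consBlock i c) =
      l.take (i + 1) :: (l.drop (i + 1)).splitWrtComposition c :=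
  List.splitWrtCompositionAux_cons _ _ _

theorem splitWrtComposition_ofFn {X : Type*} {n : ℕ} (a : Fin n → X) (c : Composition n) :
    (List.ofFn a).splitWrtComposition c = List.ofFn fun j => List.ofFn (a ∘ c.embedding j) := by
  refine List.ext_getElem (by simp) fun j hj hj' => ?_
  have hlen : j < c.length := by simpa using hj'
  have hsucc := c.sizeUpTo_succ hlen
  have hle := c.sizeUpTo_le (j + 1)
  rw [List.getElem_splitWrtComposition, List.getElem_ofFn]
  refine List.ext_getElem ?_ fun p hp hp' => ?_
  · simp only [List.length_drop, List.length_take, List.length_ofFn, Composition.blocksFun,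
      List.get_eq_getElem]
    lia
  · simp only [List.getElem_drop, List.getElem_take, List.getElem_ofFn, Function.comp_apply]
    exact congrArg a (Fin.ext (c.coe_embedding ⟨j, hlen⟩ ⟨p, by simpa using hp'⟩).symm)

variable {R : Type u} [CommSemiring R]
variable {A : Type v} [AddCommMonoid A] [Module R A]
variable {B : Type w} [AddCommMonoid B] [Module R B]
variable {F : TensorAlgebra R A →ₗ[R] B}

theorem hat_word_of_ne_nil (hF : F 1 = 0) {l : List A} (hl : l ≠ []) :
    hat F (word R l) = ∑ i ∈ Finset.range l.length,
      ι R (F (word R (l.take (i + 1)))) * hat F (word R (l.drop (i + 1))) := by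
  rw [hat_eq hF, LinearMap.add_apply, convUnit_word_of_ne hl, zero_add, conv_word,
    Finset.sum_range_succ', List.take_zero, word_nil, LinearMap.comp_apply, hF, map_zero, zero_mul,
    add_zero, ← hat_eq hF]
  rfl

theorem hat_word (hF : F 1 = 0) {n : ℕ} {l : List A} (hl : l.length = n) :
    hat F (word R l) = ∑ c : Composition n,
      word R ((l.splitWrtComposition c).map fun u => F (word R u)) := by
  induction n using Nat.strong_induction_on generalizing l with
  | _ n ih =>
    cases n with
    | zero =>
      obtain rfl := List.length_eq_zero_iff.1 hl
      have := Fintype.card_le_one_iff_subsingleton.1 (composition_card 0).le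
      rw [word_nil, hat_one hF, Fintype.sum_subsingleton _ (Composition.ones 0)]
      rfl
    | succ n =>
      rw [hat_word_of_ne_nil hF (List.ne_nil_of_length_eq_add_one hl), hl, sum_composition_succ,
        ← Fin.sum_univ_eq_sum_range fun i =>
          ι R (F (word R (l.take (i + 1)))) * hat F (word R (l.drop (i + 1)))]
      refine Finset.sum_congr rfl fun i _ => ?_
      rw [ih (n - i) (by lia) (by rw [List.length_drop, hl]; lia), Finset.mul_sum]
      refine Finset.sum_congr rfl fun c _ => ?_
      rw [splitWrtComposition_consBlock, List.map_cons, word_cons]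

theorem hat_word_ofFn (hF : F 1 = 0) {n : ℕ} (a : Fin n → A) :
    hat F (word R (List.ofFn a)) = ∑ c : Composition n,
      word R (List.ofFn fun j => F (word R (List.ofFn (a ∘ c.embedding j)))) := by
  rw [hat_word hF List.length_ofFn]
  refine Finset.sum_congr rfl fun c _ => ?_
  rw [splitWrtComposition_ofFn, List.map_ofFn]
  rfl

variable {n : ℕ} (c : Composition n) (j : Fin c.length)

/-- The total degree `∑_{l > j} (i_l - 1)` of the maps `f_{i_l}` that the Koszul rule moves past the
`j`-th block of `(i_1, …, i_r)`. -/
def tailDegree : ℕ := ∑ l ∈ Finset.Ioi j, (c.blocksFun l - 1)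

theorem signExp_eq_sum_tailDegree :
    signExp c = ∑ j : Fin c.length, tailDegree c j * c.blocksFun j := by
  simp only [tailDegree, Finset.sum_mul]
  exact Finset.sum_comm' (by simp)

theorem sizeUpTo_succ_add_sum_Ioi :
    c.sizeUpTo (j + 1) + ∑ l ∈ Finset.Ioi j, c.blocksFun l = n := by
  have hsize : c.sizeUpTo (j + 1) = ∑ l with ¬ j < l, c.blocksFun l := by
    rw [Composition.sizeUpTo, ← c.ofFn_blocksFun, List.sum_take_ofFn]
    refine Finset.sum_congr (Finset.filter_congr fun l _ => ?_) fun _ _ => rfl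
    rw [not_lt, Nat.lt_succ_iff, Fin.le_def]
  rw [hsize, add_comm, ← Finset.filter_lt_eq_Ioi, Finset.sum_filter_add_sum_filter_not,
    c.sum_blocksFun]

theorem sizeUpTo_succ_add_tailDegree_add :
    c.sizeUpTo (j + 1) + tailDegree c j + (c.length - 1 - j) = n := by
  have htail : tailDegree c j + (c.length - 1 - j) = ∑ l ∈ Finset.Ioi j, c.blocksFun l := by
    rw [tailDegree, ← Fin.card_Ioi, Finset.card_eq_sum_ones, ← Finset.sum_add_distrib]
    exact Finset.sum_congr rfl fun l _ => Nat.sub_add_cancel (c.one_le_blocksFun l)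
  rw [add_assoc, htail, sizeUpTo_succ_add_sum_Ioi]

end Compositions

section TupleDegrees

variable {R : Type u} [CommSemiring R] {A : Type v} [AddCommMonoid A] [Module R A]
variable {𝒜 : ℤ → Submodule R A}

theorem hasDegrees_ofFn {n : ℕ} {a : Fin n → A} {d : Fin n → ℤ} (h : ∀ i, a i ∈ 𝒜 (d i)) :
    HasDegrees 𝒜 (List.ofFn a) (List.ofFn d) :=
  List.forall₂_iff_get.2 ⟨by simp, fun i _ _ => by simpa using h _⟩

theorem HasDegrees.exists_ofFn {l : List A} {ds : List ℤ} (h : HasDegrees 𝒜 l ds) :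
    ∃ (n : ℕ) (a : Fin n → A) (d : Fin n → ℤ),
      (∀ i, a i ∈ 𝒜 (d i)) ∧ List.ofFn a = l ∧ List.ofFn d = ds :=
  ⟨l.length, l.get, fun i => ds.get (i.cast h.length_eq), fun i => h.get i.2 (h.length_eq ▸ i.2),
    List.ofFn_get l, by rw [← List.ofFn_congr h.length_eq.symm, List.ofFn_get]⟩

end TupleDegrees

section SuspensionSignPowers

variable {R : Type u} [CommRing R]
variable {A : Type v} [AddCommGroup A] [Module R A]
variable {B : Type w} [AddCommGroup B] [Module R B]
variable {𝒜 : ℤ → Submodule R A} [DirectSum.Decomposition 𝒜]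
variable {ℬ : ℤ → Submodule R B} [DirectSum.Decomposition ℬ]

theorem suspSign_pow_of_even {n : ℕ} (h : Even n) : suspSign 𝒜 ^ n = 1 := by
  obtain ⟨m, rfl⟩ := h
  have hsq : suspSign 𝒜 * suspSign 𝒜 = 1 := suspSign_comp_suspSign
  rw [← two_mul, pow_mul, pow_two, hsq, one_pow]

theorem suspSign_pow_eq_of_even_add {m n : ℕ} (h : Even (m + n)) :
    suspSign 𝒜 ^ m = suspSign 𝒜 ^ n := by
  calc suspSign 𝒜 ^ m = suspSign 𝒜 ^ (m + (n + n)) := by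
        rw [pow_add, suspSign_pow_of_even (Even.add_self n), mul_one]
    _ = suspSign 𝒜 ^ n := by rw [← add_assoc, pow_add, suspSign_pow_of_even h, one_mul]

theorem suspSign_pow_mem {n : ℤ} {a : A} (h : a ∈ 𝒜 n) (m : ℕ) : (suspSign 𝒜 ^ m) a ∈ 𝒜 n := by
  induction m with
  | zero => exact h
  | succ m ih =>
    rw [pow_succ', Module.End.mul_apply]
    exact suspSign_mem ih

theorem BarHomogeneous.suspSign_pow_apply {F : TensorAlgebra R A →ₗ[R] B} {e : ℤ}
    (hF : BarHomogeneous 𝒜 (suspension ℬ) e F) (m : ℕ) (l : List A) :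
    (suspSign ℬ ^ m) (F (word R l)) =
      (e.negOnePow : ℤ) ^ m • F (word R (l.map (suspSign 𝒜 ^ m))) := by
  induction m generalizing l with
  | zero => simp [Module.End.one_eq_id]
  | succ m ih =>
    rw [pow_succ, Module.End.mul_apply, ← LinearMap.comp_apply (suspSign ℬ), hF.suspSign_comp,
      LinearMap.smul_apply, map_zsmul, LinearMap.comp_apply, barSign, tmap_word, ih, smul_smul,
      ← pow_succ', List.map_map]
    rfl

variable (𝒜) in
/-- The sign relating a word on `A` to the same word on the suspension of `A`: the Koszul sign for
moving the suspension maps `s` in `s a₁ ⊗ ⋯ ⊗ s aₙ` past the entries to their left, with the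
constant `(-1) ^ (n (n - 1) / 2)` included so that `twist` is an involution. -/
def twist {n : ℕ} (a : Fin n → A) : Fin n → A := fun j => (suspSign 𝒜 ^ (n - 1 - j)) (a j)

theorem twist_twist {n : ℕ} (a : Fin n → A) : twist 𝒜 (twist 𝒜 a) = a := by
  funext j
  rw [twist, twist, ← Module.End.mul_apply, ← pow_add, suspSign_pow_of_even (Even.add_self _),
    Module.End.one_apply]

theorem twist_mem {n : ℕ} {a : Fin n → A} {d : Fin n → ℤ} (h : ∀ i, a i ∈ 𝒜 (d i)) (i : Fin n) :
    twist 𝒜 a i ∈ 𝒜 (d i) := suspSign_pow_mem (h i) _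

theorem twist_one (a : Fin 1 → A) : twist 𝒜 a = a := by
  funext j
  simp [twist]

theorem ofFn_twist_pair (x y : A) : List.ofFn (twist 𝒜 ![x, y]) = [suspSign 𝒜 x, y] := by
  simp [twist]

theorem suspSign_pow_twist_embedding {n : ℕ} (a : Fin n → A) (c : Composition n)
    (j : Fin c.length) (p : Fin (c.blocksFun j)) :
    (suspSign 𝒜 ^ (c.length - 1 - j)) (twist 𝒜 a (c.embedding j p)) =
      twist 𝒜 (fun q => (suspSign 𝒜 ^ tailDegree c j) (a (c.embedding j q))) p := by
  simp only [twist, ← Module.End.mul_apply, ← pow_add]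
  refine LinearMap.congr_fun (suspSign_pow_eq_of_even_add ?_) _
  have hsize := sizeUpTo_succ_add_tailDegree_add c j
  have hp := p.2
  rw [c.sizeUpTo_succ'] at hsize
  rw [c.coe_embedding]
  exact ⟨c.blocksFun j - 1 - p + tailDegree c j + (c.length - 1 - j), by lia⟩

end SuspensionSignPowers

section Desuspension

variable {k : Type u} [Field k]
variable {A : Type v} [AddCommGroup A] [Module k A]
variable {B : Type v} [AddCommGroup B] [Module k B]
variable {C : Type v} [AddCommGroup C] [Module k C]
variable {𝒜 : ℤ → Submodule k A} [DirectSum.Decomposition 𝒜]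
variable {ℬ : ℤ → Submodule k B}

theorem suspSign_eq_neg_signInv : suspSign 𝒜 = -signInv 𝒜 := by
  refine DirectSum.decompose_lhom_ext 𝒜 fun n => LinearMap.ext fun ⟨a, ha⟩ => ?_
  simp [suspSign_of_mem ha, signInv_of_mem 𝒜 ha, Int.negOnePow_succ]

theorem suspSign_pow_eq_smul_signInv_pow (n : ℕ) (a : A) :
    (suspSign 𝒜 ^ n) a = (-1 : ℤ) ^ n • (signInv 𝒜 ^ n) a := by
  rw [suspSign_eq_neg_signInv, ← neg_one_zsmul (signInv 𝒜), smul_pow]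
  rfl

variable (𝒜) in
/-- The linear map on the tensor algebra of the suspension that corresponds to a family of
multilinear maps; it vanishes on the unit, whatever the irrelevant member of arity zero is. -/
def toBar (f : Family k A B) : TensorAlgebra k A →ₗ[k] B :=
  glue fun n => if n = 0 then 0 else (f n).compLinearMap fun j => suspSign 𝒜 ^ (n - 1 - j)

variable (𝒜) in
/-- The family of multilinear maps that corresponds to a linear map on the tensor algebra of the
suspension. -/
def ofBar (F : TensorAlgebra k A →ₗ[k] B) : Family k A B := fun n =>
  (F.compMultilinearMap (TensorAlgebra.tprod k A n)).compLinearMap fun j => suspSign 𝒜 ^ (n - 1 - j)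

theorem ofBar_apply (F : TensorAlgebra k A →ₗ[k] B) {n : ℕ} (a : Fin n → A) :
    ofBar 𝒜 F n a = F (word k (List.ofFn (twist 𝒜 a))) := by
  rw [← tprod_eq_word]
  rfl

theorem toBar_ofFn (f : Family k A B) {n : ℕ} (hn : n ≠ 0) (a : Fin n → A) :
    toBar 𝒜 f (word k (List.ofFn a)) = f n (twist 𝒜 a) := by
  rw [toBar, glue_ofFn, if_neg hn]
  rfl

theorem toBar_ofFn_twist (f : Family k A B) {n : ℕ} (hn : n ≠ 0) (a : Fin n → A) :
    toBar 𝒜 f (word k (List.ofFn (twist 𝒜 a))) = f n a := by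
  rw [toBar_ofFn f hn, twist_twist]

theorem toBar_one (f : Family k A B) : toBar 𝒜 f 1 = 0 := by
  rw [← word_nil, toBar, glue_word]
  rfl

theorem toBar_ι (f : Family k A B) (a : A) : toBar 𝒜 f (ι k a) = linPart f a := by
  rw [← word_singleton, linPart_apply, ← toBar_ofFn_twist (𝒜 := 𝒜) f one_ne_zero, twist_one]
  rfl

theorem toBar_ofBar {F : TensorAlgebra k A →ₗ[k] B} (h : F 1 = 0) : toBar 𝒜 (ofBar 𝒜 F) = F := by
  refine ext_word fun l => ?_
  rcases eq_or_ne l.length 0 with hl | hl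
  · rw [List.length_eq_zero_iff.1 hl, word_nil, toBar_one, h]
  · rw [← List.ofFn_get l, toBar_ofFn _ hl, ofBar_apply, twist_twist]

theorem linPart_ofBar {F : TensorAlgebra k A →ₗ[k] B} (h : F 1 = 0) (a : A) :
    linPart (ofBar 𝒜 F) a = F (ι k a) := by
  rw [← toBar_ι (𝒜 := 𝒜), toBar_ofBar h]

theorem HasDegree.barHomogeneous_toBar {f : Family k A B} {e : ℤ} (hf : HasDegree 𝒜 ℬ f e) :
    BarHomogeneous 𝒜 (suspension ℬ) (e + 1) (toBar 𝒜 f) := by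
  intro l ds hl
  obtain ⟨n, a, d, ha, rfl, rfl⟩ := hl.exists_ofFn
  rcases eq_or_ne n 0 with rfl | hn
  · rw [List.ofFn_zero (f := a), word_nil, toBar_one]
    exact Submodule.zero_mem _
  · have hmem := hf n (Nat.one_le_iff_ne_zero.2 hn) d _ (twist_mem ha)
    rw [toBar_ofFn f hn, List.sum_ofFn, List.length_ofFn, suspension]
    convert hmem using 2
    ring

theorem BarHomogeneous.hasDegree_ofBar {F : TensorAlgebra k A →ₗ[k] B} {e : ℤ}
    (hF : BarHomogeneous 𝒜 (suspension ℬ) (e + 1) F) : HasDegree 𝒜 ℬ (ofBar 𝒜 F) e := by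
  intro n _ d a ha
  have hmem := hF _ _ (hasDegrees_ofFn (twist_mem ha))
  rw [ofBar_apply]
  rw [List.sum_ofFn, List.length_ofFn, suspension] at hmem
  convert hmem using 2
  ring

variable [DirectSum.Decomposition ℬ]

theorem twist_toBar_blocks {f : Family k A B} (hf : HasDegree 𝒜 ℬ f (-1)) {n : ℕ} (a : Fin n → A)
    (c : Composition n) (j : Fin c.length) :
    twist ℬ (fun j => toBar 𝒜 f (word k (List.ofFn (twist 𝒜 a ∘ c.embedding j)))) j =
      (-1 : k) ^ (tailDegree c j * c.blocksFun j) • f (c.blocksFun j) (fun q =>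
        (signInv 𝒜 ^ tailDegree c j) (a (c.embedding j q))) := by
  have hblock : (List.ofFn (twist 𝒜 a ∘ c.embedding j)).map (suspSign 𝒜 ^ (c.length - 1 - j)) =
      List.ofFn (twist 𝒜 fun q => (suspSign 𝒜 ^ tailDegree c j) (a (c.embedding j q))) := by
    rw [List.map_ofFn]
    exact congrArg _ (funext (suspSign_pow_twist_embedding a c j))
  calc (suspSign ℬ ^ (c.length - 1 - j))
        (toBar 𝒜 f (word k (List.ofFn (twist 𝒜 a ∘ c.embedding j))))
      = f (c.blocksFun j) (fun q => (suspSign 𝒜 ^ tailDegree c j) (a (c.embedding j q))) := by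
        rw [hf.barHomogeneous_toBar.suspSign_pow_apply, hblock,
          toBar_ofFn_twist f (Nat.one_le_iff_ne_zero.1 (c.one_le_blocksFun j))]
        simp
    _ = f (c.blocksFun j) (fun q => (-1 : k) ^ tailDegree c j •
          (signInv 𝒜 ^ tailDegree c j) (a (c.embedding j q))) := by
        simp only [suspSign_pow_eq_smul_signInv_pow, ← Int.cast_smul_eq_zsmul k, Int.cast_pow,
          Int.cast_neg, Int.cast_one]
    _ = _ := by
        rw [MultilinearMap.map_smul_univ, Finset.prod_const, Finset.card_univ, Fintype.card_fin,
          pow_mul]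

theorem compose_eq_toBar_hat (g : Family k B C) {f : Family k A B} (hf : HasDegree 𝒜 ℬ f (-1))
    {n : ℕ} (hn : n ≠ 0) (a : Fin n → A) : compose 𝒜 g f n a =
      toBar ℬ g (hat (toBar 𝒜 f) (word k (List.ofFn (twist 𝒜 a)))) := by
  rw [hat_word_ofFn (toBar_one f), map_sum, compose, sum_apply]
  refine Finset.sum_congr rfl fun c _ => ?_
  have hc : c.length ≠ 0 := (c.length_pos_iff.2 (Nat.pos_of_ne_zero hn)).ne'
  rw [toBar_ofFn g hc, funext (twist_toBar_blocks hf a c), MultilinearMap.map_smul_univ,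
    Finset.prod_pow_eq_pow_sum, ← signExp_eq_sum_tailDegree, smul_apply,
    ← Int.cast_smul_eq_zsmul k]
  push_cast
  rfl

end Desuspension

section Insertion

variable {k : Type u} [Field k]
variable {A : Type v} [AddCommGroup A] [Module k A]
variable {B : Type v} [AddCommGroup B] [Module k B]
variable {𝒜 : ℤ → Submodule k A} [DirectSum.Decomposition 𝒜]

variable (𝒜) in
/-- The word `± a₁ ⋯ aᵣ b(aᵣ₊₁, …, aᵣ₊ₛ) aᵣ₊ₛ₊₁ ⋯ aₙ` that contributes to `codiff 𝒜 b`. -/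
def insertWord (b : TensorAlgebra k A →ₗ[k] A) (r s : ℕ) (l : List A) : List A :=
  (l.take r).map (suspSign 𝒜) ++ b (word k ((l.drop r).take s)) :: (l.drop r).drop s

theorem codiff_word (b : TensorAlgebra k A →ₗ[k] A) (l : List A) :
    codiff 𝒜 b (word k l) = ∑ r ∈ Finset.range (l.length + 1),
      ∑ s ∈ Finset.range (l.length - r + 1), word k (insertWord 𝒜 b r s l) := by
  rw [codiff, coder, conv_word]
  refine Finset.sum_congr rfl fun r _ => ?_
  rw [conv_word, Finset.mul_sum, List.length_drop]
  refine Finset.sum_congr rfl fun s _ => ?_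
  rw [insertWord, word_append, word_cons, barSign, tmap_word]
  rfl

theorem word_insertWord_zero {b : TensorAlgebra k A →ₗ[k] A} (hb : b 1 = 0) (r : ℕ) (l : List A) :
    word k (insertWord 𝒜 b r 0 l) = 0 := by
  rw [insertWord, word_append, word_cons, List.take_zero, word_nil, hb, map_zero, zero_mul,
    mul_zero]

theorem codiff_word_eq_sum_Icc {b : TensorAlgebra k A →ₗ[k] A} (hb : b 1 = 0) (l : List A) :
    codiff 𝒜 b (word k l) = ∑ s ∈ Finset.Icc 1 l.length,
      ∑ r ∈ Finset.range (l.length - s + 1), word k (insertWord 𝒜 b r s l) := by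
  have hdrop (r : ℕ) :
      ∑ s ∈ Finset.range (l.length - r + 1), word k (insertWord 𝒜 b r s l) =
        ∑ s ∈ Finset.Icc 1 (l.length - r), word k (insertWord 𝒜 b r s l) := by
    rw [Finset.range_eq_Ico, ← Finset.Ico_add_one_right_eq_Icc,
      Finset.sum_eq_sum_Ico_succ_bot (Nat.succ_pos _), word_insertWord_zero hb, zero_add,
      Nat.zero_add]
    rfl
  simp only [codiff_word, hdrop]
  exact Finset.sum_comm' fun r s => by
    simp only [Finset.mem_range, Finset.mem_Icc]
    lia

/-- The sign of the `j`-th entry of `insertWord` relative to the entry that `insertAt` prescribes.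
Together these signs give the sign `(-1)^(rs + t)` of the `A_∞`-relations. -/
def insertSign (r s t j : ℕ) : ℤ := if j < r then (-1) ^ s else if j = r then (-1) ^ t else 1

theorem prod_insertSign (r s t : ℕ) :
    ∏ j : Fin (r + 1 + t), insertSign r s t j = (-1) ^ (r * s + t) := by
  have htail (j : Fin t) : insertSign r s t (r + 1 + j) = 1 := by
    rw [insertSign, if_neg (by lia), if_neg (by lia)]
  rw [Fin.prod_univ_add, Fin.prod_univ_castSucc]
  simp only [Fin.val_natAdd, htail, Finset.prod_const_one]
  simp [insertSign, pow_add, pow_mul, pow_right_comm _ r s]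

variable {m : Family k A A} {r s t : ℕ} (a : ℕ → A)

theorem take_drop_ofFn_twist :
    ((List.ofFn (twist 𝒜 fun i : Fin (r + s + t) => a i)).drop r).take s =
      List.ofFn fun q => (suspSign 𝒜 ^ t) (twist 𝒜 (fun i : Fin s => a (r + i)) q) := by
  have hlength : ((List.ofFn (twist 𝒜 fun i : Fin (r + s + t) => a i)).drop r).length = s + t := by
    rw [List.length_drop, List.length_ofFn]
    lia
  refine List.ext_getElem (by rw [List.length_take, hlength, List.length_ofFn]; lia)
    fun q hq hq' => ?_
  simp only [List.getElem_take, List.getElem_drop, List.getElem_ofFn, twist,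
    ← Module.End.mul_apply, ← pow_add]
  rw [List.length_ofFn] at hq'
  congr 2
  lia

theorem toBar_take_drop_ofFn_twist (hm : HasDegree 𝒜 𝒜 m (-2)) (hs : s ≠ 0) :
    toBar 𝒜 m (word k (((List.ofFn (twist 𝒜 fun i : Fin (r + s + t) => a i)).drop r).take s)) =
      (suspSign 𝒜 ^ t) ((-1 : ℤ) ^ t • m s fun i => a (r + i)) := by
  have hsign := hm.barHomogeneous_toBar.suspSign_pow_apply t
    (List.ofFn (twist 𝒜 fun i : Fin s => a (r + i)))
  rw [toBar_ofFn_twist m hs, List.map_ofFn] at hsign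
  rw [take_drop_ofFn_twist, map_zsmul, hsign, smul_smul, ← mul_pow]
  simp [Function.comp_def]

theorem insertWord_ofFn_twist (hm : HasDegree 𝒜 𝒜 m (-2)) (hs : s ≠ 0) :
    insertWord 𝒜 (toBar 𝒜 m) r s (List.ofFn (twist 𝒜 fun i : Fin (r + s + t) => a i)) =
      List.ofFn (twist 𝒜 fun j => insertSign r s t j • insertAt 𝒜 m r s t a j) := by
  rw [insertWord, toBar_take_drop_ofFn_twist a hm hs]
  have hr : ((List.ofFn (twist 𝒜 fun i : Fin (r + s + t) => a i)).take r).length = r := by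
    rw [List.length_take, List.length_ofFn]
    lia
  refine List.ext_getElem ?_ fun j hj hj' => ?_
  · simp only [List.length_append, List.length_map, hr, List.length_cons, List.length_drop,
      List.length_ofFn]
    lia
  rw [List.length_ofFn] at hj'
  simp only [List.getElem_append, List.length_map, hr, List.getElem_ofFn, twist, insertSign,
    insertAt]
  rcases lt_trichotomy j r with h | rfl | h
  · simp only [h, if_true, dif_pos, List.getElem_map, List.getElem_take, List.getElem_ofFn, twist,
      ← suspSign_pow_eq_smul_signInv_pow, ← Module.End.mul_apply, ← pow_add, ← pow_succ']
    exact LinearMap.congr_fun (suspSign_pow_eq_of_even_add ⟨r + t - j + s, by lia⟩) _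
  · simp [Nat.add_right_comm]
  · obtain ⟨p, rfl⟩ := Nat.exists_eq_add_of_lt h
    have hp : r + p + 1 - r = p + 1 := by lia
    simp only [h.not_gt, h.ne', if_false, dif_neg, not_false_eq_true, one_smul, hp,
      List.getElem_cons_succ, List.getElem_drop, List.getElem_ofFn, twist]
    congr 2 <;> lia

theorem smul_insertAt_eq_toBar_insertWord (f : Family k A B) (hm : HasDegree 𝒜 𝒜 m (-2))
    (hs : s ≠ 0) : (-1 : ℤ) ^ (r * s + t) • f (r + 1 + t) (insertAt 𝒜 m r s t a) =
      toBar 𝒜 f (word k (insertWord 𝒜 (toBar 𝒜 m) r s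
        (List.ofFn (twist 𝒜 fun i : Fin (r + s + t) => a i)))) := by
  rw [insertWord_ofFn_twist a hm hs, toBar_ofFn_twist f (by lia)]
  simp only [← Int.cast_smul_eq_zsmul k]
  rw [MultilinearMap.map_smul_univ, ← prod_insertSign, Int.cast_prod]

theorem insertSum_eq_toBar_codiff (f : Family k A B) (hm : HasDegree 𝒜 𝒜 m (-2)) (n : ℕ) :
    insertSum 𝒜 f m n a =
      toBar 𝒜 f (codiff 𝒜 (toBar 𝒜 m) (word k (List.ofFn (twist 𝒜 fun i : Fin n => a i)))) := by
  simp only [codiff_word_eq_sum_Icc (toBar_one m), map_sum, List.length_ofFn]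
  refine Finset.sum_congr rfl fun s hs => ?_
  obtain ⟨hs_pos, hs_le⟩ := Finset.mem_Icc.1 hs
  rw [Finset.Nat.sum_antidiagonal_eq_sum_range_succ_mk]
  refine Finset.sum_congr rfl fun r hr => ?_
  obtain ⟨t, ht⟩ : ∃ t, n - s = r + t := Nat.exists_eq_add_of_le (Finset.mem_range_succ_iff.1 hr)
  obtain rfl : n = r + s + t := by lia
  rw [ht, Nat.add_sub_cancel_left]
  exact smul_insertAt_eq_toBar_insertWord a f hm (Nat.one_le_iff_ne_zero.1 hs_pos)

theorem exists_twist_eq (l : List A) :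
    ∃ a : ℕ → A, List.ofFn (twist 𝒜 fun i : Fin l.length => a i) = l := by
  refine ⟨fun i => if h : i < l.length then twist 𝒜 l.get ⟨i, h⟩ else 0, ?_⟩
  simp only [Fin.is_lt, dif_pos, Fin.eta]
  exact (congrArg List.ofFn (twist_twist l.get)).trans (List.ofFn_get l)

end Insertion

section Equivalence

variable {k : Type u} [Field k]
variable {A : Type v} [AddCommGroup A] [Module k A]
variable {B : Type v} [AddCommGroup B] [Module k B]
variable {𝒜 : ℤ → Submodule k A} [DirectSum.Decomposition 𝒜]
variable {ℬ : ℤ → Submodule k B} [DirectSum.Decomposition ℬ]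

theorem codiff_one {b : TensorAlgebra k A →ₗ[k] A} (hb : b 1 = 0) : codiff 𝒜 b 1 = 0 := by
  rw [← word_nil, codiff_word_eq_sum_Icc hb]
  rfl

theorem ext_word_ofFn_twist {E : Type*} [AddCommMonoid E] [Module k E]
    {f g : TensorAlgebra k A →ₗ[k] E} (h1 : f 1 = g 1)
    (h : ∀ (n : ℕ) (a : ℕ → A), 1 ≤ n →
      f (word k (List.ofFn (twist 𝒜 fun i : Fin n => a i))) =
        g (word k (List.ofFn (twist 𝒜 fun i : Fin n => a i)))) : f = g := by
  refine ext_word fun l => ?_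
  rcases l.length.eq_zero_or_pos with hl | hl
  · rw [List.length_eq_zero_iff.1 hl, word_nil, h1]
  · obtain ⟨a, ha⟩ := exists_twist_eq (𝒜 := 𝒜) l
    rw [← ha]
    exact h _ a hl

theorem Structure.isBarStructure (S : Structure 𝒜) : IsBarStructure 𝒜 (toBar 𝒜 S.m) where
  map_one := toBar_one _
  homogeneous := S.degree.barHomogeneous_toBar
  comp_codiff := by
    refine ext_word_ofFn_twist (𝒜 := 𝒜) ?_ fun n a hn => ?_
    · rw [LinearMap.comp_apply, codiff_one (toBar_one _), map_zero, LinearMap.zero_apply]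
    · exact (insertSum_eq_toBar_codiff a S.m S.degree n).symm.trans (S.assoc n hn a)

/-- The `A_∞`-structure that corresponds to a coderivation of square zero. -/
def IsBarStructure.toStructure {b : TensorAlgebra k A →ₗ[k] A} (hb : IsBarStructure 𝒜 b) :
    Structure 𝒜 where
  m := ofBar 𝒜 b
  degree := BarHomogeneous.hasDegree_ofBar hb.homogeneous
  assoc n _ a := by
    rw [insertSum_eq_toBar_codiff _ _ (BarHomogeneous.hasDegree_ofBar hb.homogeneous),
      toBar_ofBar hb.map_one]
    exact LinearMap.congr_fun hb.comp_codiff _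

theorem IsBarStructure.toBar_toStructure {b : TensorAlgebra k A →ₗ[k] A}
    (hb : IsBarStructure 𝒜 b) : toBar 𝒜 hb.toStructure.m = b := toBar_ofBar hb.map_one

theorem Morphism.isBarMorphism {S : Structure 𝒜} {T : Structure ℬ} (φ : Morphism S T) :
    IsBarMorphism 𝒜 ℬ (toBar 𝒜 S.m) (toBar ℬ T.m) (toBar 𝒜 φ.f) where
  map_one := toBar_one _
  homogeneous := φ.degree.barHomogeneous_toBar
  comp_codiff := by
    refine ext_word_ofFn_twist (𝒜 := 𝒜) ?_ fun n a hn => ?_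
    · rw [LinearMap.comp_apply, codiff_one (toBar_one _), map_zero, LinearMap.comp_apply,
        hat_one (toBar_one _), toBar_one]
    · have h := φ.comm n hn a
      rwa [insertSum_eq_toBar_codiff _ _ S.degree,
        compose_eq_toBar_hat _ φ.degree (Nat.one_le_iff_ne_zero.1 hn)] at h

/-- The `A_∞`-morphism that corresponds to a map of tensor coalgebras. -/
def IsBarMorphism.toMorphism {S : Structure 𝒜} {T : Structure ℬ} {F : TensorAlgebra k A →ₗ[k] B}
    (hF : IsBarMorphism 𝒜 ℬ (toBar 𝒜 S.m) (toBar ℬ T.m) F) : Morphism S T where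
  f := ofBar 𝒜 F
  degree := BarHomogeneous.hasDegree_ofBar hF.homogeneous
  comm n hn a := by
    rw [insertSum_eq_toBar_codiff _ _ S.degree,
      compose_eq_toBar_hat _ (BarHomogeneous.hasDegree_ofBar hF.homogeneous)
        (Nat.one_le_iff_ne_zero.1 hn), toBar_ofBar hF.map_one]
    exact LinearMap.congr_fun hF.comp_codiff _

theorem ιInv_word_ofFn_twist {n : ℕ} (hn : 1 ≤ n) (a : Fin n → A) :
    ιInv (word k (List.ofFn (twist 𝒜 a))) = idFamily k A n a := by
  match n with
  | 1 => rw [twist_one, List.ofFn_succ, List.ofFn_zero, word_singleton, ιInv_ι]; rfl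
  | n + 2 => exact ιInv_word_of_length_ne (by simp)

theorem compose_ofBar_eq_idFamily {F : TensorAlgebra k A →ₗ[k] B} {G : TensorAlgebra k B →ₗ[k] A}
    (hF1 : F 1 = 0) (hF : BarHomogeneous 𝒜 (suspension ℬ) 0 F) (hG1 : G 1 = 0)
    (h : hat G ∘ₗ hat F = LinearMap.id) {n : ℕ} (hn : 1 ≤ n) :
    compose 𝒜 (ofBar ℬ G) (ofBar 𝒜 F) n = idFamily k A n := by
  ext a
  calc compose 𝒜 (ofBar ℬ G) (ofBar 𝒜 F) n a
      = G (hat F (word k (List.ofFn (twist 𝒜 a)))) := by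
        rw [compose_eq_toBar_hat _ (BarHomogeneous.hasDegree_ofBar hF)
          (Nat.one_le_iff_ne_zero.1 hn), toBar_ofBar hF1, toBar_ofBar hG1]
    _ = ιInv (word k (List.ofFn (twist 𝒜 a))) := by
        rw [← ιInv_hat hG1, ← LinearMap.comp_apply (f := hat G), h, LinearMap.id_apply]
    _ = idFamily k A n a := ιInv_word_ofFn_twist hn a

theorem isomorphic_of_isBarMorphism {S : Structure 𝒜} {T : Structure ℬ}
    {F : TensorAlgebra k A →ₗ[k] B} {G : TensorAlgebra k B →ₗ[k] A}
    (hF : IsBarMorphism 𝒜 ℬ (toBar 𝒜 S.m) (toBar ℬ T.m) F)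
    (hG : IsBarMorphism ℬ 𝒜 (toBar ℬ T.m) (toBar 𝒜 S.m) G)
    (hGF : hat G ∘ₗ hat F = LinearMap.id) (hFG : hat F ∘ₗ hat G = LinearMap.id) :
    Isomorphic S T :=
  ⟨hF.toMorphism, hG.toMorphism,
    fun _ hn => compose_ofBar_eq_idFamily hF.map_one hF.homogeneous hG.map_one hGF hn,
    fun _ hn => compose_ofBar_eq_idFamily hG.map_one hG.homogeneous hF.map_one hFG hn⟩

end Equivalence

section MinimalModels

variable {k : Type u} [Field k]
variable {A : Type v} [AddCommGroup A] [Module k A]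
variable {B : Type v} [AddCommGroup B] [Module k B]
variable {𝒜 : ℤ → Submodule k A} [DirectSum.Decomposition 𝒜]
variable {ℬ : ℤ → Submodule k B} [DirectSum.Decomposition ℬ]
variable {S : Structure 𝒜}

theorem Structure.toBar_comp_ι (S : Structure 𝒜) : toBar 𝒜 S.m ∘ₗ ι k = S.diff :=
  LinearMap.ext (toBar_ι S.m)

theorem ofBar_two {F : TensorAlgebra k A →ₗ[k] B} (x y : A) :
    ofBar 𝒜 F 2 ![x, y] = F (word k [suspSign 𝒜 x, y]) := by
  rw [ofBar_apply, ofFn_twist_pair]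

theorem toBar_word_suspSign_pair (f : Family k A B) (x y : A) :
    toBar 𝒜 f (word k [suspSign 𝒜 x, y]) = f 2 ![x, y] := by
  rw [← ofFn_twist_pair, toBar_ofFn_twist f two_ne_zero]

namespace Structure

variable (S) in
theorem exists_barContraction :
    ∃ c : Contraction 𝒜 S.homologyGrading (toBar 𝒜 S.m ∘ₗ ι k),
      ∀ z : S.cycles, c.proj z = S.cls z := by
  rw [S.toBar_comp_ι]
  exact S.exists_contraction

theorem contraction_incl_mem_cycles (c : Contraction 𝒜 S.homologyGrading (toBar 𝒜 S.m ∘ₗ ι k))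
    (x : S.Homology) : c.incl x ∈ S.cycles := by
  rw [mem_cycles, ← toBar_comp_ι]
  exact LinearMap.congr_fun c.diff_comp_incl x

variable {c : Contraction 𝒜 S.homologyGrading (toBar 𝒜 S.m ∘ₗ ι k)}

theorem cls_contraction_incl (hc : ∀ z : S.cycles, c.proj z = S.cls z) (x : S.Homology) :
    S.cls ⟨c.incl x, contraction_incl_mem_cycles c x⟩ = x :=
  (hc _).symm.trans (LinearMap.congr_fun c.proj_comp_incl x)

theorem contraction_proj_mul_incl (hc : ∀ z : S.cycles, c.proj z = S.cls z) (x y : S.Homology) :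
    c.proj (S.m 2 ![c.incl x, c.incl y]) = S.inducedProduct x y := by
  have hx := cls_contraction_incl hc x
  have hy := cls_contraction_incl hc y
  calc c.proj (S.m 2 ![c.incl x, c.incl y])
      = S.cls (S.cycleMul ⟨c.incl x, contraction_incl_mem_cycles c x⟩
          ⟨c.incl y, contraction_incl_mem_cycles c y⟩) := hc (S.cycleMul ⟨_, _⟩ ⟨_, _⟩)
    _ = S.inducedProduct x y := by rw [← inducedProduct_cls, hx, hy]

theorem m_one_eq_zero_of_diff_eq_zero (h : S.diff = 0) : S.m 1 = 0 := by
  ext a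
  have ha : a = fun _ => a 0 := funext fun i => congrArg a (Subsingleton.elim _ _)
  rw [ha]
  exact LinearMap.congr_fun h (a 0)

end Structure

theorem nonempty_minimalModel_of_morphism {T : Structure S.homologyGrading} (φ : Morphism T S)
    (h_one : T.m 1 = 0) (h_two : ∀ x y, T.m 2 ![x, y] = S.inducedProduct x y)
    (h_cycle : ∀ x, linPart φ.f x ∈ S.cycles)
    (h_cls : ∀ x, S.cls ⟨linPart φ.f x, h_cycle x⟩ = x) : Nonempty (MinimalModel S) := by
  have hid (x : T.cycles) : φ.homologyMap (T.cls x) = (x : S.Homology) := h_cls x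
  have hcycles (x : S.Homology) : x ∈ T.cycles := by
    rw [Structure.mem_cycles, Structure.diff, linPart_apply, h_one, zero_apply]
  refine ⟨⟨T, h_one, h_two, φ, ⟨?_, fun x => ⟨T.cls ⟨x, hcycles x⟩, hid _⟩⟩, hid⟩⟩
  refine (injective_iff_map_eq_zero _).2 fun x hx => ?_
  obtain ⟨x, rfl⟩ := T.cls_surjective x
  rw [hid] at hx
  rw [show x = 0 from Subtype.ext hx, map_zero]

theorem Structure.exists_minimalModel (S : Structure 𝒜) : Nonempty (MinimalModel S) := by
  obtain ⟨c, hc⟩ := S.exists_barContraction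
  obtain ⟨b', I, -, hb', hI, -, hIι, -, hb'ι, hb'_pair⟩ := c.exists_transfer S.isBarStructure
  rw [← hb'.toBar_toStructure] at hI hb'ι
  have hlin (x : S.Homology) : linPart hI.toMorphism.f x = c.incl x :=
    (linPart_ofBar hI.map_one x).trans (LinearMap.congr_fun hIι x)
  refine nonempty_minimalModel_of_morphism hI.toMorphism
    (m_one_eq_zero_of_diff_eq_zero ((toBar_comp_ι _).symm.trans hb'ι)) (fun x y => ?_)
    (fun x => (hlin x).symm ▸ contraction_incl_mem_cycles c x) fun x => ?_
  · calc ofBar S.homologyGrading b' 2 ![x, y]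
        = c.proj (toBar 𝒜 S.m (word k [suspSign 𝒜 (c.incl x), c.incl y])) := by
          rw [ofBar_two, hb'_pair, ← LinearMap.comp_apply c.incl, ← suspSign_comp_of_mem c.incl_mem,
            LinearMap.comp_apply]
      _ = S.inducedProduct x y := by
          rw [toBar_word_suspSign_pair, contraction_proj_mul_incl hc]
  · simp only [hlin]
    exact cls_contraction_incl hc x

theorem isomorphic_of_comp_ι_eq_id {T : Structure 𝒜} {F : TensorAlgebra k A →ₗ[k] A}
    (hF : IsBarMorphism 𝒜 𝒜 (toBar 𝒜 S.m) (toBar 𝒜 T.m) F) (hι : F ∘ₗ ι k = LinearMap.id) :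
    Isomorphic S T := by
  obtain ⟨G, hG, -, hFG, hGF⟩ := hF.exists_inverse hι
  exact isomorphic_of_isBarMorphism hF hG hGF hFG

theorem comp_hat_comp_ι {E : Type*} [AddCommMonoid E] [Module k E] {F : TensorAlgebra k A →ₗ[k] B}
    {G : TensorAlgebra k B →ₗ[k] E} (hF1 : F 1 = 0) :
    (G ∘ₗ hat F) ∘ₗ ι k = (G ∘ₗ ι k) ∘ₗ F ∘ₗ ι k :=
  LinearMap.ext fun a => congrArg G (hat_ι hF1 a)

namespace MinimalModel

theorem linPart_incl_mem_cycles (M : MinimalModel S) (x : S.Homology) :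
    linPart M.incl.f x ∈ S.cycles := by
  rw [Structure.mem_cycles, ← Morphism.linPart_diff, Structure.diff, linPart_apply M.str.m,
    M.m_one, zero_apply, map_zero]

theorem cls_linPart_incl (M : MinimalModel S) (x : S.Homology) :
    S.cls ⟨linPart M.incl.f x, M.linPart_incl_mem_cycles x⟩ = x :=
  M.induces_id ⟨x, by rw [Structure.mem_cycles, Structure.diff, linPart_apply, M.m_one, zero_apply]⟩

theorem comp_hat_incl_comp_ι (M : MinimalModel S) {P : TensorAlgebra k A →ₗ[k] S.Homology}
    (hP : ∀ z : S.cycles, P (ι k z) = S.cls z) :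
    (P ∘ₗ hat (toBar S.homologyGrading M.incl.f)) ∘ₗ ι k = LinearMap.id := by
  rw [comp_hat_comp_ι (toBar_one _)]
  refine LinearMap.ext fun x => ?_
  rw [LinearMap.comp_apply, LinearMap.comp_apply, LinearMap.comp_apply, toBar_ι]
  exact (hP ⟨_, M.linPart_incl_mem_cycles x⟩).trans (M.cls_linPart_incl x)

theorem isomorphic (M N : MinimalModel S) : Isomorphic M.str N.str := by
  obtain ⟨c, hc⟩ := S.exists_barContraction
  obtain ⟨b', -, P, -, -, hP, -, hPι, -, -⟩ := c.exists_transfer S.isBarStructure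
  have hPcls (z : S.cycles) : P (ι k z) = S.cls z := (LinearMap.congr_fun hPι z).trans (hc z)
  have hM := hP.comp M.incl.isBarMorphism
  have hN := hP.comp N.incl.isBarMorphism
  obtain ⟨G, hG, hGι, -⟩ := hN.exists_inverse (N.comp_hat_incl_comp_ι hPcls)
  refine isomorphic_of_comp_ι_eq_id (hG.comp hM) ?_
  rw [comp_hat_comp_ι hM.map_one, hGι, M.comp_hat_incl_comp_ι hPcls, LinearMap.id_comp]

end MinimalModel

end MinimalModels

end AInfinity

end

theorem mainTheorem1 {k : Type*} [Field k] {A : Type*} [AddCommGroup A] [Module k A]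
    (𝒜 : ℤ → Submodule k A) [DirectSum.Decomposition 𝒜] (S : AInfinity.Structure 𝒜) :
    Nonempty (AInfinity.MinimalModel S) ∧
      ∀ M N : AInfinity.MinimalModel S, AInfinity.Isomorphic M.str N.str :=
  ⟨S.exists_minimalModel, AInfinity.MinimalModel.isomorphic⟩
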